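/- **Games.** An asynchronous game $G$ is a graph with positions $V_G$, transitions $E_G$, an initial position from which all positions are reachable, a polarity $O$ (Opponent) or $P$ (Proponent) on transitions, and a symmetric tiling relation $m\cdot p\diamond n\cdot q$ between coinitial and cofinal paths of length two, such that $m\cdot p$ lies in at most one tile, a transition has at most one residual after another one ($q$ is the residual of $m$ after $n$, and $p$ that of $n$ after $m$), and residuals have the same polarity. Homotopy $\sim$ is the congruence on paths generated by $\diamond$. A play is a path from the initial position. $G^*$ is $G$ with polarities inverted; $G\|H$ is the asynchronous product. Write $x\le y$ if there is a path $x\to y$. Fix an interpretation of propositional variables by *sequential* games: no tiles, exactly one play to each position, no infinite path, and all transitions from a given position have the same polarity (for instance games with a single transition). A MALL formula $A$ (without units) is interpreted by a game, also written $A$: $A⅋B$ (resp. $A\otimes B$) is $A\|B$ preceded by a new initial position $\dagger$ and one Opponent (resp. Proponent) transition to the initial position of $A\|B$; $A\& B$ (resp. $A\oplus B$) is the disjoint union of $A$ and $B$ preceded by $\dagger$ and an Opponent (resp. Proponent) transition to each of the two initial positions; $(X^*)$ is interpreted by the dual of the game of $X$. **Strategies.** A strategy $\sigma$ on $G$ is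 a prefix-closed set of plays containing the empty play; its graph $G_\sigma$ consists of the positions and transitions met by its plays. It is *ingenuous* if it is: positional ($s\cdot u\in\sigma$, $s\sim t$, $t\in\sigma$ imply $t\cdot u\in\sigma$); deterministic (if $m\neq n$ in $G_\sigma$ have the same source and $m$ is a Proponent transition, then $m$ has a residual after $n$, and it is in $G_\sigma$); receptive (every play in $\sigma$ can be extended in $\sigma$ by every Opponent transition of $G$ from its target); total (if no Opponent transition of $G$ starts from the target $x$ of a play $s\in\sigma$, then no transition at all starts from $x$ or $s\cdot m\in\sigma$ for some Proponent transition $m$); courteous (if $m\cdot p\diamond n\cdot q$, $m,p$ are in $G_\sigma$, and $m$ is Proponent or $p$ is Opponent, then $n,q$ are in $G_\sigma$); closed under residuals (if $m\cdot p\diamond n\cdot q$ and $m,n$ are in $G_\sigma$ then so are $p,q$); if $G_\sigma$ has the cube property (two coinitial and cofinal paths of length three that are related by three tiles of $G_\sigma$ on one side of the cube they span are also related by three tiles of $G_\sigma$ on the other side); and if it is stable (the meet of two positions of $G_\sigma$ is in $G_\sigma$). A strategy $\sigma:A\to B$ is a strategy on $A^*\|B$. The composite $\tau\circ\sigma:A\to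 C$ of $\sigma:A\to B$ and $\tau:B\to C$ consists of the restrictions to $A^*\|C$ of the plays on $A\|B\|C$ whose projections on $A^*\|B$ and $B^*\|C$ are in $\sigma$ and $\tau$. The identity on $A$ is the copy-cat strategy: the plays on $A^*\|A$ all of whose positions $(x,y)$ are such that, for some position $z$, there are a path $z\to x$ of Proponent transitions of $A$ and a path $z\to y$ of Opponent transitions of $A$. **Scheduling criterion.** $\sigma:A\to B$ satisfies the scheduling criterion if, for every choice, for each tensor subformula of $A^*$ and of $B$, of one of its two components, every play of $\sigma$ is homotopic to a play of $\sigma$ in which, for each of these tensors, all moves in the chosen component come before all moves in the other one. **Concurrent games.** The objects are partial orders $D$ in which nonempty subsets have meets and nonempty directed subsets have joins. A morphism $D\to E$ is a concurrent strategy on the complete lattice $(D\times E)_\top$ obtained from $D\times E$ by adding a top element, i.e. a closure operator that preserves directed joins. The identity is the one whose fixpoints are $\top$ and the pairs $(x,x)$; the composite of $\varsigma:D\to E$ and $\varsigma':E\to F$ is the one whose fixpoints are $\top$ and the pairs $(x,z)$ such that for some $y$, $(x,y)$ is a fixpoint of $\varsigma$ and $(y,z)$ one of $\varsigma'$. **Theorem.**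 (1) Copy-cat strategies between formulas are ingenuous and satisfy the scheduling criterion; if $\sigma:A\to B$ and $\tau:B\to C$ are ingenuous and satisfy the scheduling criterion, then so does $\tau\circ\sigma$. Composition of ingenuous strategies is associative, with the copy-cat strategies as units. Hence formulas and ingenuous strategies satisfying the scheduling criterion form a category. (2) For $\sigma:A\to B$ let $\sigma^\circ$ be the set of halting positions of $\sigma$ (positions of $G_\sigma$ from which no Proponent transition of $G_\sigma$ starts). For $\sigma$ ingenuous and satisfying the scheduling criterion, $w\mapsto\bigwedge\{y\in\sigma^\circ\mid w\le y\}$ is a concurrent strategy on $(V_A\times V_B)_\top$, and this defines a functor from the category in (1) to the category of concurrent games, which sends $A$ to the partial order $(V_A,\le)$: it preserves identities and composition. -/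

import Mathlib

namespace AsyncConc

/-! ### Asynchronous games -/

/-- The two players: Opponent `O` and Proponent `P`. -/
inductive Polarity
  | O
  | P

/-- Exchange of the two players. -/
def Polarity.opp : Polarity → Polarity
  | .O => .P
  | .P => .O

/-- `IsPathOn src tgt x l y`: the list of transitions `l` is a path from `x` to `y`. -/
def IsPathOn {V E : Type} (src tgt : E → V) : V → List E → V → Prop
  | x, [], y => x = y
  | x, e :: l, y => src e = x ∧ IsPathOn src tgt (tgt e) l y

/-- Asynchronous games: a graph with a tiling relation on paths of length two, an initial position
and polarities.  `tile m p n q` says that the paths `m · p` and `n · q` form a tile. -/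
structure AsyncGame where
  V : Type
  E : Type
  src : E → V
  tgt : E → V
  tile : E → E → E → E → Prop
  init : V
  pol : E → Polarity
  tile_bound : ∀ {m p n q}, tile m p n q →
    src m = src n ∧ tgt m = src p ∧ tgt n = src q ∧ tgt p = tgt q
  tile_symm : ∀ {m p n q}, tile m p n q → tile n q m p
  tile_unique : ∀ {m p n q n' q'}, tile m p n q → tile m p n' q' → n = n' ∧ q = q'
  residual_unique : ∀ {m p n q p' q'}, tile m p n q → tile m p' n q' → q = q'
  tile_pol : ∀ {m p n q}, tile m p n q → pol m = pol q ∧ pol n = pol p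
  reachable : ∀ x, ∃ s, IsPathOn src tgt init s x

theorem isPathOn_append {V E : Type} {src tgt : E → V} {x y z : V} {s t : List E}
    (hs : IsPathOn src tgt x s y) (ht : IsPathOn src tgt y t z) :
    IsPathOn src tgt x (s ++ t) z := by
  induction s generalizing x with
  | nil => cases hs; exact ht
  | cons e s ih => exact ⟨hs.1, ih hs.2⟩

theorem isPathOn_append_inv {V E : Type} {src tgt : E → V} {x z : V} {s t : List E}
    (h : IsPathOn src tgt x (s ++ t) z) :
    ∃ y, IsPathOn src tgt x s y ∧ IsPathOn src tgt y t z := by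
  induction s generalizing x with
  | nil => exact ⟨x, rfl, h⟩
  | cons e s ih =>
    obtain ⟨y, h1, h2⟩ := ih h.2
    exact ⟨y, ⟨h.1, h1⟩, h2⟩

theorem isPathOn_map {V E V' E' : Type} {src tgt : E → V} {src' tgt' : E' → V'}
    (f : V → V') (g : E → E') (hs : ∀ e, src' (g e) = f (src e)) (ht : ∀ e, tgt' (g e) = f (tgt e))
    {x y : V} {s : List E} (h : IsPathOn src tgt x s y) :
    IsPathOn src' tgt' (f x) (s.map g) (f y) := by
  induction s generalizing x with
  | nil => cases h; rfl
  | cons e s ih =>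
    refine ⟨(hs e).trans (congrArg f h.1), ?_⟩
    rw [ht]
    exact ih h.2

/-- Projection of a path along a graph map that may collapse some transitions. -/
theorem isPathOn_filterMap {V E V' E' : Type} {src tgt : E → V} {src' tgt' : E' → V'}
    (f : V → V') (g : E → Option E')
    (hnone : ∀ e, g e = none → f (src e) = f (tgt e))
    (hsome : ∀ e e', g e = some e' → src' e' = f (src e) ∧ tgt' e' = f (tgt e))
    {x y : V} {s : List E} (h : IsPathOn src tgt x s y) :
    IsPathOn src' tgt' (f x) (s.filterMap g) (f y) := by
  induction s generalizing x with
  | nil => cases h; rfl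
  | cons e s ih =>
    obtain ⟨rfl, h2⟩ := h
    cases hg : g e with
    | none => rw [List.filterMap_cons_none hg, hnone e hg]; exact ih h2
    | some e' =>
      rw [List.filterMap_cons_some hg]
      obtain ⟨h1, h3⟩ := hsome e e' hg
      refine ⟨h1, ?_⟩
      rw [h3]
      exact ih h2

namespace AsyncGame

/-- `G.Path x s y`: `s` is a path from `x` to `y` in `G`. -/
def Path (G : AsyncGame) (x : G.V) (s : List G.E) (y : G.V) : Prop :=
  IsPathOn G.src G.tgt x s y

/-- The order on positions: there is a path from `x` to `y`. -/
def Reach (G : AsyncGame) (x y : G.V) : Prop := ∃ s, G.Path x s y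

/-- A play is a path that starts at the initial position. -/
def IsPlay (G : AsyncGame) (s : List G.E) : Prop := ∃ x, G.Path G.init s x

/-- Homotopy of paths: the smallest congruence that contains the tiling relation. -/
inductive Homotopic (G : AsyncGame) : List G.E → List G.E → Prop
  | refl (s) : Homotopic G s s
  | symm {s t} : Homotopic G s t → Homotopic G t s
  | trans {s t u} : Homotopic G s t → Homotopic G t u → Homotopic G s u
  | tile (u v) {m p n q} : G.tile m p n q → Homotopic G (u ++ m :: p :: v) (u ++ n :: q :: v)

/-- The game with polarities inverted. -/
def dual (G : AsyncGame) : AsyncGame where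
  V := G.V
  E := G.E
  src := G.src
  tgt := G.tgt
  tile := G.tile
  init := G.init
  pol e := (G.pol e).opp
  tile_bound := G.tile_bound
  tile_symm := G.tile_symm
  tile_unique := G.tile_unique
  residual_unique := G.residual_unique
  tile_pol h := ⟨congrArg _ (G.tile_pol h).1, congrArg _ (G.tile_pol h).2⟩
  reachable := G.reachable

/-- Tiles of the asynchronous product: tiles of each component, and one tile for each pair of
transitions in different components. -/
inductive ProdTile (G H : AsyncGame) :
    (G.E × H.V) ⊕ (G.V × H.E) → (G.E × H.V) ⊕ (G.V × H.E) →
    (G.E × H.V) ⊕ (G.V × H.E) → (G.E × H.V) ⊕ (G.V × H.E) → Prop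
  | left (y : H.V) {m p n q : G.E} : G.tile m p n q →
      ProdTile G H (.inl (m, y)) (.inl (p, y)) (.inl (n, y)) (.inl (q, y))
  | right (x : G.V) {m p n q : H.E} : H.tile m p n q →
      ProdTile G H (.inr (x, m)) (.inr (x, p)) (.inr (x, n)) (.inr (x, q))
  | leftRight (m : G.E) (n : H.E) :
      ProdTile G H (.inl (m, H.src n)) (.inr (G.tgt m, n)) (.inr (G.src m, n)) (.inl (m, H.tgt n))
  | rightLeft (m : G.E) (n : H.E) :
      ProdTile G H (.inr (G.src m, n)) (.inl (m, H.tgt n)) (.inl (m, H.src n)) (.inr (G.tgt m, n))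

/-- Sources in the asynchronous product. -/
def prodSrc (G H : AsyncGame) : (G.E × H.V) ⊕ (G.V × H.E) → G.V × H.V
  | .inl (m, y) => (G.src m, y)
  | .inr (x, n) => (x, H.src n)

/-- Targets in the asynchronous product. -/
def prodTgt (G H : AsyncGame) : (G.E × H.V) ⊕ (G.V × H.E) → G.V × H.V
  | .inl (m, y) => (G.tgt m, y)
  | .inr (x, n) => (x, H.tgt n)

/-- Polarities in the asynchronous product. -/
def prodPol (G H : AsyncGame) : (G.E × H.V) ⊕ (G.V × H.E) → Polarity
  | .inl (m, _) => G.pol m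
  | .inr (_, n) => H.pol n

theorem prod_path (G H : AsyncGame) {x x' : G.V} {y y' : H.V} {s : List G.E} {t : List H.E}
    (hs : G.Path x s x') (ht : H.Path y t y') :
    ∃ u, IsPathOn (prodSrc G H) (prodTgt G H) (x, y) u (x', y') :=
  ⟨s.map (fun m => .inl (m, y)) ++ t.map (fun n => .inr (x', n)),
    isPathOn_append
      (isPathOn_map (src := G.src) (tgt := G.tgt) (src' := prodSrc G H) (tgt' := prodTgt G H)
        (fun v => (v, y)) (fun m => .inl (m, y)) (fun _ => rfl) (fun _ => rfl) hs)
      (isPathOn_map (src := H.src) (tgt := H.tgt) (src' := prodSrc G H) (tgt' := prodTgt G H)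
        (fun v => (x', v)) (fun n => .inr (x', n)) (fun _ => rfl) (fun _ => rfl) ht)⟩

/-- The asynchronous product `G ∥ H`. -/
def prod (G H : AsyncGame) : AsyncGame where
  V := G.V × H.V
  E := (G.E × H.V) ⊕ (G.V × H.E)
  src := prodSrc G H
  tgt := prodTgt G H
  tile := ProdTile G H
  init := (G.init, H.init)
  pol := prodPol G H
  tile_bound := by
    rintro _ _ _ _ (⟨y, h⟩ | ⟨x, h⟩ | _ | _)
    · obtain ⟨h1, h2, h3, h4⟩ := G.tile_bound h
      simp [prodSrc, prodTgt, h1, h2, h3, h4]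
    · obtain ⟨h1, h2, h3, h4⟩ := H.tile_bound h
      simp [prodSrc, prodTgt, h1, h2, h3, h4]
    · simp [prodSrc, prodTgt]
    · simp [prodSrc, prodTgt]
  tile_symm := by
    rintro _ _ _ _ (⟨y, h⟩ | ⟨x, h⟩ | _ | _)
    · exact .left y (G.tile_symm h)
    · exact .right x (H.tile_symm h)
    · exact .rightLeft _ _
    · exact .leftRight _ _
  tile_unique := by
    rintro _ _ _ _ n' q' (⟨y, h⟩ | ⟨x, h⟩ | ⟨m, n⟩ | ⟨m, n⟩) h'
    · cases h' with
      | left _ h' => obtain ⟨rfl, rfl⟩ := G.tile_unique h h'; exact ⟨rfl, rfl⟩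
    · cases h' with
      | right _ h' => obtain ⟨rfl, rfl⟩ := H.tile_unique h h'; exact ⟨rfl, rfl⟩
    · generalize hy : H.src n = y at h'
      generalize hx : G.tgt m = x at h'
      cases h' with
      | leftRight => exact ⟨rfl, rfl⟩
    · generalize hy : H.tgt n = y at h'
      generalize hx : G.src m = x at h'
      cases h' with
      | rightLeft => exact ⟨rfl, rfl⟩
  residual_unique := by
    rintro _ _ _ _ p' q' (⟨y, h⟩ | ⟨x, h⟩ | ⟨m, n⟩ | ⟨m, n⟩) h'
    · cases h' with
      | left _ h' => cases G.residual_unique h h'; rfl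
    · cases h' with
      | right _ h' => cases H.residual_unique h h'; rfl
    · generalize hy : H.src n = y at h'
      generalize hx : G.src m = x at h'
      cases h' with
      | leftRight => rfl
    · generalize hy : H.src n = y at h'
      generalize hx : G.src m = x at h'
      cases h' with
      | rightLeft => rfl
  tile_pol := by
    rintro _ _ _ _ (⟨y, h⟩ | ⟨x, h⟩ | _ | _)
    · exact G.tile_pol h
    · exact H.tile_pol h
    · exact ⟨rfl, rfl⟩
    · exact ⟨rfl, rfl⟩
  reachable := by
    rintro ⟨x, y⟩
    obtain ⟨s, hs⟩ := G.reachable x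
    obtain ⟨t, ht⟩ := H.reachable y
    exact prod_path G H hs ht

/-- Tiles of `choice p ι G`: those of each component. -/
inductive ChoiceTile {ι : Type} (G : ι → AsyncGame) :
    ι ⊕ (Σ i, (G i).E) → ι ⊕ (Σ i, (G i).E) → ι ⊕ (Σ i, (G i).E) → ι ⊕ (Σ i, (G i).E) → Prop
  | mk (i : ι) {m p n q : (G i).E} : (G i).tile m p n q →
      ChoiceTile G (.inr ⟨i, m⟩) (.inr ⟨i, p⟩) (.inr ⟨i, n⟩) (.inr ⟨i, q⟩)

/-- Sources in `choice p ι G`. -/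
def choiceSrc {ι : Type} (G : ι → AsyncGame) : ι ⊕ (Σ i, (G i).E) → Option (Σ i, (G i).V)
  | .inl _ => none
  | .inr ⟨i, m⟩ => some ⟨i, (G i).src m⟩

/-- Targets in `choice p ι G`. -/
def choiceTgt {ι : Type} (G : ι → AsyncGame) : ι ⊕ (Σ i, (G i).E) → Option (Σ i, (G i).V)
  | .inl i => some ⟨i, (G i).init⟩
  | .inr ⟨i, m⟩ => some ⟨i, (G i).tgt m⟩

/-- Polarities in `choice p ι G`. -/
def choicePol {ι : Type} (p : Polarity) (G : ι → AsyncGame) : ι ⊕ (Σ i, (G i).E) → Polarity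
  | .inl _ => p
  | .inr ⟨i, m⟩ => (G i).pol m

/-- The disjoint union of the games `G i` with a new initial position `†` (`none`) and, for each
`i`, a transition of polarity `p` from `†` to the initial position of `G i`. -/
def choice (p : Polarity) (ι : Type) (G : ι → AsyncGame) : AsyncGame where
  V := Option (Σ i, (G i).V)
  E := ι ⊕ (Σ i, (G i).E)
  src := choiceSrc G
  tgt := choiceTgt G
  tile := ChoiceTile G
  init := none
  pol := choicePol p G
  tile_bound := by
    rintro _ _ _ _ ⟨i, h⟩
    obtain ⟨h1, h2, h3, h4⟩ := (G i).tile_bound h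
    simp [choiceSrc, choiceTgt, h1, h2, h3, h4]
  tile_symm := by
    rintro _ _ _ _ ⟨i, h⟩
    exact .mk i ((G i).tile_symm h)
  tile_unique := by
    rintro _ _ _ _ n' q' ⟨i, h⟩ h'
    cases h' with
    | mk _ h' => obtain ⟨rfl, rfl⟩ := (G i).tile_unique h h'; exact ⟨rfl, rfl⟩
  residual_unique := by
    rintro _ _ _ _ p' q' ⟨i, h⟩ h'
    cases h' with
    | mk _ h' => cases (G i).residual_unique h h'; rfl
  tile_pol := by
    rintro _ _ _ _ ⟨i, h⟩
    exact (G i).tile_pol h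
  reachable := by
    rintro (_ | ⟨i, x⟩)
    · exact ⟨[], rfl⟩
    · obtain ⟨s, hs⟩ := (G i).reachable x
      exact ⟨.inl i :: s.map (fun m => .inr ⟨i, m⟩), rfl,
        isPathOn_map (src := (G i).src) (tgt := (G i).tgt) (src' := choiceSrc G)
          (tgt' := choiceTgt G) (fun v => some ⟨i, v⟩) (fun m => .inr ⟨i, m⟩)
          (fun _ => rfl) (fun _ => rfl) hs⟩

/-- Sequential games: no tiles, each position is reached by exactly one play (the positions form a
tree), no infinite path, and at each position it is the turn of only one player. -/
structure IsSequential (G : AsyncGame) : Prop where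
  no_tile : ∀ m p n q, ¬ G.tile m p n q
  tree : ∀ s t x, G.Path G.init s x → G.Path G.init t x → s = t
  finite : ¬ ∃ f : ℕ → G.E, ∀ n, G.tgt (f n) = G.src (f (n + 1))
  turn : ∀ m n, G.src m = G.src n → G.pol m = G.pol n

/-! ### Strategies -/

/-- A strategy: a prefix-closed set of plays (containing the empty play). -/
@[ext]
structure Strategy (G : AsyncGame) where
  plays : Set (List G.E)
  isPlay : ∀ s ∈ plays, G.IsPlay s
  nil_mem : [] ∈ plays
  prefix_mem : ∀ s t, s ++ t ∈ plays → s ∈ plays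

namespace Strategy

variable {G : AsyncGame} (σ : Strategy G)

/-- The positions of the graph of the strategy. -/
def Pos (x : G.V) : Prop := ∃ s ∈ σ.plays, G.Path G.init s x

/-- The transitions of the graph of the strategy. -/
def Trans (m : G.E) : Prop := ∃ s, s ++ [m] ∈ σ.plays

/-- The tiles of the graph of the strategy. -/
def Tile (m p n q : G.E) : Prop :=
  G.tile m p n q ∧ σ.Trans m ∧ σ.Trans p ∧ σ.Trans n ∧ σ.Trans q

def Positional : Prop :=
  ∀ s t u x y, G.Path G.init s x → G.Path G.init t x → G.Path x u y →
    s ++ u ∈ σ.plays → G.Homotopic s t → t ∈ σ.plays → t ++ u ∈ σ.plays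

def Deterministic : Prop :=
  ∀ m n, G.src m = G.src n → m ≠ n → G.pol m = .P → σ.Trans m → σ.Trans n →
    ∃ p q, G.tile m p n q ∧ σ.Trans q

def Receptive : Prop :=
  ∀ s x m, s ∈ σ.plays → G.Path G.init s x → G.src m = x → G.pol m = .O → s ++ [m] ∈ σ.plays

def Total : Prop :=
  ∀ s x, s ∈ σ.plays → G.Path G.init s x → (∀ m, G.src m = x → G.pol m ≠ .O) →
    (∀ m, G.src m ≠ x) ∨ ∃ m, G.src m = x ∧ G.pol m = .P ∧ s ++ [m] ∈ σ.plays

def Courteous : Prop :=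
  ∀ m p n q, G.tile m p n q → σ.Trans m → σ.Trans p → (G.pol m = .P ∨ G.pol p = .O) →
    σ.Trans n ∧ σ.Trans q

/-- Closure under residuals of transitions. -/
def ResidualClosed : Prop :=
  ∀ m p n q, G.tile m p n q → σ.Trans m → σ.Trans n → σ.Trans p ∧ σ.Trans q

/-- The cube property of the graph of the strategy: a hexagon with sides `m₁ · m₂ · m₃` and
`p₁ · p₂ · p₃` can be filled by three tiles on one side of the cube if and only if it can be
filled by three tiles on the other side. -/
def Cube : Prop :=
  ∀ m₁ m₂ m₃ p₁ p₂ p₃,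
    (∃ a b c, σ.Tile m₂ m₃ a b ∧ σ.Tile m₁ a p₁ c ∧ σ.Tile c b p₂ p₃) ↔
    (∃ d e f, σ.Tile m₁ m₂ d e ∧ σ.Tile e m₃ f p₃ ∧ σ.Tile d f p₁ p₂)

/-- Stability: the positions of the strategy are closed under binary meets. -/
def Stable : Prop :=
  ∀ x y z, σ.Pos x → σ.Pos y → G.Reach z x → G.Reach z y →
    (∀ w, G.Reach w x → G.Reach w y → G.Reach w z) → σ.Pos z

/-- Ingenuous strategies. -/
structure IsIngenuous : Prop where
  positional : σ.Positional
  deterministic : σ.Deterministic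
  receptive : σ.Receptive
  total : σ.Total
  courteous : σ.Courteous
  residualClosed : σ.ResidualClosed
  cube : σ.Cube
  stable : σ.Stable

/-- The halting positions: no Proponent move of the strategy starts there. -/
def halting : Set G.V :=
  {x | σ.Pos x ∧ ∀ m, σ.Trans m → G.src m = x → G.pol m ≠ .P}

end Strategy

/-! ### Composition and identities -/

section Composition

variable (A B C : AsyncGame)

/-- The part of a transition of `A ∥ (B ∥ C)` that is visible in `A ∥ B`. -/
def projAB : (A.prod (B.prod C)).E → Option (A.dual.prod B).E
  | .inl (m, (y, _)) => some (.inl (m, y))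
  | .inr (x, .inl (n, _)) => some (.inr (x, n))
  | .inr (_, .inr _) => none

/-- The part of a transition of `A ∥ (B ∥ C)` that is visible in `B ∥ C`. -/
def projBC : (A.prod (B.prod C)).E → Option (B.dual.prod C).E
  | .inl _ => none
  | .inr (_, e) => some e

/-- The part of a transition of `A ∥ (B ∥ C)` that is visible in `A ∥ C`. -/
def projAC : (A.prod (B.prod C)).E → Option (A.dual.prod C).E
  | .inl (m, (_, z)) => some (.inl (m, z))
  | .inr (_, .inl _) => none
  | .inr (x, .inr (_, p)) => some (.inr (x, p))

variable {A B C}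

/-- Interactions of `σ` and `τ`: plays on `A ∥ B ∥ C` that project to plays of `σ` and of `τ`. -/
def IsInteraction (σ : Strategy (A.dual.prod B)) (τ : Strategy (B.dual.prod C))
    (u : List (A.prod (B.prod C)).E) : Prop :=
  (A.prod (B.prod C)).IsPlay u ∧
    u.filterMap (projAB A B C) ∈ σ.plays ∧ u.filterMap (projBC A B C) ∈ τ.plays

/-- The composite `τ ∘ σ`: the restrictions of the interactions to `A* ∥ C`. -/
def Strategy.comp (σ : Strategy (A.dual.prod B)) (τ : Strategy (B.dual.prod C)) :
    Strategy (A.dual.prod C) where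
  plays := {s | ∃ u, IsInteraction σ τ u ∧ u.filterMap (projAC A B C) = s}
  isPlay := by
    rintro _ ⟨u, ⟨⟨⟨x, y, z⟩, hu⟩, -, -⟩, rfl⟩
    refine ⟨(x, z), isPathOn_filterMap (src := (A.prod (B.prod C)).src)
      (tgt := (A.prod (B.prod C)).tgt) (fun v => (v.1, v.2.2)) (projAC A B C) ?_ ?_ hu⟩
    · rintro (⟨m, y, z⟩ | ⟨x, ⟨n, z⟩ | ⟨y, p⟩⟩) h
      · simp [projAC] at h
      · rfl
      · simp [projAC] at h
    · rintro (⟨m, y, z⟩ | ⟨x, ⟨n, z⟩ | ⟨y, p⟩⟩) e' h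
      · cases h; exact ⟨rfl, rfl⟩
      · simp [projAC] at h
      · cases h; exact ⟨rfl, rfl⟩
  nil_mem := ⟨[], ⟨⟨_, rfl⟩, σ.nil_mem, τ.nil_mem⟩, rfl⟩
  prefix_mem := by
    rintro s t ⟨u, ⟨⟨v, hu⟩, h1, h2⟩, h⟩
    obtain ⟨u₁, u₂, rfl, rfl, -⟩ := List.filterMap_eq_append_iff.1 h
    rw [List.filterMap_append] at h1 h2
    obtain ⟨w, hw, -⟩ := isPathOn_append_inv hu
    exact ⟨u₁, ⟨⟨w, hw⟩, σ.prefix_mem _ _ h1, τ.prefix_mem _ _ h2⟩, rfl⟩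

end Composition

/-- The positions `(x, y)` of the copy-cat strategy: both sides extend a common position `z`, the
left one by moves that Proponent has not copied yet (Proponent moves of `G`, played by Opponent in
`G*`), and the right one likewise (Opponent moves of `G`). -/
def CopyRel (G : AsyncGame) (x y : G.V) : Prop :=
  ∃ z s t, G.Path z s x ∧ (∀ e ∈ s, G.pol e = .P) ∧ G.Path z t y ∧ (∀ e ∈ t, G.pol e = .O)

/-- The copy-cat strategy on `G* ∥ G`. -/
def copycat (G : AsyncGame) : Strategy (G.dual.prod G) where
  plays := {s | (G.dual.prod G).IsPlay s ∧
    ∀ t, t <+: s → ∀ x y, (G.dual.prod G).Path (G.dual.prod G).init t (x, y) → CopyRel G x y}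
  isPlay _ h := h.1
  nil_mem := by
    refine ⟨⟨_, rfl⟩, fun t ht x y h => ?_⟩
    obtain rfl := List.prefix_nil.1 ht
    cases h
    exact ⟨G.init, [], [], rfl, by simp, rfl, by simp⟩
  prefix_mem := by
    rintro s t ⟨⟨v, hv⟩, h⟩
    obtain ⟨w, hw, -⟩ := isPathOn_append_inv hv
    exact ⟨⟨w, hw⟩, fun t' ht' => h t' (ht'.trans (List.prefix_append s t))⟩

end AsyncGame

/-! ### Formulas and the scheduling criterion -/

/-- Formulas of MALL over the variables `X`; `dvar x` is the dual of the variable `x`. -/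
inductive Formula (X : Type) where
  | var : X → Formula X
  | dvar : X → Formula X
  | par : Formula X → Formula X → Formula X
  | tens : Formula X → Formula X → Formula X
  | with_ : Formula X → Formula X → Formula X
  | plus : Formula X → Formula X → Formula X

/-- The game of a formula, for an interpretation `ρ` of the variables. -/
def interp {X : Type} (ρ : X → AsyncGame) : Formula X → AsyncGame
  | .var x => ρ x
  | .dvar x => (ρ x).dual
  | .par A B => .choice .O Unit fun _ => (interp ρ A).prod (interp ρ B)
  | .tens A B => .choice .P Unit fun _ => (interp ρ A).prod (interp ρ B)
  | .with_ A B => .choice .O Bool fun b => Bool.rec (interp ρ B) (interp ρ A) b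
  | .plus A B => .choice .P Bool fun b => Bool.rec (interp ρ B) (interp ρ A) b

/-- A switching chooses, for each multiplicative connective of a formula, which of the two
components comes first (`true` for the left one). -/
def Switching {X : Type} : Formula X → Type
  | .var _ => Unit
  | .dvar _ => Unit
  | .par A B => Bool × Switching A × Switching B
  | .tens A B => Bool × Switching A × Switching B
  | .with_ A B => Switching A × Switching B
  | .plus A B => Switching A × Switching B

/-- The relation on the transitions of `G ∥ H` that is `R` between transitions in `G`, `S` between
transitions in `H`, and holds from `G` to `H` if `l` and from `H` to `G` if `r`. -/
def prodRel {G H : AsyncGame} (R : G.E → G.E → Prop) (S : H.E → H.E → Prop) (l r : Prop) :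
    (G.prod H).E → (G.prod H).E → Prop
  | .inl (m, _), .inl (m', _) => R m m'
  | .inr (_, n), .inr (_, n') => S n n'
  | .inl _, .inr _ => l
  | .inr _, .inl _ => r

/-- The relation on the transitions of `choice p ι G` induced by relations on the components. -/
inductive ChoiceRel {p : Polarity} {ι : Type} {G : ι → AsyncGame}
    (R : ∀ i, (G i).E → (G i).E → Prop) :
    (AsyncGame.choice p ι G).E → (AsyncGame.choice p ι G).E → Prop
  | mk (i : ι) {m n : (G i).E} : R i m n → ChoiceRel R (.inr ⟨i, m⟩) (.inr ⟨i, n⟩)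

/-- `Before ρ A d S e e'`: the transitions `e` and `e'` lie in the two components of a tensor of
`A` (if `d = false`) or of the dual `A*` (if `d = true`), that of `e` being the one which the
switching `S` puts first.  The tensors of `A*` are the pars of `A`. -/
def Before {X : Type} (ρ : X → AsyncGame) :
    (A : Formula X) → (d : Bool) → Switching A → (interp ρ A).E → (interp ρ A).E → Prop
  | .var _, _, _ => fun _ _ => False
  | .dvar _, _, _ => fun _ _ => False
  | .par A B, d, S => ChoiceRel fun _ => prodRel (Before ρ A d S.2.1) (Before ρ B d S.2.2)
      (d = true ∧ S.1 = true) (d = true ∧ S.1 = false)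
  | .tens A B, d, S => ChoiceRel fun _ => prodRel (Before ρ A d S.2.1) (Before ρ B d S.2.2)
      (d = false ∧ S.1 = true) (d = false ∧ S.1 = false)
  | .with_ A B, d, S => ChoiceRel fun b => Bool.rec (Before ρ B d S.2) (Before ρ A d S.1) b
  | .plus A B, d, S => ChoiceRel fun b => Bool.rec (Before ρ B d S.2) (Before ρ A d S.1) b

/-- Strategies `A → B`, that is, on `A* ∥ B`. -/
abbrev Strat {X : Type} (ρ : X → AsyncGame) (A B : Formula X) : Type :=
  AsyncGame.Strategy ((interp ρ A).dual.prod (interp ρ B))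

/-- The scheduling criterion for `σ : A → B`: whatever component is chosen to come first in each
tensor of `A*` and of `B`, each play of `σ` is homotopic to a play of `σ` in which, for each of
these tensors, all the moves in the chosen component precede all those in the other one. -/
def Scheduled {X : Type} {ρ : X → AsyncGame} {A B : Formula X} (σ : Strat ρ A B) : Prop :=
  ∀ (S : Switching A) (T : Switching B), ∀ s ∈ σ.plays, ∃ t ∈ σ.plays,
    ((interp ρ A).dual.prod (interp ρ B)).Homotopic s t ∧
    t.Pairwise fun e e' =>
      ¬ prodRel (G := (interp ρ A).dual) (Before ρ A true S) (Before ρ B false T) False False e' e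

/-! ### The domain of positions of a game -/

namespace AsyncGame

/-- The order `Reach` on positions is antisymmetric and has meets of nonempty sets and joins of
directed sets. -/
structure IsDomain (G : AsyncGame) : Prop where
  antisymm : ∀ x y, G.Reach x y → G.Reach y x → x = y
  glb : ∀ s : Set G.V, s.Nonempty → ∃ m, (∀ x ∈ s, G.Reach m x) ∧
    ∀ w, (∀ x ∈ s, G.Reach w x) → G.Reach w m
  lub : ∀ s : Set G.V, s.Nonempty → DirectedOn G.Reach s → ∃ m, (∀ x ∈ s, G.Reach x m) ∧
    ∀ w, (∀ x ∈ s, G.Reach x w) → G.Reach m w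

theorem Reach.refl {G : AsyncGame} (x : G.V) : G.Reach x x := ⟨[], rfl⟩

theorem Reach.trans {G : AsyncGame} {x y z : G.V} (h : G.Reach x y) (h' : G.Reach y z) :
    G.Reach x z := by
  obtain ⟨s, hs⟩ := h
  obtain ⟨t, ht⟩ := h'
  exact ⟨s ++ t, isPathOn_append hs ht⟩

theorem path_target {G : AsyncGame} {x y z : G.V} {s : List G.E}
    (h : G.Path x s y) (h' : G.Path x s z) : y = z := by
  induction s generalizing x with
  | nil => exact Eq.trans (Eq.symm h) h'
  | cons e s ih => exact ih h.2 h'.2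

theorem path_transGen {G : AsyncGame} {e : G.E} {l : List G.E} {x y : G.V}
    (h : G.Path x (e :: l) y) :
    Relation.TransGen (fun b a => ∃ e, G.src e = a ∧ G.tgt e = b) y x := by
  induction l generalizing e x with
  | nil => exact .single ⟨e, h.1, h.2⟩
  | cons e' l ih => exact .tail (ih h.2) ⟨e, h.1, rfl⟩

theorem IsSequential.isDomain {G : AsyncGame} (h : G.IsSequential) : G.IsDomain where
  antisymm := by
    rintro x y ⟨p, hp⟩ ⟨q, hq⟩
    obtain ⟨s, hs⟩ := G.reachable x
    have h1 := h.tree _ _ _ hs (isPathOn_append (isPathOn_append hs hp) hq)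
    have h2 : p = [] := by
      have := congrArg List.length h1
      simp only [List.length_append] at this
      exact List.eq_nil_of_length_eq_zero (by omega)
    subst h2
    exact hp
  glb := by
    rintro s ⟨x₀, hx₀⟩
    obtain ⟨s₀, hs₀⟩ := G.reachable x₀
    have hpre : ∀ w t, (∀ x ∈ s, G.Reach w x) → G.Path G.init t w → t <+: s₀ := by
      intro w t hw ht
      obtain ⟨u, hu⟩ := hw x₀ hx₀
      exact ⟨u, h.tree _ _ _ (isPathOn_append ht hu) hs₀⟩
    let L : Set ℕ := {n | ∃ w t, (∀ x ∈ s, G.Reach w x) ∧ G.Path G.init t w ∧ t.length = n}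
    have hne : L.Nonempty := ⟨0, G.init, [], fun x _ => G.reachable x, rfl, rfl⟩
    have hbd : BddAbove L := by
      refine ⟨s₀.length, ?_⟩
      rintro _ ⟨w, t, hw, ht, rfl⟩
      exact (hpre w t hw ht).length_le
    obtain ⟨m, t, hm, ht, hlen⟩ := Nat.sSup_mem hne hbd
    refine ⟨m, hm, fun w hw => ?_⟩
    obtain ⟨t', ht'⟩ := G.reachable w
    have hle : t'.length ≤ t.length := by
      rw [hlen]; exact le_csSup hbd ⟨w, t', hw, ht', rfl⟩
    obtain ⟨c, rfl⟩ := List.prefix_of_prefix_length_le (hpre w t' hw ht') (hpre m t hm ht) hle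
    obtain ⟨y, hy, hc⟩ := isPathOn_append_inv ht
    obtain rfl := path_target (G := G) hy ht'
    exact ⟨c, hc⟩
  lub := by
    intro s hs hd
    have wf : WellFounded (fun b a : G.V => ∃ e, G.src e = a ∧ G.tgt e = b) := by
      rw [wellFounded_iff_isEmpty_descending_chain]
      refine ⟨?_⟩
      rintro ⟨f, hf⟩
      choose e he using hf
      exact h.finite ⟨e, fun n => (he n).2.trans (he (n + 1)).1.symm⟩
    obtain ⟨m, hm, hmin⟩ := wf.transGen.has_min s hs
    refine ⟨m, fun x hx => ?_, fun w hw => hw m hm⟩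
    obtain ⟨z, hz, hxz, l, hl⟩ := hd x hx m hm
    cases l with
    | nil => cases hl; exact hxz
    | cons e l => exact absurd (path_transGen hl) (hmin z hz)

theorem IsDomain.dual {G : AsyncGame} (h : G.IsDomain) : G.dual.IsDomain :=
  ⟨h.antisymm, h.glb, h.lub⟩

/-- The order on the positions of `G ∥ H` is the product order. -/
theorem reach_prod {G H : AsyncGame} (v w : G.V × H.V) :
    (G.prod H).Reach v w ↔ G.Reach v.1 w.1 ∧ H.Reach v.2 w.2 := by
  constructor
  · rintro ⟨u, hu⟩
    refine ⟨⟨u.filterMap (fun e => Sum.elim (fun a => some a.1) (fun _ => none) e), ?_⟩,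
      ⟨u.filterMap (fun e => Sum.elim (fun _ => none) (fun a => some a.2) e), ?_⟩⟩
    · refine isPathOn_filterMap (src := (G.prod H).src) (tgt := (G.prod H).tgt)
        Prod.fst _ ?_ ?_ hu
      · rintro (⟨m, y⟩ | ⟨x, n⟩) h
        · cases h
        · rfl
      · rintro (⟨m, y⟩ | ⟨x, n⟩) e h
        · cases h; exact ⟨rfl, rfl⟩
        · cases h
    · refine isPathOn_filterMap (src := (G.prod H).src) (tgt := (G.prod H).tgt)
        Prod.snd _ ?_ ?_ hu
      · rintro (⟨m, y⟩ | ⟨x, n⟩) h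
        · rfl
        · cases h
      · rintro (⟨m, y⟩ | ⟨x, n⟩) e h
        · cases h
        · cases h; exact ⟨rfl, rfl⟩
  · rintro ⟨⟨s, hs⟩, ⟨t, ht⟩⟩
    exact prod_path G H hs ht

theorem IsDomain.prod {G H : AsyncGame} (hG : G.IsDomain) (hH : H.IsDomain) :
    (G.prod H).IsDomain where
  antisymm v w h h' := by
    have h1 := (reach_prod v w).1 h
    have h2 := (reach_prod w v).1 h'
    exact Prod.ext (hG.antisymm _ _ h1.1 h2.1) (hH.antisymm _ _ h1.2 h2.2)
  glb s hs := by
    obtain ⟨m, hm, hm'⟩ := hG.glb (Prod.fst '' s) (hs.image _)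
    obtain ⟨n, hn, hn'⟩ := hH.glb (Prod.snd '' s) (hs.image _)
    refine ⟨(m, n), fun x hx => (reach_prod _ _).2
      ⟨hm _ (Set.mem_image_of_mem _ hx), hn _ (Set.mem_image_of_mem _ hx)⟩, fun w hw => ?_⟩
    refine (reach_prod _ _).2 ⟨hm' _ ?_, hn' _ ?_⟩
    · rintro _ ⟨x, hx, rfl⟩; exact ((reach_prod _ _).1 (hw x hx)).1
    · rintro _ ⟨x, hx, rfl⟩; exact ((reach_prod _ _).1 (hw x hx)).2
  lub s hs hd := by
    obtain ⟨m, hm, hm'⟩ := hG.lub (Prod.fst '' s) (hs.image _) (by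
      rintro _ ⟨x, hx, rfl⟩ _ ⟨y, hy, rfl⟩
      obtain ⟨z, hz, h1, h2⟩ := hd x hx y hy
      exact ⟨_, ⟨z, hz, rfl⟩, ((reach_prod _ _).1 h1).1, ((reach_prod _ _).1 h2).1⟩)
    obtain ⟨n, hn, hn'⟩ := hH.lub (Prod.snd '' s) (hs.image _) (by
      rintro _ ⟨x, hx, rfl⟩ _ ⟨y, hy, rfl⟩
      obtain ⟨z, hz, h1, h2⟩ := hd x hx y hy
      exact ⟨_, ⟨z, hz, rfl⟩, ((reach_prod _ _).1 h1).2, ((reach_prod _ _).1 h2).2⟩)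
    refine ⟨(m, n), fun x hx => (reach_prod _ _).2
      ⟨hm _ (Set.mem_image_of_mem _ hx), hn _ (Set.mem_image_of_mem _ hx)⟩, fun w hw => ?_⟩
    refine (reach_prod _ _).2 ⟨hm' _ ?_, hn' _ ?_⟩
    · rintro _ ⟨x, hx, rfl⟩; exact ((reach_prod _ _).1 (hw x hx)).1
    · rintro _ ⟨x, hx, rfl⟩; exact ((reach_prod _ _).1 (hw x hx)).2

theorem reach_choice {p : Polarity} {ι : Type} {G : ι → AsyncGame} (i : ι) (x : (G i).V)
    (v : Option (Σ i, (G i).V)) :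
    (choice p ι G).Reach (some ⟨i, x⟩) v ↔ ∃ y, v = some ⟨i, y⟩ ∧ (G i).Reach x y := by
  constructor
  · rintro ⟨s, hs⟩
    induction s generalizing x with
    | nil => exact ⟨x, Eq.symm hs, .refl x⟩
    | cons e s ih =>
      obtain ⟨h1, h2⟩ := hs
      rcases e with j | ⟨j, m⟩
      · cases h1
      · cases h1
        obtain ⟨y, rfl, hy⟩ := ih _ h2
        exact ⟨y, rfl, .trans ⟨[m], rfl, rfl⟩ hy⟩
  · rintro ⟨y, rfl, s, hs⟩
    exact ⟨s.map (fun m => .inr ⟨i, m⟩), isPathOn_map (src := (G i).src) (tgt := (G i).tgt)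
      (src' := choiceSrc G) (tgt' := choiceTgt G) (fun v => some ⟨i, v⟩) (fun m => .inr ⟨i, m⟩)
      (fun _ => rfl) (fun _ => rfl) hs⟩

theorem reach_choice_some {p : Polarity} {ι : Type} {G : ι → AsyncGame} (i : ι) (x y : (G i).V) :
    (choice p ι G).Reach (some ⟨i, x⟩) (some ⟨i, y⟩) ↔ (G i).Reach x y := by
  rw [reach_choice]
  constructor
  · rintro ⟨z, hz, h⟩; cases hz; exact h
  · exact fun h => ⟨y, rfl, h⟩

theorem reach_choice_none {p : Polarity} {ι : Type} {G : ι → AsyncGame}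
    (v : Option (Σ i, (G i).V)) : (choice p ι G).Reach none v :=
  (choice p ι G).reachable v

theorem IsDomain.choice {p : Polarity} {ι : Type} {G : ι → AsyncGame} (h : ∀ i, (G i).IsDomain) :
    (choice p ι G).IsDomain where
  antisymm := by
    rintro (_ | ⟨i, x⟩) (_ | ⟨j, y⟩) h1 h2
    · rfl
    · obtain ⟨_, h3, _⟩ := (reach_choice _ _ _).1 h2; cases h3
    · obtain ⟨_, h3, _⟩ := (reach_choice _ _ _).1 h1; cases h3
    · obtain ⟨_, h3, h4⟩ := (reach_choice _ _ _).1 h1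
      cases h3
      rw [(h i).antisymm _ _ h4 ((reach_choice_some _ _ _).1 h2)]
  glb := by
    intro s hs
    by_cases hi : ∃ i, ∀ v ∈ s, ∃ x, v = some ⟨i, x⟩
    · obtain ⟨i, hi⟩ := hi
      obtain ⟨m, hm, hm'⟩ := (h i).glb {x : (G i).V | some (⟨i, x⟩ : Σ i, (G i).V) ∈ s} (by
        obtain ⟨v, hv⟩ := hs
        obtain ⟨x, rfl⟩ := hi v hv
        exact ⟨x, hv⟩)
      refine ⟨some ⟨i, m⟩, fun v hv => ?_, fun w hw => ?_⟩
      · obtain ⟨x, rfl⟩ := hi v hv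
        exact (reach_choice_some _ _ _).2 (hm x hv)
      · rcases w with _ | ⟨j, w⟩
        · exact reach_choice_none _
        · obtain ⟨v, hv⟩ := hs
          obtain ⟨x, rfl⟩ := hi v hv
          obtain ⟨_, h3, _⟩ := (reach_choice _ _ _).1 (hw _ hv)
          cases h3
          exact (reach_choice_some _ _ _).2
            (hm' w fun y hy => (reach_choice_some _ _ _).1 (hw _ hy))
    · refine ⟨none, fun v _ => reach_choice_none v, fun w hw => ?_⟩
      rcases w with _ | ⟨j, w⟩
      · exact .refl _
      · refine absurd ⟨j, fun v hv => ?_⟩ hi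
        obtain ⟨y, h3, _⟩ := (reach_choice _ _ _).1 (hw v hv)
        exact ⟨y, h3⟩
  lub := by
    intro s hs hd
    by_cases hi : ∃ i x, some ⟨i, x⟩ ∈ s
    · obtain ⟨i, x₀, hx₀⟩ := hi
      have hsame : ∀ v ∈ s, v = none ∨ ∃ x, v = some ⟨i, x⟩ := by
        rintro (_ | ⟨j, y⟩) hv
        · exact .inl rfl
        · obtain ⟨z, hz, h1, h2⟩ := hd _ hx₀ _ hv
          obtain ⟨_, rfl, _⟩ := (reach_choice _ _ _).1 h1
          obtain ⟨_, h3, _⟩ := (reach_choice _ _ _).1 h2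
          cases h3
          exact .inr ⟨y, rfl⟩
      obtain ⟨m, hm, hm'⟩ := (h i).lub {x : (G i).V | some (⟨i, x⟩ : Σ i, (G i).V) ∈ s} ⟨x₀, hx₀⟩ (by
        intro x hx y hy
        obtain ⟨z, hz, h1, h2⟩ := hd _ hx _ hy
        obtain ⟨z', rfl, h3⟩ := (reach_choice _ _ _).1 h1
        exact ⟨z', hz, h3, (reach_choice_some _ _ _).1 h2⟩)
      refine ⟨some ⟨i, m⟩, fun v hv => ?_, fun w hw => ?_⟩
      · rcases hsame v hv with rfl | ⟨x, rfl⟩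
        · exact reach_choice_none _
        · exact (reach_choice_some _ _ _).2 (hm x hv)
      · obtain ⟨w', rfl, _⟩ := (reach_choice _ _ _).1 (hw _ hx₀)
        exact (reach_choice_some _ _ _).2
          (hm' w' fun y hy => (reach_choice_some _ _ _).1 (hw _ hy))
    · refine ⟨none, fun v hv => ?_, fun w _ => reach_choice_none w⟩
      rcases v with _ | ⟨i, x⟩
      · exact .refl _
      · exact absurd ⟨i, x, hv⟩ hi

end AsyncGame

theorem interp_isDomain {X : Type} {ρ : X → AsyncGame} (hρ : ∀ x, (ρ x).IsSequential) :
    ∀ A : Formula X, (interp ρ A).IsDomain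
  | .var x => (hρ x).isDomain
  | .dvar x => (hρ x).isDomain.dual
  | .par A B => .choice fun _ => (interp_isDomain hρ A).prod (interp_isDomain hρ B)
  | .tens A B => .choice fun _ => (interp_isDomain hρ A).prod (interp_isDomain hρ B)
  | .with_ A B => .choice fun b => by
      cases b
      · exact interp_isDomain hρ B
      · exact interp_isDomain hρ A
  | .plus A B => .choice fun b => by
      cases b
      · exact interp_isDomain hρ B
      · exact interp_isDomain hρ A

/-! ### Concurrent games -/

/-- Concurrent games: a partial order of positions which becomes a complete lattice once a top
element is added, and which is closed under directed joins. -/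
structure ConcGame where
  Pos : Type
  [order : PartialOrder Pos]
  glb : ∀ s : Set Pos, s.Nonempty → ∃ m, IsGLB s m
  lub : ∀ s : Set Pos, s.Nonempty → DirectedOn (· ≤ ·) s → ∃ m, IsLUB s m

attribute [instance] ConcGame.order

/-- A concurrent strategy on a complete lattice: a continuous closure operator. -/
structure ConcStrategy (D : Type) [CompleteLattice D] extends ClosureOperator D where
  continuous : ScottContinuous toFun

/-- The operator `x ↦ ⋀ {y ∈ R | x ≤ y}` induced by a set `R`. -/
def clop {D : Type} [CompleteLattice D] (R : Set D) (x : D) : D := sInf {y | y ∈ R ∧ x ≤ y}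

namespace ConcStrategy

variable {D : Type} [CompleteLattice D]

/-- The fixpoints of a concurrent strategy. -/
def fix (ς : ConcStrategy D) : Set D := {x | ς.toFun x = x}

/-- The concurrent strategy of a set closed under meets and under directed joins. -/
def ofFix (R : Set D) (hM : ∀ s ⊆ R, sInf s ∈ R)
    (hJ : ∀ s ⊆ R, s.Nonempty → DirectedOn (· ≤ ·) s → sSup s ∈ R) : ConcStrategy D where
  toFun := clop R
  monotone' _ _ h := sInf_le_sInf fun _ hy => ⟨hy.1, h.trans hy.2⟩
  le_closure' _ := le_sInf fun _ hy => hy.2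
  idempotent' _ := le_antisymm (sInf_le ⟨hM _ fun _ hy => hy.1, le_rfl⟩)
    (le_sInf fun _ hy => hy.2)
  continuous := by
    intro d hne hd a ha
    have mono : Monotone (clop R) := fun _ _ h => sInf_le_sInf fun _ hy => ⟨hy.1, h.trans hy.2⟩
    have hle : ∀ x, x ≤ clop R x := fun _ => le_sInf fun _ hy => hy.2
    refine ⟨?_, fun b hb => ?_⟩
    · rintro _ ⟨x, hx, rfl⟩
      exact mono (ha.1 hx)
    · have hs : sSup (clop R '' d) ∈ R := by
        refine hJ _ ?_ (hne.image _) ?_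
        · rintro _ ⟨x, _, rfl⟩
          exact hM _ fun _ hy => hy.1
        · rintro _ ⟨x, hx, rfl⟩ _ ⟨y, hy, rfl⟩
          obtain ⟨z, hz, h1, h2⟩ := hd x hx y hy
          exact ⟨_, ⟨z, hz, rfl⟩, mono h1, mono h2⟩
      have has : a ≤ sSup (clop R '' d) :=
        ha.2 fun x hx => (hle x).trans (le_sSup ⟨x, hx, rfl⟩)
      exact (sInf_le ⟨hs, has⟩ : clop R a ≤ _).trans (sSup_le hb)

theorem fix_ofFix (R : Set D) (hM hJ) : (ofFix R hM hJ).fix = R := by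
  ext x
  constructor
  · intro h
    have h' : clop R x = x := h
    rw [← h']
    exact hM _ fun _ hy => hy.1
  · intro h
    exact le_antisymm (sInf_le ⟨h, le_rfl⟩) (le_sInf fun _ hy => hy.2)

theorem fix_sInf (ς : ConcStrategy D) {s : Set D} (hs : s ⊆ ς.fix) : sInf s ∈ ς.fix := by
  refine le_antisymm (le_sInf fun x hx => ?_) (ς.le_closure' _)
  have h : ς.toFun x = x := hs hx
  rw [← h]
  exact ς.monotone' (sInf_le hx)

theorem fix_lub (ς : ConcStrategy D) {s : Set D} (hs : s ⊆ ς.fix) (hne : s.Nonempty)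
    (hd : DirectedOn (· ≤ ·) s) {a : D} (ha : IsLUB s a) : a ∈ ς.fix := by
  have h := ς.continuous hne hd ha
  have h' : ς.toFun '' s = s := by
    ext x
    constructor
    · rintro ⟨y, hy, rfl⟩
      rw [show ς.toFun y = y from hs hy]
      exact hy
    · exact fun hx => ⟨x, hx, hs hx⟩
  rw [h'] at h
  exact h.unique ha

theorem toFun_eq_clop (ς : ConcStrategy D) (x : D) : ς.toFun x = clop ς.fix x := by
  refine le_antisymm (le_sInf fun y hy => ?_) (sInf_le ⟨ς.idempotent' x, ς.le_closure' x⟩)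
  have h : ς.toFun y = y := hy.1
  rw [← h]
  exact ς.monotone' hy.2

theorem ext_fun {ς ς' : ConcStrategy D} (h : ∀ x, ς.toFun x = ς'.toFun x) : ς = ς' := by
  have h1 : ς.toClosureOperator = ς'.toClosureOperator := ClosureOperator.ext _ _ h
  cases ς
  cases ς'
  cases h1
  rfl

theorem ext_fix {ς ς' : ConcStrategy D} (h : ς.fix = ς'.fix) : ς = ς' :=
  ext_fun fun x => by rw [toFun_eq_clop, toFun_eq_clop, h]

end ConcStrategy

namespace ConcGame

/-- The domain of `P* ∥ Q`: the pairs of positions, with a top element added. -/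
abbrev Dom (P Q : ConcGame) : Type := WithTop (P.Pos × Q.Pos)

theorem exists_glb_prod (P Q : ConcGame) (s : Set (P.Pos × Q.Pos)) (hs : s.Nonempty) :
    ∃ m, IsGLB s m := by
  obtain ⟨a, ha⟩ := P.glb (Prod.fst '' s) (hs.image _)
  obtain ⟨b, hb⟩ := Q.glb (Prod.snd '' s) (hs.image _)
  exact ⟨(a, b), isGLB_prod.2 ⟨ha, hb⟩⟩

theorem exists_glb (P Q : ConcGame) (s : Set (Dom P Q)) : ∃ m, IsGLB s m := by
  by_cases h : ∃ v : P.Pos × Q.Pos, (v : Dom P Q) ∈ s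
  · obtain ⟨m, hm⟩ := exists_glb_prod P Q {v | (v : Dom P Q) ∈ s} h
    refine ⟨m, fun w hw => ?_, fun w hw => ?_⟩
    · induction w using WithTop.recTopCoe with
      | top => exact le_top
      | coe v => exact WithTop.coe_le_coe.2 (hm.1 hw)
    · obtain ⟨v, hv⟩ := h
      induction w using WithTop.recTopCoe with
      | top => exact absurd (hw hv) (by simp)
      | coe w => exact WithTop.coe_le_coe.2 (hm.2 fun u hu => WithTop.coe_le_coe.1 (hw hu))
  · refine ⟨⊤, fun w hw => ?_, fun w _ => le_top⟩
    induction w using WithTop.recTopCoe with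
    | top => exact le_rfl
    | coe v => exact absurd ⟨v, hw⟩ h

noncomputable instance (P Q : ConcGame) : InfSet (Dom P Q) :=
  ⟨fun s => Classical.choose (exists_glb P Q s)⟩

noncomputable instance (P Q : ConcGame) : CompleteLattice (Dom P Q) :=
  { completeLatticeOfInf (Dom P Q) fun s => Classical.choose_spec (exists_glb P Q s) with
    top := ⊤
    le_top := fun _ => le_top }

/-- A pair of positions as an element of the domain. -/
abbrev pair {P Q : ConcGame} (x : P.Pos) (y : Q.Pos) : Dom P Q := ((x, y) : P.Pos × Q.Pos)

theorem isGLB_pair {I : Type} [Nonempty I] {P Q : ConcGame} {f : I → P.Pos} {g : I → Q.Pos}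
    {a : P.Pos} {b : Q.Pos} (ha : IsGLB (Set.range f) a) (hb : IsGLB (Set.range g) b) :
    IsGLB (Set.range fun i => pair (f i) (g i)) (pair a b) := by
  refine ⟨?_, fun w hw => ?_⟩
  · rintro _ ⟨i, rfl⟩
    exact WithTop.coe_le_coe.2 ⟨ha.1 ⟨i, rfl⟩, hb.1 ⟨i, rfl⟩⟩
  · induction w using WithTop.recTopCoe with
    | top => exact absurd (hw ⟨Classical.arbitrary I, rfl⟩) (by simp [pair])
    | coe w =>
      refine WithTop.coe_le_coe.2 ⟨ha.2 ?_, hb.2 ?_⟩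
      · rintro _ ⟨i, rfl⟩; exact (WithTop.coe_le_coe.1 (hw ⟨i, rfl⟩)).1
      · rintro _ ⟨i, rfl⟩; exact (WithTop.coe_le_coe.1 (hw ⟨i, rfl⟩)).2

theorem isLUB_pair {I : Type} {P Q : ConcGame} {f : I → P.Pos} {g : I → Q.Pos}
    {a : P.Pos} {b : Q.Pos} (ha : IsLUB (Set.range f) a) (hb : IsLUB (Set.range g) b) :
    IsLUB (Set.range fun i => pair (f i) (g i)) (pair a b) := by
  refine ⟨?_, fun w hw => ?_⟩
  · rintro _ ⟨i, rfl⟩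
    exact WithTop.coe_le_coe.2 ⟨ha.1 ⟨i, rfl⟩, hb.1 ⟨i, rfl⟩⟩
  · induction w using WithTop.recTopCoe with
    | top => exact le_top
    | coe w =>
      refine WithTop.coe_le_coe.2 ⟨ha.2 ?_, hb.2 ?_⟩
      · rintro _ ⟨i, rfl⟩; exact (WithTop.coe_le_coe.1 (hw ⟨i, rfl⟩)).1
      · rintro _ ⟨i, rfl⟩; exact (WithTop.coe_le_coe.1 (hw ⟨i, rfl⟩)).2

theorem fix_isGLB {P Q : ConcGame} (ς : ConcStrategy (Dom P Q)) {I : Type} {f : I → Dom P Q}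
    (hf : ∀ i, f i ∈ ς.fix) {m : Dom P Q} (h : IsGLB (Set.range f) m) : m ∈ ς.fix := by
  rw [← h.sInf_eq]
  refine ς.fix_sInf ?_
  rintro _ ⟨i, rfl⟩
  exact hf i

/-- The fixpoints of the identity on `P`. -/
def idFix (P : ConcGame) : Set (Dom P P) := {w | w = ⊤ ∨ ∃ x : P.Pos, w = pair x x}

/-- The relational composite of two sets of fixpoints. -/
def compFix {P Q R : ConcGame} (F : Set (Dom P Q)) (F' : Set (Dom Q R)) : Set (Dom P R) :=
  {w | w = ⊤ ∨ ∃ x y z, w = pair x z ∧ pair x y ∈ F ∧ pair y z ∈ F'}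

theorem pair_inj {P Q : ConcGame} {x x' : P.Pos} {y y' : Q.Pos} :
    pair x y = pair x' y' ↔ x = x' ∧ y = y' := by
  simp [pair]

theorem pair_mem_compFix {P Q R : ConcGame} {F : Set (Dom P Q)} {F' : Set (Dom Q R)}
    {x : P.Pos} {z : R.Pos} :
    pair x z ∈ compFix F F' ↔ ∃ y, pair x y ∈ F ∧ pair y z ∈ F' := by
  constructor
  · rintro (h | ⟨x', y, z', h, h1, h2⟩)
    · exact absurd h (WithTop.coe_ne_top)
    · obtain ⟨rfl, rfl⟩ := pair_inj.1 h
      exact ⟨y, h1, h2⟩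
  · rintro ⟨y, h1, h2⟩
    exact .inr ⟨x, y, z, rfl, h1, h2⟩

theorem idFix_sInf (P : ConcGame) (s : Set (Dom P P)) (hs : s ⊆ idFix P) : sInf s ∈ idFix P := by
  by_cases hne : ∃ x : P.Pos, pair x x ∈ s
  · have : Nonempty {x : P.Pos // pair x x ∈ s} := ⟨⟨hne.choose, hne.choose_spec⟩⟩
    obtain ⟨a, ha⟩ := P.glb _ (Set.range_nonempty (fun i : {x : P.Pos // pair x x ∈ s} => i.1))
    have h := isGLB_pair ha ha
    refine .inr ⟨a, le_antisymm (h.2 ?_) (le_sInf fun w hw => ?_)⟩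
    · rintro _ ⟨i, rfl⟩
      exact sInf_le i.2
    · rcases hs hw with rfl | ⟨x, rfl⟩
      · exact le_top
      · exact h.1 ⟨⟨x, hw⟩, rfl⟩
  · refine .inl (top_le_iff.1 (le_sInf fun w hw => ?_))
    rcases hs hw with rfl | ⟨x, rfl⟩
    · exact le_rfl
    · exact absurd ⟨x, hw⟩ hne

theorem idFix_sSup (P : ConcGame) (s : Set (Dom P P)) (hs : s ⊆ idFix P) :
    sSup s ∈ idFix P := by
  by_cases h : sSup s = ⊤
  · exact .inl h
  · obtain ⟨⟨a, b⟩, hab⟩ := WithTop.ne_top_iff_exists.1 h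
    have key : ∀ x : P.Pos, pair x x ∈ s → x ≤ a ∧ x ≤ b := fun x hx => by
      have := le_sSup hx
      rw [← hab] at this
      exact WithTop.coe_le_coe.1 this
    have hba : sSup s ≤ pair b a := sSup_le fun w hw => by
      rcases hs hw with rfl | ⟨x, rfl⟩
      · exact absurd (top_le_iff.1 (le_sSup hw)) h
      · exact WithTop.coe_le_coe.2 (key x hw).symm
    rw [← hab] at hba
    have h2 := WithTop.coe_le_coe.1 hba
    obtain rfl : a = b := le_antisymm h2.1 h2.2
    exact .inr ⟨a, hab.symm⟩

theorem compFix_sInf {P Q R : ConcGame} (ς : ConcStrategy (Dom P Q)) (ς' : ConcStrategy (Dom Q R))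
    (s : Set (Dom P R)) (hs : s ⊆ compFix ς.fix ς'.fix) : sInf s ∈ compFix ς.fix ς'.fix := by
  let I := {i : P.Pos × Q.Pos × R.Pos //
    pair i.1 i.2.2 ∈ s ∧ pair i.1 i.2.1 ∈ ς.fix ∧ pair i.2.1 i.2.2 ∈ ς'.fix}
  by_cases hne : Nonempty I
  · obtain ⟨a, ha⟩ := P.glb _ (Set.range_nonempty fun i : I => i.1.1)
    obtain ⟨b, hb⟩ := Q.glb _ (Set.range_nonempty fun i : I => i.1.2.1)
    obtain ⟨c, hc⟩ := R.glb _ (Set.range_nonempty fun i : I => i.1.2.2)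
    have h := isGLB_pair ha hc
    refine .inr ⟨a, b, c, le_antisymm (h.2 ?_) (le_sInf fun w hw => ?_),
      fix_isGLB ς (fun i => i.2.2.1) (isGLB_pair ha hb),
      fix_isGLB ς' (fun i => i.2.2.2) (isGLB_pair hb hc)⟩
    · rintro _ ⟨i, rfl⟩
      exact sInf_le i.2.1
    · rcases hs hw with rfl | ⟨x, y, z, rfl, h1, h2⟩
      · exact le_top
      · exact h.1 ⟨⟨(x, y, z), hw, h1, h2⟩, rfl⟩
  · refine .inl (top_le_iff.1 (le_sInf fun w hw => ?_))
    rcases hs hw with rfl | ⟨x, y, z, rfl, h1, h2⟩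
    · exact le_rfl
    · exact absurd ⟨⟨(x, y, z), hw, h1, h2⟩⟩ hne

theorem compFix_sSup {P Q R : ConcGame} (ς : ConcStrategy (Dom P Q)) (ς' : ConcStrategy (Dom Q R))
    (s : Set (Dom P R)) (hs : s ⊆ compFix ς.fix ς'.fix) (hne : s.Nonempty)
    (hd : DirectedOn (· ≤ ·) s) : sSup s ∈ compFix ς.fix ς'.fix := by
  by_cases htop : ⊤ ∈ s
  · exact .inl (top_le_iff.1 (le_sSup htop))
  let I := {i : P.Pos × R.Pos // pair i.1 i.2 ∈ s}
  have hI : ∀ w ∈ s, ∃ i : I, w = pair i.1.1 i.1.2 := fun w hw => by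
    rcases hs hw with rfl | ⟨x, y, z, rfl, -, -⟩
    · exact absurd hw htop
    · exact ⟨⟨(x, z), hw⟩, rfl⟩
  have : Nonempty I := by
    obtain ⟨w, hw⟩ := hne
    exact ⟨(hI w hw).choose⟩
  -- the least intermediate position for each element of the directed set
  have hY : ∀ i : I, ∃ y, (pair i.1.1 y ∈ ς.fix ∧ pair y i.1.2 ∈ ς'.fix) ∧
      ∀ (j : I) (y' : Q.Pos), i.1 ≤ j.1 → pair j.1.1 y' ∈ ς.fix → pair y' j.1.2 ∈ ς'.fix →
        y ≤ y' := by
    intro i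
    let K := {k : P.Pos × Q.Pos × R.Pos // i.1.1 ≤ k.1 ∧ i.1.2 ≤ k.2.2 ∧
      pair k.1 k.2.1 ∈ ς.fix ∧ pair k.2.1 k.2.2 ∈ ς'.fix}
    obtain ⟨y₀, h1, h2⟩ := pair_mem_compFix.1 (hs i.2)
    have hK : Nonempty K := ⟨⟨(i.1.1, y₀, i.1.2), le_rfl, le_rfl, h1, h2⟩⟩
    obtain ⟨y, hy⟩ := Q.glb _ (Set.range_nonempty fun k : K => k.1.2.1)
    have hx : IsGLB (Set.range fun k : K => k.1.1) i.1.1 :=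
      ⟨by rintro _ ⟨k, rfl⟩; exact k.2.1,
        fun w hw => hw ⟨⟨(i.1.1, y₀, i.1.2), le_rfl, le_rfl, h1, h2⟩, rfl⟩⟩
    have hz : IsGLB (Set.range fun k : K => k.1.2.2) i.1.2 :=
      ⟨by rintro _ ⟨k, rfl⟩; exact k.2.2.1,
        fun w hw => hw ⟨⟨(i.1.1, y₀, i.1.2), le_rfl, le_rfl, h1, h2⟩, rfl⟩⟩
    exact ⟨y, ⟨fix_isGLB ς (fun k => k.2.2.2.1) (isGLB_pair hx hy),
      fix_isGLB ς' (fun k => k.2.2.2.2) (isGLB_pair hy hz)⟩,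
      fun j y' hij h1 h2 => hy.1 ⟨⟨(j.1.1, y', j.1.2), hij.1, hij.2, h1, h2⟩, rfl⟩⟩
  choose Y hY hmin using hY
  have hdir : ∀ i j : I, ∃ k : I, i.1 ≤ k.1 ∧ j.1 ≤ k.1 := by
    intro i j
    obtain ⟨w, hw, h1, h2⟩ := hd _ i.2 _ j.2
    obtain ⟨k, rfl⟩ := hI w hw
    exact ⟨k, WithTop.coe_le_coe.1 h1, WithTop.coe_le_coe.1 h2⟩
  have hYmono : ∀ i j : I, i.1 ≤ j.1 → Y i ≤ Y j := fun i j hij =>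
    hmin i j _ hij (hY j).1 (hY j).2
  have hdirected : ∀ {T : Type} [Preorder T] (f : I → T),
      (∀ i j : I, i.1 ≤ j.1 → f i ≤ f j) → DirectedOn (· ≤ ·) (Set.range f) := by
    rintro T _ f hf _ ⟨i, rfl⟩ _ ⟨j, rfl⟩
    obtain ⟨k, h1, h2⟩ := hdir i j
    exact ⟨_, ⟨k, rfl⟩, hf i k h1, hf j k h2⟩
  obtain ⟨a, ha⟩ := P.lub _ (Set.range_nonempty fun i : I => i.1.1)
    (hdirected _ fun _ _ h => h.1)
  obtain ⟨b, hb⟩ := Q.lub _ (Set.range_nonempty Y) (hdirected _ hYmono)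
  obtain ⟨c, hc⟩ := R.lub _ (Set.range_nonempty fun i : I => i.1.2)
    (hdirected _ fun _ _ h => h.2)
  have h := isLUB_pair ha hc
  refine .inr ⟨a, b, c, le_antisymm (sSup_le fun w hw => ?_) (h.2 ?_), ?_, ?_⟩
  · obtain ⟨i, rfl⟩ := hI w hw
    exact h.1 ⟨i, rfl⟩
  · rintro _ ⟨i, rfl⟩
    exact le_sSup i.2
  · refine ς.fix_lub ?_ (Set.range_nonempty _)
      (hdirected _ fun i j h => WithTop.coe_le_coe.2 ⟨h.1, hYmono i j h⟩) (isLUB_pair ha hb)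
    rintro _ ⟨i, rfl⟩
    exact (hY i).1
  · refine ς'.fix_lub ?_ (Set.range_nonempty _)
      (hdirected _ fun i j h => WithTop.coe_le_coe.2 ⟨hYmono i j h, h.2⟩) (isLUB_pair hb hc)
    rintro _ ⟨i, rfl⟩
    exact (hY i).2

theorem top_mem_fix {D : Type} [CompleteLattice D] (ς : ConcStrategy D) : ⊤ ∈ ς.fix :=
  top_le_iff.1 (ς.le_closure' ⊤)

/-- The identity on `P`: the closure operator whose fixpoints are the pairs `(x, x)` and `⊤`. -/
noncomputable def idStrategy (P : ConcGame) : ConcStrategy (Dom P P) :=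
  .ofFix (idFix P) (idFix_sInf P) fun s hs _ _ => idFix_sSup P s hs

/-- The composite of two concurrent strategies: the closure operator whose fixpoints are `⊤` and
the pairs `(x, z)` such that `(x, y)` and `(y, z)` are fixpoints for some `y`. -/
noncomputable def compStrategy {P Q R : ConcGame} (ς : ConcStrategy (Dom P Q))
    (ς' : ConcStrategy (Dom Q R)) : ConcStrategy (Dom P R) :=
  .ofFix (compFix ς.fix ς'.fix) (compFix_sInf ς ς') (compFix_sSup ς ς')

/-- The category of concurrent games. -/
noncomputable instance : CategoryTheory.Category ConcGame where
  Hom P Q := ConcStrategy (Dom P Q)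
  id := idStrategy
  comp := compStrategy
  id_comp {P Q} ς := by
    refine ConcStrategy.ext_fix ?_
    rw [compStrategy, idStrategy, ConcStrategy.fix_ofFix, ConcStrategy.fix_ofFix]
    ext w
    induction w using WithTop.recTopCoe with
    | top => exact iff_of_true (.inl rfl) (top_mem_fix ς)
    | coe v =>
      refine pair_mem_compFix.trans ⟨?_, fun h => ⟨v.1, .inr ⟨_, rfl⟩, h⟩⟩
      rintro ⟨y, h | ⟨x, h⟩, h'⟩
      · exact absurd h WithTop.coe_ne_top
      · obtain ⟨rfl, rfl⟩ := pair_inj.1 h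
        exact h'
  comp_id {P Q} ς := by
    refine ConcStrategy.ext_fix ?_
    rw [compStrategy, idStrategy, ConcStrategy.fix_ofFix, ConcStrategy.fix_ofFix]
    ext w
    induction w using WithTop.recTopCoe with
    | top => exact iff_of_true (.inl rfl) (top_mem_fix ς)
    | coe v =>
      refine pair_mem_compFix.trans ⟨?_, fun h => ⟨v.2, h, .inr ⟨_, rfl⟩⟩⟩
      rintro ⟨y, h', h | ⟨x, h⟩⟩
      · exact absurd h WithTop.coe_ne_top
      · obtain ⟨rfl, h2⟩ := pair_inj.1 h
        rw [← h2] at h'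
        exact h'
  assoc {P Q R S} ς ς' ς'' := by
    refine ConcStrategy.ext_fix ?_
    simp only [compStrategy, ConcStrategy.fix_ofFix]
    ext w
    induction w using WithTop.recTopCoe with
    | top => exact iff_of_true (.inl rfl) (.inl rfl)
    | coe v =>
      refine pair_mem_compFix.trans (Iff.trans ?_ pair_mem_compFix.symm)
      simp only [pair_mem_compFix]
      constructor
      · rintro ⟨z, ⟨y, h1, h2⟩, h3⟩
        exact ⟨y, h1, z, h2, h3⟩
      · rintro ⟨y, h1, z, h2, h3⟩
        exact ⟨z, ⟨y, h1, h2⟩, h3⟩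

end ConcGame

/-- The concurrent game of a formula: the positions of its game, ordered by reachability. -/
def dom {X : Type} (ρ : X → AsyncGame) (hρ : ∀ x, (ρ x).IsSequential) (A : Formula X) :
    ConcGame where
  Pos := (interp ρ A).V
  order :=
    { le := (interp ρ A).Reach
      le_refl := AsyncGame.Reach.refl
      le_trans := fun _ _ _ => AsyncGame.Reach.trans
      le_antisymm := (interp_isDomain hρ A).antisymm }
  glb s hs := by
    obtain ⟨m, h1, h2⟩ := (interp_isDomain hρ A).glb s hs
    exact ⟨m, fun x hx => h1 x hx, fun w hw => h2 w fun x hx => hw hx⟩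
  lub s hs hd := by
    obtain ⟨m, h1, h2⟩ := (interp_isDomain hρ A).lub s hs hd
    exact ⟨m, fun x hx => h1 x hx, fun w hw => h2 w fun x hx => hw hx⟩

/-- The set of halting positions of `σ : A → B`, in the domain of `A* ∥ B`. -/
def haltSet {X : Type} {ρ : X → AsyncGame} (hρ : ∀ x, (ρ x).IsSequential) {A B : Formula X}
    (σ : Strat ρ A B) : Set (ConcGame.Dom (dom ρ hρ A) (dom ρ hρ B)) :=
  {w | ∃ x y, (x, y) ∈ σ.halting ∧
    w = ConcGame.pair (P := dom ρ hρ A) (Q := dom ρ hρ B) x y}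

end AsyncConc

/-! ### Positions as configurations of events -/

namespace AsyncConc

namespace AsyncGame

/-! A position of the game of a formula is determined by the finite set of events that lead to it.
Reachability is then inclusion, meets are intersections, bounded positions have unions, and
compatible moves commute, so that coinitial and cofinal paths are always homotopic (`Conf`,
`Conf.homotopic_of_path`). An ingenuous strategy is therefore the same thing as a set of positions
with suitable closure properties (`Conf.Fam`), its plays being the paths inside this set
(`Strategy.IsIngenuous.fam`, `Strategy.PlaysIn.isIngenuous`); the cube property follows from closure
under meets and residuals. The scheduling criterion says that, for all switchings, every position of
the strategy is reached inside the strategy through positions that are closed downwards for the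
order imposed by the switchings (`schedFam_iff`).

The difficulty in composing `σ : A → B` and `τ : B → C` is deadlock: the two strategies may agree on
a position of `B` and yet be unable to reach it together, because each waits in `B` for a move that
the other one delays. At a stuck position the moves of `B` still to be played are pairwise separated
by multiplicative connectives. The waiting relation of `σ` is compatible with all switchings of the
tensors of `B`, that of `τ` with all switchings of the tensors of `B*`, which are the pars of `B`.
By induction on `B`, the union of two such relations is well founded (`jointlyWF_before`): at each
connective, one of the two relations is compatible with both orders of the two components, hence
never crosses between them and splits into two smaller relations. A minimal move of the union would
be awaited by nobody, so there is no deadlock (`SwConf.interaction_step`). Totality of the composite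
uses the same argument, with the extra care that the two strategies may be heading for conflicting
positions of `B` (`Interacts.total`).

Once all compatible positions are reachable (`Interacts`), hidden moves are deterministic, since a
move of `B` is Proponent for one of the two strategies. Hidden parts over comparable visible
positions can thus be merged (`Interacts.confluence`), and the closure properties pass to the
composite. A visible position halts exactly when some hidden position makes both strategies halt
(`Interacts.halt_iff`), which is the relational composition of fixpoints. Halting positions are
closed under meets by determinism and under directed joins because ascending sequences stop; with
`⊤` they are the fixpoints of a continuous closure operator. Those of the copy-cat strategy form the
diagonal (`Conf.halt_copy`). -/

/-- A presentation of the positions of a game as finite sets of events: each transition adds one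
event, the order is inclusion, and the tiles are the squares of compatible transitions. -/
structure Conf (G : AsyncGame) where
  Ev : Type
  ev : G.E → Ev
  evs : G.V → Set Ev
  polEv : Ev → Polarity
  evs_init : evs G.init = ∅
  ev_notMem : ∀ e, ev e ∉ evs (G.src e)
  evs_tgt : ∀ e, evs (G.tgt e) = insert (ev e) (evs (G.src e))
  reach_of_subset : ∀ {x y}, evs x ⊆ evs y → G.Reach x y
  inter : ∀ x y, ∃ z, evs z = evs x ∩ evs y
  union : ∀ {x y w}, evs x ⊆ evs w → evs y ⊆ evs w → ∃ z, evs z = evs x ∪ evs y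
  edge_ext : ∀ {e e'}, G.src e = G.src e' → ev e = ev e' → e = e'
  tile_ev : ∀ {m p n q}, G.tile m p n q → ev m = ev q ∧ ev n = ev p
  tile_of_subset : ∀ {m n w}, G.src m = G.src n → m ≠ n → evs (G.tgt m) ⊆ evs w →
    evs (G.tgt n) ⊆ evs w → ∃ p q, G.tile m p n q
  -- A choice always belongs to a single player, so moves of different polarities never conflict.
  tile_of_pol : ∀ {m n}, G.src m = G.src n → G.pol m ≠ G.pol n → ∃ p q, G.tile m p n q
  pol_ev : ∀ e, G.pol e = polEv (ev e)
  -- A conflict met by a later occurrence of the event of `e` is already present where `e` itself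
  -- starts. Totality of composites rests on this.
  conflict_enabled : ∀ {e e₁ e₂}, evs (G.src e) ⊆ evs (G.src e₁) → ev e = ev e₁ →
    G.src e₁ = G.src e₂ → (¬ ∃ p q, G.tile e₁ p e₂ q) →
    ∃ e₃, G.src e₃ = G.src e ∧ ev e₃ = ev e₂ ∧ ¬ ∃ p q, G.tile e p e₃ q
  wf : WellFounded fun y x => ∃ e, G.src e = x ∧ G.tgt e = y

theorem Path.append {G : AsyncGame} {x y z : G.V} {s t : List G.E}
    (hs : G.Path x s y) (ht : G.Path y t z) : G.Path x (s ++ t) z :=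
  isPathOn_append hs ht

theorem Path.single {G : AsyncGame} (e : G.E) : G.Path (G.src e) [e] (G.tgt e) := ⟨rfl, rfl⟩

theorem Homotopic.path {G : AsyncGame} {s t : List G.E} (h : G.Homotopic s t) {x y : G.V} :
    G.Path x s y ↔ G.Path x t y := by
  induction h generalizing x y with
  | refl => exact Iff.rfl
  | symm _ ih => exact ih.symm
  | trans _ _ ih1 ih2 => exact ih1.trans ih2
  | tile u v ht =>
    have key : ∀ {m p n q}, G.tile m p n q → G.Path x (u ++ m :: p :: v) y →
        G.Path x (u ++ n :: q :: v) y := by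
      intro m p n q ht h
      obtain ⟨z, h1, h2, h3, h4⟩ := isPathOn_append_inv h
      obtain ⟨t1, t2, t3, t4⟩ := G.tile_bound ht
      exact isPathOn_append h1 ⟨t1.symm.trans h2, t3.symm, t4 ▸ h4⟩
    exact ⟨key ht, key (G.tile_symm ht)⟩

theorem Homotopic.append_left {G : AsyncGame} {s t : List G.E} (h : G.Homotopic s t)
    (u : List G.E) : G.Homotopic (u ++ s) (u ++ t) := by
  induction h with
  | refl => exact .refl _
  | symm _ ih => exact .symm ih
  | trans _ _ ih1 ih2 => exact .trans ih1 ih2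
  | tile w v ht =>
    have := Homotopic.tile (G := G) (u ++ w) v ht
    simpa using this

namespace Conf

variable {G : AsyncGame} (c : Conf G)

theorem evs_mono_path {x y : G.V} {s : List G.E} (h : G.Path x s y) : c.evs x ⊆ c.evs y := by
  induction s generalizing x with
  | nil => cases h; exact subset_rfl
  | cons e s ih =>
    obtain ⟨rfl, h2⟩ := h
    exact ((Set.subset_insert _ _).trans (c.evs_tgt e).ge).trans (ih h2)

theorem reach_iff {x y : G.V} : G.Reach x y ↔ c.evs x ⊆ c.evs y :=
  ⟨fun ⟨_, h⟩ => c.evs_mono_path h, c.reach_of_subset⟩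

theorem ev_mem_tgt (e : G.E) : c.ev e ∈ c.evs (G.tgt e) := by
  rw [c.evs_tgt]; exact Set.mem_insert _ _

theorem src_subset_tgt (e : G.E) : c.evs (G.src e) ⊆ c.evs (G.tgt e) := by
  rw [c.evs_tgt]; exact Set.subset_insert _ _

/-- A nonempty path adds an event, so a path between positions with the same events is empty. -/
theorem evs_injective {x y : G.V} (h : c.evs x = c.evs y) : x = y := by
  obtain ⟨s, hs⟩ := c.reach_of_subset h.le
  cases s with
  | nil => exact hs
  | cons e s =>
    obtain ⟨rfl, h2⟩ := hs
    exact absurd (h.ge (c.evs_mono_path h2 (c.ev_mem_tgt e))) (c.ev_notMem e)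

theorem mem_evs_of_path {x y : G.V} {s : List G.E} (h : G.Path x s y) (a : c.Ev) :
    a ∈ c.evs y ↔ a ∈ c.evs x ∨ ∃ e ∈ s, c.ev e = a := by
  induction s generalizing x with
  | nil => cases h; simp
  | cons e s ih =>
    obtain ⟨rfl, h2⟩ := h
    rw [ih h2, c.evs_tgt]
    simp only [Set.mem_insert_iff, List.mem_cons, exists_eq_or_imp]
    constructor
    · rintro ((rfl | h) | h) <;> simp_all
    · rintro (h | rfl | h) <;> simp_all

/-- The position `y` is obtained from `x` by adding the event `a`. -/
def Step (x : G.V) (a : c.Ev) (y : G.V) : Prop := a ∉ c.evs x ∧ c.evs y = insert a (c.evs x)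

variable {c}

theorem step_edge (e : G.E) : c.Step (G.src e) (c.ev e) (G.tgt e) := ⟨c.ev_notMem e, c.evs_tgt e⟩

theorem Step.subset {x y : G.V} {a : c.Ev} (h : c.Step x a y) : c.evs x ⊆ c.evs y := by
  rw [h.2]; exact Set.subset_insert _ _

theorem Step.mem {x y : G.V} {a : c.Ev} (h : c.Step x a y) : a ∈ c.evs y := by
  rw [h.2]; exact Set.mem_insert _ _

theorem Step.mem_iff {x y : G.V} {a : c.Ev} (h : c.Step x a y) (b : c.Ev) :
    b ∈ c.evs y ↔ b = a ∨ b ∈ c.evs x := by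
  rw [h.2]; exact Set.mem_insert_iff

theorem Step.unique {x y y' : G.V} {a : c.Ev} (h : c.Step x a y) (h' : c.Step x a y') : y = y' :=
  c.evs_injective (h.2.trans h'.2.symm)

theorem Step.subset_of {x y w : G.V} {a : c.Ev} (h : c.Step x a y) (hx : c.evs x ⊆ c.evs w)
    (ha : a ∈ c.evs w) : c.evs y ⊆ c.evs w := by
  rw [h.2]; exact Set.insert_subset ha hx

theorem exists_step {x y : G.V} (h : c.evs x ⊆ c.evs y) (hne : x ≠ y) :
    ∃ a x', c.Step x a x' ∧ c.evs x' ⊆ c.evs y := by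
  obtain ⟨s, hs⟩ := c.reach_of_subset h
  cases s with
  | nil => exact absurd hs hne
  | cons e s =>
    obtain ⟨rfl, h2⟩ := hs
    exact ⟨_, _, step_edge e, c.evs_mono_path h2⟩

theorem Step.exists_edge {x y : G.V} {a : c.Ev} (h : c.Step x a y) :
    ∃ e, G.src e = x ∧ G.tgt e = y ∧ c.ev e = a := by
  obtain ⟨s, hs⟩ := c.reach_of_subset h.subset
  cases s with
  | nil => cases hs; exact absurd h.mem h.1
  | cons e s =>
    obtain ⟨rfl, h2⟩ := hs
    have h3 : c.ev e = a := by
      have := c.evs_mono_path h2 (c.ev_mem_tgt e)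
      rw [h.mem_iff] at this
      exact this.resolve_right (c.ev_notMem e)
    subst h3
    exact ⟨e, rfl, (step_edge e).unique h, rfl⟩

theorem step_wf (c : Conf G) : WellFounded fun y x => ∃ a, c.Step x a y := by
  refine Subrelation.wf ?_ c.wf
  rintro y x ⟨a, h⟩
  obtain ⟨e, h1, h2, -⟩ := h.exists_edge
  exact ⟨e, h1, h2⟩

theorem evs_finite (c : Conf G) (x : G.V) : (c.evs x).Finite := by
  obtain ⟨s, hs⟩ := G.reachable x
  refine (s.finite_toSet.image c.ev).subset fun a ha => ?_
  rw [c.mem_evs_of_path hs, c.evs_init] at ha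
  exact ha.resolve_left (Set.notMem_empty a)

theorem ssubset_wf (c : Conf G) : WellFounded fun y x => c.evs x ⊂ c.evs y := by
  refine Subrelation.wf ?_ c.step_wf.transGen
  intro y x h
  obtain ⟨s, hs⟩ := c.reach_of_subset h.subset
  induction s generalizing x with
  | nil => cases hs; exact absurd h (ssubset_irrefl _)
  | cons e s ih =>
    obtain ⟨rfl, h2⟩ := hs
    rcases (c.evs_mono_path h2).eq_or_ssubset with h3 | h3
    · obtain rfl := c.evs_injective h3
      exact .single ⟨_, step_edge e⟩
    · exact .tail (ih h3 h2) ⟨_, step_edge e⟩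

/-- A position of least cardinality that satisfies `Q` equals its intersection with any other one.
-/
theorem exists_least (c : Conf G) {Q : G.V → Prop} (hQ : ∃ v, Q v)
    (hi : ∀ u v w, Q v → Q w → c.evs u = c.evs v ∩ c.evs w → Q u) :
    ∃ v, Q v ∧ ∀ w, Q w → c.evs v ⊆ c.evs w := by
  obtain ⟨v, hv, hmin⟩ := (measure fun v => (c.evs v).ncard).wf.has_min {v | Q v} hQ
  refine ⟨v, hv, fun w hw => ?_⟩
  obtain ⟨u, hu⟩ := c.inter v w
  have h1 := hmin u (hi u v w hv hw hu)
  have h2 : c.evs u ⊆ c.evs v := hu.le.trans Set.inter_subset_left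
  have h3 := Set.eq_of_subset_of_ncard_le h2 (not_lt.1 h1) (c.evs_finite v)
  rw [← h3, hu]
  exact Set.inter_subset_right

/-- The target of `p` bounds both `m` and `n`, which therefore form a tile; its remaining sides have
the sources and events of `p` and `q`, and these determine an edge. -/
theorem tile_mk (c : Conf G) {m p n q : G.E} (hmn : G.src m = G.src n) (hne : m ≠ n)
    (hp : G.src p = G.tgt m) (hq : G.src q = G.tgt n) (hp' : c.ev p = c.ev n)
    (hq' : c.ev q = c.ev m) : G.tile m p n q := by
  obtain ⟨p', q', ht⟩ := c.tile_of_subset (w := G.tgt p) hmn hne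
    (by rw [← hp]; exact c.src_subset_tgt p)
    (by
      rw [c.evs_tgt n, ← hp', ← hmn]
      refine Set.insert_subset (c.ev_mem_tgt p) ((c.src_subset_tgt m).trans ?_)
      rw [← hp]; exact c.src_subset_tgt p)
  obtain ⟨-, h2, h3, -⟩ := G.tile_bound ht
  obtain ⟨h5, h6⟩ := c.tile_ev ht
  obtain rfl := c.edge_ext (hp.trans h2) (hp'.trans h6)
  obtain rfl := c.edge_ext (hq.trans h3) (hq'.trans h5)
  exact ht

/-- The fourth corner is the union of `v₁` and `v₂`, which exists below the bound `w`. -/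
theorem Step.diamond {v v₁ v₂ w : G.V} {a b : c.Ev} (ha : c.Step v a v₁) (hb : c.Step v b v₂)
    (hne : a ≠ b) (h₁ : c.evs v₁ ⊆ c.evs w) (h₂ : c.evs v₂ ⊆ c.evs w) :
    ∃ u, c.Step v₁ b u ∧ c.Step v₂ a u ∧ c.evs u ⊆ c.evs w := by
  obtain ⟨u, hu⟩ := c.union h₁ h₂
  refine ⟨u, ⟨?_, ?_⟩, ⟨?_, ?_⟩, hu.le.trans (Set.union_subset h₁ h₂)⟩
  · rw [ha.mem_iff]
    rintro (rfl | h)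
    · exact hne rfl
    · exact hb.1 h
  · rw [hu, ha.2, hb.2]; ext; simp
  · rw [hb.mem_iff]
    rintro (rfl | h)
    · exact hne rfl
    · exact ha.1 h
  · rw [hu, ha.2, hb.2]; ext; simp; tauto

theorem Step.swap {v v₁ v₂ w : G.V} {a b : c.Ev} (ha : c.Step v a v₁) (hb : c.Step v b v₂)
    (h : c.Step v₁ b w) : c.Step v₂ a w := by
  have hab : a ≠ b := fun h' => h.1 (h' ▸ ha.mem)
  refine ⟨?_, ?_⟩
  · rw [hb.mem_iff]
    rintro (rfl | h)
    · exact hab rfl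
    · exact ha.1 h
  · rw [h.2, ha.2, hb.2]; exact Set.insert_comm _ _ _

theorem tile_step {m p n q : G.E} (ht : G.tile m p n q) :
    c.Step (G.tgt m) (c.ev n) (G.tgt p) ∧ c.Step (G.tgt n) (c.ev m) (G.tgt p) := by
  obtain ⟨-, h2, h3, h4⟩ := G.tile_bound ht
  obtain ⟨h5, h6⟩ := c.tile_ev ht
  have hp := step_edge (c := c) p
  have hq := step_edge (c := c) q
  rw [← h2, ← h6] at hp
  rw [← h3, ← h5, ← h4] at hq
  exact ⟨hp, hq⟩

theorem Step.diamond_of_pol {v v₁ v₂ : G.V} {a b : c.Ev} (ha : c.Step v a v₁)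
    (hb : c.Step v b v₂) (hne : c.polEv a ≠ c.polEv b) : ∃ u, c.Step v₁ b u ∧ c.Step v₂ a u := by
  obtain ⟨m, rfl, rfl, rfl⟩ := ha.exists_edge
  obtain ⟨n, h1, rfl, rfl⟩ := hb.exists_edge
  rw [← c.pol_ev, ← c.pol_ev] at hne
  obtain ⟨p, q, ht⟩ := c.tile_of_pol h1.symm hne
  exact ⟨_, tile_step ht⟩

/-! ### Homotopy -/

/-- The event of `m` occurs in `t`, and `m` is commuted with the transitions that come before it;
the bound `y` supplies the tiles. The class `T` serves to keep the new path inside the graph of a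
strategy. -/
theorem homotopic_front (c : Conf G) {T : G.E → Prop}
    (hT : ∀ {m p n q}, G.tile m p n q → T m → T n → T p ∧ T q)
    {x y : G.V} {t : List G.E} (ht : G.Path x t y) (hTt : ∀ e ∈ t, T e) {m : G.E}
    (hm : G.src m = x) (hTm : T m) (hy : c.evs (G.tgt m) ⊆ c.evs y) :
    ∃ t', G.Path (G.tgt m) t' y ∧ (∀ e ∈ t', T e) ∧ G.Homotopic t (m :: t') := by
  induction t generalizing x m with
  | nil =>
    cases ht; subst hm
    exact absurd (hy (c.ev_mem_tgt m)) (c.ev_notMem m)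
  | cons n t ih =>
    obtain ⟨rfl, h2⟩ := ht
    by_cases hmn : m = n
    · subst hmn
      exact ⟨t, h2, fun e he => hTt e (by simp [he]), .refl _⟩
    · obtain ⟨p, q, htile⟩ := c.tile_of_subset hm hmn hy (c.evs_mono_path h2)
      obtain ⟨b1, b2, b3, b4⟩ := G.tile_bound htile
      obtain ⟨hTp, hTq⟩ := hT htile hTm (hTt n (by simp))
      have hq : c.evs (G.tgt q) ⊆ c.evs y := by
        rw [c.evs_tgt, ← b3, ← (c.tile_ev htile).1]
        exact Set.insert_subset (hy (c.ev_mem_tgt m)) (c.evs_mono_path h2)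
      obtain ⟨t', h3, h4, h5⟩ := ih h2 (fun e he => hTt e (by simp [he])) b3.symm hTq hq
      refine ⟨p :: t', ⟨b2.symm, b4 ▸ h3⟩, ?_, ?_⟩
      · simpa [hTp] using h4
      · exact (h5.append_left [n]).trans (.tile [] t' (G.tile_symm htile))

/-- The transitions of `s` are brought one by one to the front of `t`. Positionality thereby becomes
a statement about positions alone. -/
theorem homotopic_of_path (c : Conf G) {x y : G.V} {s t : List G.E} (hs : G.Path x s y)
    (ht : G.Path x t y) : G.Homotopic s t := by
  induction s generalizing x t with
  | nil =>
    cases hs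
    cases t with
    | nil => exact .refl _
    | cons e t =>
      obtain ⟨rfl, h2⟩ := ht
      exact absurd (c.evs_mono_path h2 (c.ev_mem_tgt e)) (c.ev_notMem e)
  | cons m s ih =>
    obtain ⟨rfl, h2⟩ := hs
    obtain ⟨t', h3, -, h5⟩ := c.homotopic_front (T := fun _ => True)
      (fun _ _ _ => ⟨trivial, trivial⟩) ht (fun _ _ => trivial) rfl trivial (c.evs_mono_path h2)
    exact ((ih h2 h3).append_left [m]).trans h5.symm

/-! ### Chains inside a set of positions -/

/-- One step inside the set of positions `K`. -/
def KStep (c : Conf G) (K : G.V → Prop) (v w : G.V) : Prop := K v ∧ K w ∧ ∃ a, c.Step v a w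

/-- A sequence of steps inside the set of positions `K`. -/
def Chain (c : Conf G) (K : G.V → Prop) : G.V → G.V → Prop := Relation.ReflTransGen (c.KStep K)

/-- Closure under residuals, for sets of positions. -/
def ResClosed (c : Conf G) (K : G.V → Prop) : Prop :=
  ∀ v a b v₁ v₂ w, K v → c.Step v a v₁ → c.Step v b v₂ → K v₁ → K v₂ → c.Step v₁ b w → K w

/-- Closure under binary meets. -/
def InterClosed (c : Conf G) (K : G.V → Prop) : Prop :=
  ∀ u v w, K v → K w → c.evs u = c.evs v ∩ c.evs w → K u

theorem Chain.subset {K : G.V → Prop} {v w : G.V} (h : c.Chain K v w) : c.evs v ⊆ c.evs w := by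
  induction h with
  | refl => exact subset_rfl
  | tail _ h ih => obtain ⟨-, -, a, h⟩ := h; exact ih.trans h.subset

theorem Chain.mono {K K' : G.V → Prop} {v w : G.V} (h : c.Chain K v w)
    (hK : ∀ u, K u → c.evs v ⊆ c.evs u → c.evs u ⊆ c.evs w → K' u) : c.Chain K' v w := by
  induction h using Relation.ReflTransGen.head_induction_on with
  | refl => exact .refl
  | head h h' ih =>
    obtain ⟨h1, h2, a, h3⟩ := h
    have h4 : c.evs _ ⊆ c.evs _ := Chain.subset h'
    exact .head ⟨hK _ h1 subset_rfl (h3.subset.trans h4), hK _ h2 h3.subset h4, a, h3⟩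
      (ih fun u hu hu1 hu2 => hK u hu (h3.subset.trans hu1) hu2)

theorem Chain.right {K : G.V → Prop} {v w : G.V} (h : c.Chain K v w) (hv : K v) : K w := by
  cases h with
  | refl => exact hv
  | tail _ h => exact h.2.1

/-- The residual of the chain after `a` stays in `K` by closure under residuals, and loses the step
that adds `a`. -/
theorem Chain.front {K : G.V → Prop} (hK : c.ResClosed K) {v v₁ w : G.V} {a : c.Ev}
    (h : c.Chain K v w) (ha : c.Step v a v₁) (h₁ : K v₁) (hw : c.evs v₁ ⊆ c.evs w) :
    c.Chain K v₁ w := by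
  induction h using Relation.ReflTransGen.head_induction_on generalizing v₁ with
  | refl => exact absurd (hw ha.mem) ha.1
  | head h h' ih =>
    obtain ⟨hv, h2, b, hb⟩ := h
    by_cases hab : a = b
    · subst hab
      obtain rfl := ha.unique hb
      exact h'
    · obtain ⟨u, hu1, hu2, hu3⟩ := ha.diamond hb hab hw (Chain.subset h')
      have hu : K u := hK _ _ _ _ _ _ hv ha hb h₁ h2 hu1
      exact .head ⟨h₁, hu, b, hu1⟩ (ih hu2 hu hu3)

/-- The steps of the chain to `x` are removed one by one from the chain to `y`. -/
theorem Chain.of_subset {K : G.V → Prop} (hK : c.ResClosed K) {z x y : G.V}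
    (hx : c.Chain K z x) (hy : c.Chain K z y) (h : c.evs x ⊆ c.evs y) : c.Chain K x y := by
  induction hx using Relation.ReflTransGen.head_induction_on with
  | refl => exact hy
  | head h1 h2 ih =>
    obtain ⟨-, h4, a, h5⟩ := h1
    exact ih (hy.front hK h5 h4 ((Chain.subset h2).trans h))

/-- No common bound is given here: the diamonds come from the hypothesis `hd`, which is either
determinism of `a` or, in `Chain.join`, the confinement of the chain below a union. -/
theorem Chain.push {K : G.V → Prop} {a : c.Ev}
    (hd : ∀ v b v₁ v₂, K v → c.Step v a v₁ → c.Step v b v₂ → K v₁ → K v₂ → a ≠ b →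
      ∃ u, c.Step v₁ b u ∧ K u) {v v₁ w : G.V}
    (h : c.Chain K v w) (ha : c.Step v a v₁) (h₁ : K v₁) :
    a ∈ c.evs w ∨ ∃ w₁, c.Step w a w₁ ∧ K w₁ ∧ c.Chain K v₁ w₁ := by
  induction h using Relation.ReflTransGen.head_induction_on generalizing v₁ with
  | refl => exact .inr ⟨v₁, ha, h₁, .refl⟩
  | head h h' ih =>
    obtain ⟨hv, h2, b, hb⟩ := h
    by_cases hab : a = b
    · subst hab
      exact .inl (Chain.subset h' hb.mem)
    · obtain ⟨u, hu1, hu⟩ := hd _ _ _ _ hv ha hb h₁ h2 hab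
      rcases ih (ha.swap hb hu1) hu with h3 | ⟨w₁, h3, h4, h5⟩
      · exact .inl h3
      · exact .inr ⟨w₁, h3, h4, .head ⟨h₁, hu, b, hu1⟩ h5⟩

theorem Chain.join {K : G.V → Prop} (hK : c.ResClosed K) {z x y u : G.V} (hz : K z)
    (hx : c.Chain K z x) (hy : c.Chain K z y) (hu : c.evs u = c.evs x ∪ c.evs y) :
    K u ∧ c.Chain K x u := by
  induction hx using Relation.ReflTransGen.head_induction_on generalizing y with
  | refl =>
    rw [Set.union_eq_self_of_subset_left hy.subset] at hu
    obtain rfl := c.evs_injective hu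
    exact ⟨hy.right hz, hy⟩
  | head h1 h2 ih =>
    obtain ⟨-, h4, a, h5⟩ := h1
    have hax : a ∈ c.evs x := Chain.subset h2 h5.mem
    by_cases hay : a ∈ c.evs y
    · exact ih h4 (hy.front hK h5 h4 (h5.subset_of hy.subset hay)) hu
    · have hyu : c.evs y ⊆ c.evs u := by rw [hu]; exact Set.subset_union_right
      -- Confining the chain below `u` makes all the diamonds needed by `Chain.push` bounded.
      have hy' : c.Chain (fun v => K v ∧ c.evs v ⊆ c.evs u) _ y :=
        hy.mono fun v hv _ h => ⟨hv, h.trans hyu⟩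
      obtain ⟨y₁, h6, h7, h8⟩ := (hy'.push (a := a) (fun v b v₁ v₂ hv ha hb h₁ h₂ hab => by
        obtain ⟨w, hw1, hw2, hw3⟩ := ha.diamond hb hab h₁.2 h₂.2
        exact ⟨w, hw1, hK _ _ _ _ _ _ hv.1 ha hb h₁.1 h₂.1 hw1, hw3⟩) h5
        ⟨h4, by rw [hu]; exact (Chain.subset h2).trans Set.subset_union_left⟩).resolve_left hay
      refine ih h4 (h8.mono fun v hv _ _ => hv.1) ?_
      rw [hu, h6.2]
      ext b; simp only [Set.mem_union, Set.mem_insert_iff]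
      constructor
      · tauto
      · rintro (h | rfl | h) <;> tauto

/-- The positions of the chain are intersected with `u`; each step either survives or collapses. -/
theorem Chain.inter {K : G.V → Prop} (hK : c.InterClosed K) {v w u : G.V} (hu : K u)
    (h : c.Chain K v w) (huw : c.evs u ⊆ c.evs w) (hvu : c.evs v ⊆ c.evs u) : c.Chain K v u := by
  induction h generalizing u with
  | refl => obtain rfl := c.evs_injective (hvu.antisymm huw); exact .refl
  | @tail w w' h h' ih =>
    obtain ⟨h1, h2, a, ha⟩ := h'
    obtain ⟨u', hu'⟩ := c.inter u w
    have hKu' := hK _ _ _ hu h1 hu'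
    have h3 := ih hKu' (hu'.le.trans Set.inter_subset_right)
      (by rw [hu']; exact Set.subset_inter hvu (Chain.subset h))
    by_cases hau : a ∈ c.evs u
    · refine .tail h3 ⟨hKu', hu, a, ⟨?_, ?_⟩⟩
      · rw [hu']; exact fun h => ha.1 h.2
      · rw [hu']
        ext b
        have := @huw b
        rw [ha.mem_iff] at this
        simp only [Set.mem_insert_iff, Set.mem_inter_iff]
        constructor
        · intro hb; rcases this hb with rfl | h <;> tauto
        · rintro (rfl | h) <;> tauto
    · have : c.evs u' = c.evs u := by
        rw [hu']
        refine Set.inter_eq_left.2 fun b hb => ?_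
        rcases (ha.mem_iff b).1 (huw hb) with rfl | h
        · exact absurd hb hau
        · exact h
      obtain rfl := c.evs_injective this
      exact h3

end Conf
end AsyncGame
end AsyncConc

/-! ### Configurations of the games of formulas -/

namespace AsyncConc
namespace AsyncGame
namespace Conf

/-- The configurations of the dual game. -/
def dual {G : AsyncGame} (c : Conf G) : Conf G.dual where
  Ev := c.Ev
  ev := c.ev
  evs := c.evs
  polEv a := (c.polEv a).opp
  evs_init := c.evs_init
  ev_notMem := c.ev_notMem
  evs_tgt := c.evs_tgt
  reach_of_subset := c.reach_of_subset
  inter := c.inter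
  union := c.union
  edge_ext := c.edge_ext
  tile_ev := c.tile_ev
  tile_of_subset := c.tile_of_subset
  tile_of_pol h hne := c.tile_of_pol h fun h' => hne (congrArg Polarity.opp h')
  pol_ev e := congrArg Polarity.opp (c.pol_ev e)
  conflict_enabled := c.conflict_enabled
  wf := c.wf

/-- The events of a pair of positions. -/
def prodEvs {α β V W : Type} (f : V → Set α) (g : W → Set β) (v : V × W) : Set (α ⊕ β) :=
  {a | Sum.elim (· ∈ f v.1) (· ∈ g v.2) a}

section

variable {α β V W : Type} {f : V → Set α} {g : W → Set β}

@[simp] theorem inl_mem_prodEvs {v : V × W} {a : α} : .inl a ∈ prodEvs f g v ↔ a ∈ f v.1 := Iff.rfl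

@[simp] theorem inr_mem_prodEvs {v : V × W} {b : β} : .inr b ∈ prodEvs f g v ↔ b ∈ g v.2 := Iff.rfl

theorem prodEvs_subset {v w : V × W} :
    prodEvs f g v ⊆ prodEvs f g w ↔ f v.1 ⊆ f w.1 ∧ g v.2 ⊆ g w.2 :=
  ⟨fun h => ⟨fun a ha => h (a := .inl a) ha, fun b hb => h (a := .inr b) hb⟩,
    fun h a ha => by
      rcases a with a | b
      · exact h.1 ha
      · exact h.2 ha⟩

theorem prodEvs_insert_left {x x' : V} {a : α} (h : f x' = insert a (f x)) (y : W) :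
    prodEvs f g (x', y) = insert (.inl a) (prodEvs f g (x, y)) := by
  ext (b | b) <;> simp [h]

theorem prodEvs_insert_right (x : V) {y y' : W} {b : β} (h : g y' = insert b (g y)) :
    prodEvs f g (x, y') = insert (.inr b) (prodEvs f g (x, y)) := by
  ext (b | b) <;> simp [h]

end

/-- The configurations of the asynchronous product. -/
def prod {G H : AsyncGame} (c : Conf G) (d : Conf H) : Conf (G.prod H) where
  Ev := c.Ev ⊕ d.Ev
  ev := Sum.map (fun m => c.ev m.1) (fun n => d.ev n.2)
  evs := prodEvs c.evs d.evs
  polEv := Sum.elim c.polEv d.polEv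
  evs_init := by
    ext (a | b)
    · exact (Set.ext_iff.1 c.evs_init a)
    · exact (Set.ext_iff.1 d.evs_init b)
  ev_notMem := by
    rintro (⟨m, y⟩ | ⟨x, n⟩)
    · exact c.ev_notMem m
    · exact d.ev_notMem n
  evs_tgt := by
    rintro (⟨m, y⟩ | ⟨x, n⟩)
    · exact prodEvs_insert_left (c.evs_tgt m) y
    · exact prodEvs_insert_right x (d.evs_tgt n)
  reach_of_subset h := by
    replace h := prodEvs_subset.1 h
    exact (reach_prod _ _).2 ⟨c.reach_of_subset h.1, d.reach_of_subset h.2⟩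
  inter := by
    rintro ⟨x, y⟩ ⟨x', y'⟩
    obtain ⟨u, hu⟩ := c.inter x x'
    obtain ⟨v, hv⟩ := d.inter y y'
    refine ⟨(u, v), ?_⟩
    ext (a | b)
    · simp [hu]
    · simp [hv]
  union := by
    rintro ⟨x, y⟩ ⟨x', y'⟩ ⟨w, w'⟩ h h'
    replace h := prodEvs_subset.1 h
    replace h' := prodEvs_subset.1 h'
    obtain ⟨u, hu⟩ := c.union h.1 h'.1
    obtain ⟨v, hv⟩ := d.union h.2 h'.2
    refine ⟨(u, v), ?_⟩
    ext (a | b)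
    · simp [hu]
    · simp [hv]
  edge_ext := by
    rintro (⟨m, y⟩ | ⟨x, n⟩) (⟨m', y'⟩ | ⟨x', n'⟩) h h'
    · cases Prod.mk.inj h with
      | intro h1 h2 =>
        obtain rfl := c.edge_ext h1 (Sum.inl.inj h')
        obtain rfl := h2
        rfl
    · cases h'
    · cases h'
    · cases Prod.mk.inj h with
      | intro h1 h2 =>
        obtain rfl := d.edge_ext h2 (Sum.inr.inj h')
        obtain rfl := h1
        rfl
  tile_ev := by
    rintro _ _ _ _ (⟨y, h⟩ | ⟨x, h⟩ | _ | _)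
    · exact ⟨congrArg Sum.inl (c.tile_ev h).1, congrArg Sum.inl (c.tile_ev h).2⟩
    · exact ⟨congrArg Sum.inr (d.tile_ev h).1, congrArg Sum.inr (d.tile_ev h).2⟩
    · exact ⟨rfl, rfl⟩
    · exact ⟨rfl, rfl⟩
  tile_of_subset := by
    rintro (⟨m, y⟩ | ⟨x, n⟩) (⟨m', y'⟩ | ⟨x', n'⟩) w h hne h1 h2
    · obtain ⟨h3, h4⟩ := Prod.mk.inj h
      subst h4
      replace h1 := prodEvs_subset.1 h1
      replace h2 := prodEvs_subset.1 h2
      obtain ⟨p, q, ht⟩ := c.tile_of_subset h3 (fun h => hne (by rw [h])) h1.1 h2.1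
      exact ⟨_, _, .left _ ht⟩
    · obtain ⟨h3, h4⟩ := Prod.mk.inj h
      subst h3 h4
      exact ⟨_, _, .leftRight _ _⟩
    · obtain ⟨h3, h4⟩ := Prod.mk.inj h
      subst h3 h4
      exact ⟨_, _, .rightLeft _ _⟩
    · obtain ⟨h3, h4⟩ := Prod.mk.inj h
      subst h3
      replace h1 := prodEvs_subset.1 h1
      replace h2 := prodEvs_subset.1 h2
      obtain ⟨p, q, ht⟩ := d.tile_of_subset h4 (fun h => hne (by rw [h])) h1.2 h2.2
      exact ⟨_, _, .right _ ht⟩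
  tile_of_pol := by
    rintro (⟨m, y⟩ | ⟨x, n⟩) (⟨m', y'⟩ | ⟨x', n'⟩) h hne
    · obtain ⟨h3, h4⟩ := Prod.mk.inj h
      subst h4
      obtain ⟨p, q, ht⟩ := c.tile_of_pol h3 hne
      exact ⟨_, _, .left _ ht⟩
    · obtain ⟨h3, h4⟩ := Prod.mk.inj h
      subst h3 h4
      exact ⟨_, _, .leftRight _ _⟩
    · obtain ⟨h3, h4⟩ := Prod.mk.inj h
      subst h3 h4
      exact ⟨_, _, .rightLeft _ _⟩
    · obtain ⟨h3, h4⟩ := Prod.mk.inj h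
      subst h3
      obtain ⟨p, q, ht⟩ := d.tile_of_pol h4 hne
      exact ⟨_, _, .right _ ht⟩
  pol_ev := by
    rintro (⟨m, y⟩ | ⟨x, n⟩)
    · exact c.pol_ev m
    · exact d.pol_ev n
  conflict_enabled := by
    rintro (⟨m, y⟩ | ⟨x, n⟩) (⟨m₁, y₁⟩ | ⟨x₁, n₁⟩) (⟨m₂, y₂⟩ | ⟨x₂, n₂⟩) h h' h₁₂ ht
    · obtain ⟨h3, h4⟩ := Prod.mk.inj h₁₂
      subst h4
      replace h := prodEvs_subset.1 h
      obtain ⟨e, h5, h6, h7⟩ := c.conflict_enabled h.1 (Sum.inl.inj h') h3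
        fun ⟨p, q, h⟩ => ht ⟨_, _, .left _ h⟩
      refine ⟨.inl (e, y), congrArg (·, y) h5, congrArg Sum.inl h6, ?_⟩
      rintro ⟨_, _, ht⟩
      cases ht with
      | left _ h => exact h7 ⟨_, _, h⟩
    · obtain ⟨h3, h4⟩ := Prod.mk.inj h₁₂
      subst h3 h4
      exact absurd ⟨_, _, .leftRight _ _⟩ ht
    · cases h'
    · cases h'
    · cases h'
    · cases h'
    · obtain ⟨h3, h4⟩ := Prod.mk.inj h₁₂
      subst h3 h4
      exact absurd ⟨_, _, .rightLeft _ _⟩ ht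
    · obtain ⟨h3, h4⟩ := Prod.mk.inj h₁₂
      subst h3
      replace h := prodEvs_subset.1 h
      obtain ⟨e, h5, h6, h7⟩ := d.conflict_enabled h.2 (Sum.inr.inj h') h4
        fun ⟨p, q, h⟩ => ht ⟨_, _, .right _ h⟩
      refine ⟨.inr (x, e), congrArg (x, ·) h5, congrArg Sum.inr h6, ?_⟩
      rintro ⟨_, _, ht⟩
      cases ht with
      | right _ h => exact h7 ⟨_, _, h⟩
  wf := by
    refine Subrelation.wf ?_ (c.wf.prod_gameAdd d.wf)
    rintro _ _ ⟨⟨m, y⟩ | ⟨x, n⟩, rfl, rfl⟩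
    · exact .fst ⟨m, rfl, rfl⟩
    · exact .snd ⟨n, rfl, rfl⟩

/-- The events of a position of `choice p ι G`. -/
def choiceEvs {ι : Type} {G : ι → AsyncGame} (c : ∀ i, Conf (G i)) :
    Option (Σ i, (G i).V) → Set (ι ⊕ Σ i, (c i).Ev)
  | none => ∅
  | some ⟨i, x⟩ => insert (.inl i) ((fun a => .inr ⟨i, a⟩) '' (c i).evs x)

section

variable {ι : Type} {G : ι → AsyncGame} {c : ∀ i, Conf (G i)}

theorem choiceEvs_subset {i : ι} {x : (G i).V} {v : Option (Σ i, (G i).V)}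
    (h : choiceEvs c (some ⟨i, x⟩) ⊆ choiceEvs c v) :
    ∃ y, v = some ⟨i, y⟩ ∧ (c i).evs x ⊆ (c i).evs y := by
  rcases v with _ | ⟨j, y⟩
  · exact absurd (h (Set.mem_insert _ _)) (Set.notMem_empty _)
  · obtain rfl : i = j := by simpa [choiceEvs] using h (Set.mem_insert _ _)
    refine ⟨y, rfl, fun a ha => ?_⟩
    have := h (Set.mem_insert_of_mem _ ⟨a, ha, rfl⟩)
    simpa [choiceEvs] using this

end

/-- The configurations of `choice p ι G`. -/
def choice {p : Polarity} {ι : Type} {G : ι → AsyncGame} (c : ∀ i, Conf (G i)) :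
    Conf (AsyncGame.choice p ι G) where
  Ev := ι ⊕ Σ i, (c i).Ev
  ev := Sum.map id fun m => ⟨m.1, (c m.1).ev m.2⟩
  evs := choiceEvs c
  polEv := Sum.elim (fun _ => p) fun a => (c a.1).polEv a.2
  evs_init := rfl
  ev_notMem := by
    rintro (i | ⟨i, m⟩)
    · exact Set.notMem_empty _
    · simpa [choiceEvs, AsyncGame.choice, choiceSrc] using (c i).ev_notMem m
  evs_tgt := by
    rintro (i | ⟨i, m⟩)
    · simp [choiceEvs, AsyncGame.choice, choiceSrc, choiceTgt, (c i).evs_init]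
    · simp only [choiceEvs, AsyncGame.choice, choiceSrc, choiceTgt, (c i).evs_tgt,
        Set.image_insert_eq]
      exact Set.insert_comm _ _ _
  reach_of_subset := by
    rintro (_ | ⟨i, x⟩) v h
    · exact reach_choice_none _
    · obtain ⟨y, rfl, h2⟩ := choiceEvs_subset h
      exact (reach_choice_some _ _ _).2 ((c i).reach_of_subset h2)
  inter := by
    rintro (_ | ⟨i, x⟩) (_ | ⟨j, y⟩)
    · exact ⟨none, by simp [choiceEvs]⟩
    · exact ⟨none, by simp [choiceEvs]⟩
    · exact ⟨none, by simp [choiceEvs]⟩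
    · by_cases hij : i = j
      · subst hij
        obtain ⟨z, hz⟩ := (c i).inter x y
        refine ⟨some ⟨i, z⟩, ?_⟩
        simp only [choiceEvs, hz]
        rw [← Set.insert_inter_distrib, Set.image_inter]
        intro a b h
        simpa using h
      · refine ⟨none, ?_⟩
        ext (a | ⟨k, a⟩)
        · simp only [choiceEvs]
          simp
          rintro rfl
          exact hij
        · simp only [choiceEvs]
          simp
          rintro _ _ rfl _ _ _ rfl
          exact absurd rfl hij
  union := by
    rintro (_ | ⟨i, x⟩) (_ | ⟨j, y⟩) w h h'
    · exact ⟨none, by simp [choiceEvs]⟩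
    · exact ⟨some ⟨j, y⟩, by simp [choiceEvs]⟩
    · exact ⟨some ⟨i, x⟩, by simp [choiceEvs]⟩
    · obtain ⟨w₁, rfl, h1⟩ := choiceEvs_subset h
      obtain ⟨w₂, h3, h2⟩ := choiceEvs_subset h'
      cases h3
      obtain ⟨z, hz⟩ := (c i).union h1 h2
      refine ⟨some ⟨i, z⟩, ?_⟩
      simp only [choiceEvs, hz, Set.image_union]
      exact Set.insert_union_distrib _ _ _
  edge_ext := by
    rintro (i | ⟨i, m⟩) (j | ⟨j, n⟩) h h'
    · cases h'; rfl
    · cases h'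
    · cases h'
    · simp [AsyncGame.choice, choiceSrc] at h
      obtain ⟨rfl, h⟩ := h
      have h2 : (c i).ev m = (c i).ev n := by simpa using h'
      rw [(c i).edge_ext (eq_of_heq h) h2]
  tile_ev := by
    rintro _ _ _ _ ⟨i, h⟩
    obtain ⟨h1, h2⟩ := (c i).tile_ev h
    simp [h1, h2]
  tile_of_subset := by
    rintro (i | ⟨i, m⟩) (j | ⟨j, n⟩) w h hne h1 h2
    · obtain ⟨y, rfl, h3⟩ := choiceEvs_subset h1
      obtain ⟨y', h4, h5⟩ := choiceEvs_subset h2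
      cases h4
      exact absurd rfl hne
    · cases h
    · cases h
    · simp [AsyncGame.choice, choiceSrc] at h
      obtain ⟨rfl, h⟩ := h
      obtain ⟨y, rfl, h3⟩ := choiceEvs_subset h1
      obtain ⟨y', h4, h5⟩ := choiceEvs_subset h2
      cases h4
      obtain ⟨p, q, ht⟩ := (c i).tile_of_subset (eq_of_heq h) (fun h => hne (by rw [h])) h3 h5
      exact ⟨_, _, .mk i ht⟩
  tile_of_pol := by
    rintro (i | ⟨i, m⟩) (j | ⟨j, n⟩) h hne
    · exact absurd rfl hne
    · cases h
    · cases h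
    · simp [AsyncGame.choice, choiceSrc] at h
      obtain ⟨rfl, h⟩ := h
      obtain ⟨p, q, ht⟩ := (c i).tile_of_pol (eq_of_heq h) hne
      exact ⟨_, _, .mk i ht⟩
  pol_ev := by
    rintro (i | ⟨i, m⟩)
    · rfl
    · exact (c i).pol_ev m
  conflict_enabled := by
    rintro (i | ⟨i, m⟩) (i₁ | ⟨i₁, m₁⟩) (i₂ | ⟨i₂, m₂⟩) h h' h₁₂ ht
    -- Initial moves are all enabled at `†` and lie in no tile.
    · exact ⟨.inl i₂, rfl, rfl, fun ⟨_, _, ht⟩ => nomatch ht⟩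
    · cases h₁₂
    · cases h'
    · cases h'
    · cases h'
    · cases h'
    · cases h₁₂
    · simp [AsyncGame.choice, choiceSrc] at h₁₂
      obtain ⟨rfl, h₁₂⟩ := h₁₂
      obtain ⟨y, h3, h4⟩ := choiceEvs_subset h
      cases h3
      have h2 : (c i).ev m = (c i).ev m₁ := by simpa using h'
      obtain ⟨e, h5, h6, h7⟩ := (c i).conflict_enabled h4 h2 (eq_of_heq h₁₂)
        fun ⟨p, q, h⟩ => ht ⟨_, _, .mk i h⟩
      refine ⟨.inr ⟨i, e⟩, ?_, ?_, ?_⟩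
      · exact congrArg (fun x => some (⟨i, x⟩ : Σ i, (G i).V)) h5
      · exact congrArg (fun x => Sum.inr (⟨i, x⟩ : Σ i, (c i).Ev)) h6
      · rintro ⟨_, _, ht⟩
        cases ht with
        | mk _ h => exact h7 ⟨_, _, h⟩
  wf := by
    -- No transition returns to `†`, so accessibility is settled inside each component first.
    have hs : ∀ i x, Acc (fun y x => ∃ e, (AsyncGame.choice p ι G).src e = x ∧
        (AsyncGame.choice p ι G).tgt e = y) (some ⟨i, x⟩) := by
      intro i x
      induction x using (c i).wf.induction with
      | _ x ih =>
        constructor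
        rintro _ ⟨j | ⟨j, m⟩, h, rfl⟩
        · cases h
        · cases h
          exact ih _ ⟨m, rfl, rfl⟩
    refine ⟨?_⟩
    rintro (_ | ⟨i, x⟩)
    · constructor
      rintro _ ⟨j | ⟨j, m⟩, h, rfl⟩
      · exact hs _ _
      · cases h
    · exact hs i x

/-- The configurations of a sequential game: the events of a position are the transitions of the
play that leads to it. -/
def ofSequential {G : AsyncGame} (h : G.IsSequential) : Conf G :=
  have mem_iff : ∀ {x s}, G.Path G.init s x → ∀ e,
      (∃ t, G.Path G.init t x ∧ e ∈ t) ↔ e ∈ s := fun {x s} hs e =>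
    ⟨fun ⟨t, ht, he⟩ => h.tree _ _ _ ht hs ▸ he, fun he => ⟨s, hs, he⟩⟩
  have reach_of_mem : ∀ {x e}, (∃ t, G.Path G.init t x ∧ e ∈ t) → G.Reach (G.tgt e) x := by
    rintro x e ⟨t, ht, he⟩
    obtain ⟨t₁, t₂, rfl⟩ := List.append_of_mem he
    obtain ⟨z, -, -, h2⟩ := isPathOn_append_inv ht
    exact ⟨t₂, h2⟩
  have mem_of_reach : ∀ {x e}, G.Reach (G.tgt e) x → ∃ t, G.Path G.init t x ∧ e ∈ t := by
    rintro x e ⟨u, hu⟩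
    obtain ⟨s, hs⟩ := G.reachable (G.src e)
    exact ⟨s ++ e :: u, isPathOn_append hs ⟨rfl, hu⟩, by simp⟩
  have mono : ∀ {x y}, G.Reach x y →
      {e | ∃ t, G.Path G.init t x ∧ e ∈ t} ⊆ {e | ∃ t, G.Path G.init t y ∧ e ∈ t} :=
    fun hr _ he => mem_of_reach ((reach_of_mem he).trans hr)
  have reach : ∀ {x y},
      {e | ∃ t, G.Path G.init t x ∧ e ∈ t} ⊆ {e | ∃ t, G.Path G.init t y ∧ e ∈ t} →
      G.Reach x y := by
    intro x y hxy
    obtain ⟨s, hs⟩ := G.reachable x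
    rcases s.eq_nil_or_concat with rfl | ⟨s, e, rfl⟩
    · cases hs; exact G.reachable y
    · rw [List.concat_eq_append] at hs
      obtain ⟨z, -, h1, h2⟩ := isPathOn_append_inv hs
      cases h2
      exact reach_of_mem (hxy ⟨_, hs, by simp⟩)
  -- The plays to `w` through `x` and through `y` coincide, so the prefixes leading to `x` and `y`
  -- are comparable.
  have total : ∀ {x y w}, G.Reach x w → G.Reach y w → G.Reach x y ∨ G.Reach y x := by
    rintro x y w ⟨u, hu⟩ ⟨v, hv⟩
    obtain ⟨s, hs⟩ := G.reachable x
    obtain ⟨t, ht⟩ := G.reachable y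
    have key := h.tree _ _ _ (isPathOn_append hs hu) (isPathOn_append ht hv)
    rcases List.append_eq_append_iff.1 key with ⟨a, rfl, -⟩ | ⟨a, rfl, -⟩
    · obtain ⟨z, h1, h2⟩ := isPathOn_append_inv ht
      obtain rfl := path_target (G := G) h1 hs
      exact .inl ⟨_, h2⟩
    · obtain ⟨z, h1, h2⟩ := isPathOn_append_inv hs
      obtain rfl := path_target (G := G) h1 ht
      exact .inr ⟨_, h2⟩
  { Ev := G.E
    ev := id
    evs := fun x => {e | ∃ t, G.Path G.init t x ∧ e ∈ t}
    polEv := G.pol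
    evs_init := by
      ext e
      exact (mem_iff (s := []) rfl e).trans (by simp)
    ev_notMem := by
      rintro e ⟨t, ht, he⟩
      obtain ⟨t₁, t₂, rfl⟩ := List.append_of_mem he
      obtain ⟨z, h1, h2, h3⟩ := isPathOn_append_inv ht
      cases h2
      have := congrArg List.length (h.tree _ _ _ h1 ht)
      simp at this
    evs_tgt := by
      intro e
      obtain ⟨s, hs⟩ := G.reachable (G.src e)
      ext e'
      refine (mem_iff (isPathOn_append hs (Path.single e)) e').trans ?_
      have h1 := mem_iff hs e'
      simp only [List.mem_append, List.mem_singleton, Set.mem_insert_iff, id]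
      rw [or_comm]
      exact or_congr Iff.rfl h1.symm
    reach_of_subset := reach
    inter := by
      intro x y
      obtain ⟨m, h1, h2⟩ := h.isDomain.glb {x, y} ⟨x, by simp⟩
      refine ⟨m, Set.Subset.antisymm (Set.subset_inter (mono (h1 x (by simp)))
        (mono (h1 y (by simp)))) ?_⟩
      rintro e ⟨he, he'⟩
      refine mem_of_reach (h2 _ ?_)
      rintro z (rfl | rfl)
      · exact reach_of_mem he
      · exact reach_of_mem he'
    union := by
      intro x y w h1 h2
      rcases total (reach h1) (reach h2) with h3 | h3
      · exact ⟨y, (Set.union_eq_self_of_subset_left (mono h3)).symm⟩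
      · exact ⟨x, (Set.union_eq_self_of_subset_right (mono h3)).symm⟩
    edge_ext := fun _ h => h
    tile_ev := fun ht => absurd ht (h.no_tile _ _ _ _)
    tile_of_subset := by
      intro m n w hs hne h1 h2
      exfalso
      obtain ⟨s, hs'⟩ := G.reachable (G.src m)
      obtain ⟨u, hu⟩ := reach h1
      obtain ⟨v, hv⟩ := reach h2
      have h3 : G.Path G.init (s ++ m :: u) w := isPathOn_append hs' ⟨rfl, hu⟩
      have h4 : G.Path G.init (s ++ n :: v) w := isPathOn_append hs' ⟨hs.symm, hv⟩
      have := h.tree _ _ _ h3 h4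
      simp at this
      exact hne this.1
    tile_of_pol := fun hs hne => absurd (h.turn _ _ hs) hne
    pol_ev := fun _ => rfl
    conflict_enabled := by
      -- Events are transitions here, so `e = e₁` and `e₂` itself is the conflicting transition.
      rintro e e₁ e₂ - h1 h2 -
      cases h1
      exact ⟨e₂, h2.symm, rfl, fun ⟨_, _, ht⟩ => h.no_tile _ _ _ _ ht⟩
    wf := by
      rw [wellFounded_iff_isEmpty_descending_chain]
      refine ⟨?_⟩
      rintro ⟨f, hf⟩
      choose e he using hf
      exact h.finite ⟨e, fun n => (he n).2.trans (he (n + 1)).1.symm⟩ }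

end Conf
end AsyncGame
end AsyncConc

/-! ### Ingenuous strategies as sets of positions -/

namespace AsyncConc
namespace AsyncGame

/-- `G.Along K x s y`: the path `s` from `x` to `y` stays inside the set of positions `K`. -/
def Along (G : AsyncGame) (K : G.V → Prop) : G.V → List G.E → G.V → Prop
  | x, [], y => x = y ∧ K x
  | x, e :: l, y => G.src e = x ∧ K x ∧ Along G K (G.tgt e) l y

namespace Along

variable {G : AsyncGame} {K : G.V → Prop} {x y z : G.V} {s t : List G.E}

theorem path (h : G.Along K x s y) : G.Path x s y := by
  induction s generalizing x with
  | nil => exact h.1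
  | cons e s ih => exact ⟨h.1, ih h.2.2⟩

theorem left (h : G.Along K x s y) : K x := by
  cases s with
  | nil => exact h.2
  | cons e s => exact h.2.1

theorem right (h : G.Along K x s y) : K y := by
  induction s generalizing x with
  | nil => exact h.1 ▸ h.2
  | cons e s ih => exact ih h.2.2

theorem append (hs : G.Along K x s y) (ht : G.Along K y t z) : G.Along K x (s ++ t) z := by
  induction s generalizing x with
  | nil => obtain ⟨rfl, -⟩ := hs; exact ht
  | cons e s ih => exact ⟨hs.1, hs.2.1, ih hs.2.2⟩

theorem append_inv (h : G.Along K x (s ++ t) z) : ∃ y, G.Along K x s y ∧ G.Along K y t z := by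
  induction s generalizing x with
  | nil => exact ⟨x, ⟨rfl, h.left⟩, h⟩
  | cons e s ih =>
    obtain ⟨y, h1, h2⟩ := ih h.2.2
    exact ⟨y, ⟨h.1, h.2.1, h1⟩, h2⟩

theorem mono {K' : G.V → Prop} (hK : ∀ v, K v → K' v) (h : G.Along K x s y) :
    G.Along K' x s y := by
  induction s generalizing x with
  | nil => exact ⟨h.1, hK _ h.2⟩
  | cons e s ih => exact ⟨h.1, hK _ h.2.1, ih h.2.2⟩

theorem single {e : G.E} (h : K (G.src e)) (h' : K (G.tgt e)) :
    G.Along K (G.src e) [e] (G.tgt e) := ⟨rfl, h, rfl, h'⟩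

theorem of_path (h : G.Path x s y)
    (hK : ∀ t, t <+: s → ∀ v, G.Path x t v → K v) : G.Along K x s y := by
  induction s generalizing x with
  | nil => exact ⟨h, hK [] (List.prefix_refl _) x rfl⟩
  | cons e s ih =>
    refine ⟨h.1, hK [] List.nil_prefix x rfl, ih h.2 fun t ht v hv => ?_⟩
    exact hK (e :: t) ((List.prefix_cons_inj e).2 ht) v ⟨h.1, hv⟩

theorem of_prefix (h : G.Along K x s y) (ht : t <+: s) (hv : G.Path x t z) : K z := by
  obtain ⟨u, rfl⟩ := ht
  obtain ⟨w, h1, -⟩ := h.append_inv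
  obtain rfl := path_target hv h1.path
  exact h1.right

theorem chain (h : G.Along K x s y) (c : Conf G) : c.Chain K x y := by
  induction s generalizing x with
  | nil => obtain ⟨rfl, -⟩ := h; exact .refl
  | cons e s ih =>
    obtain ⟨rfl, h1, h2⟩ := h
    exact .head ⟨h1, h2.left, _, Conf.step_edge e⟩ (ih h2)

end Along

theorem Conf.Chain.exists_along {G : AsyncGame} {c : Conf G} {K : G.V → Prop} {x y : G.V}
    (h : c.Chain K x y) (hx : K x) : ∃ s, G.Along K x s y := by
  induction h with
  | refl => exact ⟨[], rfl, hx⟩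
  | tail _ h ih =>
    obtain ⟨s, hs⟩ := ih
    obtain ⟨h1, h2, a, h3⟩ := h
    obtain ⟨e, rfl, rfl, -⟩ := h3.exists_edge
    exact ⟨s ++ [e], hs.append (.single h1 h2)⟩

namespace Conf

/-- The vertex that is missing when one side of a cube is known is the meet of `y₂` and `z₂`;
closure under meets will put it in the strategy. -/
theorem hexagon_inter {G : AsyncGame} {c : Conf G} {x y₁ y₂ y₃ z₁ z₂ : G.V} {a b d : c.Ev}
    (h₁ : c.Step x a y₁) (h₂ : c.Step y₁ b y₂) (h₃ : c.Step y₂ d y₃) (h₄ : c.Step x d z₁)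
    (h₅ : c.Step z₁ b z₂) :
    ∃ u, c.Step x b u ∧ c.Step u a y₂ ∧ c.Step u d z₂ ∧ c.evs u = c.evs y₂ ∩ c.evs z₂ := by
  obtain ⟨u, hu⟩ := c.inter y₂ z₂
  have n1 := h₁.1
  have n2 := h₂.1
  have n3 := h₃.1
  have hu' : c.evs u = insert b (c.evs x) := by
    rw [hu, h₂.2, h₅.2, h₁.2, h₄.2]
    rw [h₂.2, h₁.2] at n3
    rw [h₁.2] at n2
    ext e
    simp only [Set.mem_inter_iff, Set.mem_insert_iff] at *
    grind
  refine ⟨u, ⟨fun h => n2 (h₁.subset h), hu'⟩, ⟨?_, ?_⟩, ⟨?_, ?_⟩, hu⟩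
  · rw [hu', Set.mem_insert_iff]
    rintro (rfl | h)
    · exact n2 h₁.mem
    · exact n1 h
  · rw [h₂.2, h₁.2, hu']; exact Set.insert_comm _ _ _
  · rw [hu', Set.mem_insert_iff]
    rintro (rfl | h)
    · exact n3 h₂.mem
    · exact h₄.1 h
  · rw [h₅.2, h₄.2, hu']; exact Set.insert_comm _ _ _

/-- On the opposite side of the cube the missing vertex is the union of `y₁` and `z₁`, bounded by
`y₃`; closure under residuals will put it in the strategy. -/
theorem hexagon_union {G : AsyncGame} {c : Conf G} {x y₁ y₂ y₃ z₁ : G.V} {a b d : c.Ev}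
    (h₁ : c.Step x a y₁) (h₂ : c.Step y₁ b y₂) (h₃ : c.Step y₂ d y₃) (h₄ : c.Step x d z₁) :
    ∃ w, c.Step y₁ d w ∧ c.Step z₁ a w ∧ c.Step w b y₃ := by
  have had : a ≠ d := fun h => h₃.1 (h ▸ h₂.subset h₁.mem)
  obtain ⟨w, hw1, hw2, -⟩ := h₁.diamond h₄ had (w := y₃) (h₂.subset.trans h₃.subset)
    (h₄.subset_of ((h₁.subset.trans h₂.subset).trans h₃.subset) h₃.mem)
  exact ⟨w, hw1, hw2, h₂.swap hw1 h₃⟩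

/-- The properties of the set of positions of an ingenuous strategy. -/
structure Fam {G : AsyncGame} (c : Conf G) (K : G.V → Prop) : Prop where
  init : K G.init
  chain : ∀ v, K v → c.Chain K G.init v
  det : ∀ {v a b v₁ v₂}, K v → c.Step v a v₁ → c.Step v b v₂ → K v₁ → K v₂ → a ≠ b →
    c.polEv a = .P → ∃ u, c.Step v₁ b u ∧ K u
  recep : ∀ {v a w}, K v → c.Step v a w → c.polEv a = .O → K w
  total : ∀ {v}, K v → (∀ a w, c.Step v a w → c.polEv a ≠ .O) →
    (∀ a w, ¬ c.Step v a w) ∨ ∃ a w, c.Step v a w ∧ c.polEv a = .P ∧ K w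
  court : ∀ {v a b v₁ v₂ w}, K v → c.Step v a v₁ → c.Step v b v₂ → c.Step v₁ b w → K v₁ → K w →
    c.polEv a = .P → K v₂
  res : c.ResClosed K
  inter : c.InterClosed K

end Conf

namespace Strategy

variable {G : AsyncGame} {σ : Strategy G}

/-- The plays of `σ` are the plays that stay inside the set of positions `K`. -/
def PlaysIn (σ : Strategy G) (K : G.V → Prop) : Prop :=
  ∀ s, s ∈ σ.plays ↔ ∃ x, G.Along K G.init s x

theorem Trans.pos {e : G.E} (h : σ.Trans e) : σ.Pos (G.src e) ∧ σ.Pos (G.tgt e) := by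
  obtain ⟨s, hs⟩ := h
  obtain ⟨x, hx⟩ := σ.isPlay _ hs
  obtain ⟨y, h1, h2, h3⟩ := isPathOn_append_inv hx
  cases h2
  exact ⟨⟨s, σ.prefix_mem _ _ hs, h1⟩, ⟨_, hs, isPathOn_append h1 (Path.single e)⟩⟩

theorem trans_of_mem {s : List G.E} (hs : s ∈ σ.plays) {e : G.E} (he : e ∈ s) : σ.Trans e := by
  obtain ⟨s₁, s₂, rfl⟩ := List.append_of_mem he
  exact ⟨s₁, σ.prefix_mem _ s₂ (by simpa using hs)⟩

/-- Each transition of the path ends some play of `σ`. That play, without its last move, is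
homotopic to the prefix of the path with the same target, so positionality transfers the move. -/
theorem mem_plays_of_trans (c : Conf G) (hσ : σ.Positional) {s : List G.E} {x : G.V}
    (h : G.Path G.init s x) (hs : ∀ e ∈ s, σ.Trans e) : s ∈ σ.plays := by
  induction s using List.reverseRecOn generalizing x with
  | nil => exact σ.nil_mem
  | append_singleton s e ih =>
    obtain ⟨y, h1, h2, h3⟩ := isPathOn_append_inv h
    subst h2
    have hs' := ih h1 fun e he => hs e (by simp [he])
    obtain ⟨t, ht⟩ := hs e (by simp)
    obtain ⟨z, hz⟩ := σ.isPlay _ ht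
    obtain ⟨y', h4, h5, h6⟩ := isPathOn_append_inv hz
    subst h5
    exact hσ t s [e] _ _ h4 h1 (Path.single e) ht (c.homotopic_of_path h4 h1) hs'

/-- Moving the transitions of a play to the source of `e` to the front of a play to its target
leaves a path of `σ` from the source to the target, which can only start with `e`. -/
theorem trans_of_pos (c : Conf G) (hr : σ.ResidualClosed) {e : G.E}
    (h : σ.Pos (G.src e)) (h' : σ.Pos (G.tgt e)) : σ.Trans e := by
  obtain ⟨s, hs, hs'⟩ := h
  obtain ⟨t, ht, ht'⟩ := h'
  have key : ∀ {x z : G.V} (s t : List G.E), G.Path x s (G.src e) → G.Path x t (G.tgt e) →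
      (∀ e ∈ s, σ.Trans e) → (∀ e ∈ t, σ.Trans e) →
      ∃ t', G.Path (G.src e) t' (G.tgt e) ∧ ∀ e ∈ t', σ.Trans e := by
    intro x z s
    induction s generalizing x with
    | nil =>
      intro t h1 h2 _ h4
      cases h1
      exact ⟨t, h2, h4⟩
    | cons m s ih =>
      intro t h1 h2 h3 h4
      obtain ⟨rfl, h1⟩ := h1
      obtain ⟨t', h5, h6, -⟩ := c.homotopic_front (fun ht hm hn => hr _ _ _ _ ht hm hn) h2 h4 rfl
        (h3 m (by simp)) ((c.evs_mono_path h1).trans (c.src_subset_tgt e))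
      exact ih t' h1 h5 (fun e he => h3 e (by simp [he])) h6
  obtain ⟨t', h1, h2⟩ := key (z := G.init) s t hs' ht' (fun _ => trans_of_mem hs)
    (fun _ => trans_of_mem ht)
  cases t' with
  | nil => exact absurd (h1 ▸ c.ev_mem_tgt e : c.ev e ∈ c.evs (G.src e)) (c.ev_notMem e)
  | cons m t' =>
    obtain ⟨h3, h4⟩ := h1
    have : c.ev m = c.ev e := by
      have := c.evs_mono_path h4 (c.ev_mem_tgt m)
      rw [c.evs_tgt, ← h3] at this
      exact this.resolve_right (c.ev_notMem m)
    obtain rfl := c.edge_ext h3 this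
    exact h2 m (by simp)

/-- By `trans_of_pos`, conditions on transitions become conditions on positions. The cube property
has no counterpart in `Fam` because it follows from the other ones. -/
theorem IsIngenuous.fam (c : Conf G) (h : σ.IsIngenuous) :
    σ.PlaysIn σ.Pos ∧ c.Fam σ.Pos := by
  have hplays : σ.PlaysIn σ.Pos := by
    intro s
    constructor
    · intro hs
      obtain ⟨x, hx⟩ := σ.isPlay s hs
      refine ⟨x, .of_path hx fun t ht v hv => ⟨t, ?_, hv⟩⟩
      obtain ⟨u, rfl⟩ := ht
      exact σ.prefix_mem _ _ hs
    · rintro ⟨x, hx⟩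
      refine mem_plays_of_trans c h.positional hx.path fun e he => ?_
      obtain ⟨s₁, s₂, rfl⟩ := List.append_of_mem he
      obtain ⟨y, -, h1, h2, h3⟩ := hx.append_inv
      subst h1
      exact trans_of_pos c h.residualClosed h2 h3.left
  have htr : ∀ {e}, σ.Pos (G.src e) → σ.Pos (G.tgt e) → σ.Trans e :=
    trans_of_pos c h.residualClosed
  refine ⟨hplays, ⟨⟨[], σ.nil_mem, rfl⟩, ?_, ?_, ?_, ?_, ?_, ?_, ?_⟩⟩
  · rintro v ⟨s, hs, hv⟩
    obtain ⟨x, hx⟩ := (hplays s).1 hs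
    obtain rfl := path_target hv hx.path
    exact hx.chain c
  · intro v a b v₁ v₂ hv ha hb h₁ h₂ hab hP
    obtain ⟨m, rfl, rfl, rfl⟩ := ha.exists_edge
    obtain ⟨n, hn, rfl, rfl⟩ := hb.exists_edge
    rw [← c.pol_ev] at hP
    obtain ⟨p, q, ht, hq⟩ := h.deterministic m n hn.symm (fun h => hab (by rw [h])) hP (htr hv h₁)
      (htr (hn ▸ hv) h₂)
    refine ⟨_, (Conf.tile_step ht).1, ?_⟩
    rw [(G.tile_bound ht).2.2.2]
    exact hq.pos.2
  · rintro v a w ⟨s, hs, hv⟩ ha hO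
    obtain ⟨m, rfl, rfl, rfl⟩ := ha.exists_edge
    rw [← c.pol_ev] at hO
    exact ⟨_, h.receptive s _ m hs hv rfl hO, hv.append (.single m)⟩
  · rintro v ⟨s, hs, hv⟩ hno
    rcases h.total s v hs hv fun m hm hO => by
        subst hm
        exact hno _ _ (Conf.step_edge m) ((c.pol_ev m).symm.trans hO) with h1 | ⟨m, hm, hP, hm'⟩
    · refine .inl fun a w ha => ?_
      obtain ⟨m, hm, -, -⟩ := ha.exists_edge
      exact h1 m hm
    · subst hm
      exact .inr ⟨_, _, Conf.step_edge m, (c.pol_ev m).symm.trans hP, _, hm', hv.append (.single m)⟩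
  · intro v a b v₁ v₂ w hv ha hb hw h₁ hKw hP
    obtain ⟨m, rfl, rfl, rfl⟩ := ha.exists_edge
    obtain ⟨n, hn, rfl, rfl⟩ := hb.exists_edge
    obtain ⟨p, hp, rfl, hp'⟩ := hw.exists_edge
    obtain ⟨q, hq, hq'', hq'⟩ := (ha.swap hb hw).exists_edge
    rw [← c.pol_ev] at hP
    have hmn : m ≠ n := fun h => hw.1 (h ▸ ha.mem)
    have ht := c.tile_mk hn.symm hmn hp hq hp' hq'
    exact (h.courteous m p n q ht (htr hv h₁) (htr (hp ▸ h₁) hKw) (.inl hP)).1.pos.2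
  · intro v a b v₁ v₂ w hv ha hb h₁ h₂ hw
    obtain ⟨m, rfl, rfl, rfl⟩ := ha.exists_edge
    obtain ⟨n, hn, rfl, rfl⟩ := hb.exists_edge
    obtain ⟨p, hp, rfl, hp'⟩ := hw.exists_edge
    obtain ⟨q, hq, hq'', hq'⟩ := (ha.swap hb hw).exists_edge
    have hmn : m ≠ n := fun h => hw.1 (h ▸ ha.mem)
    have ht := c.tile_mk hn.symm hmn hp hq hp' hq'
    exact (h.residualClosed m p n q ht (htr hv h₁) (htr (hn ▸ hv) h₂)).1.pos.2
  · intro u v w hv hw hu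
    refine h.stable v w u hv hw ?_ ?_ ?_
    · exact c.reach_of_subset (hu.le.trans Set.inter_subset_left)
    · exact c.reach_of_subset (hu.le.trans Set.inter_subset_right)
    · intro z h1 h2
      refine c.reach_of_subset ?_
      rw [hu]
      exact Set.subset_inter (c.reach_iff.1 h1) (c.reach_iff.1 h2)

theorem PlaysIn.pos_iff {c : Conf G} {K : G.V → Prop} (h : σ.PlaysIn K) (hK : c.Fam K) (v : G.V) :
    σ.Pos v ↔ K v := by
  constructor
  · rintro ⟨s, hs, hv⟩
    obtain ⟨x, hx⟩ := (h s).1 hs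
    obtain rfl := path_target hv hx.path
    exact hx.right
  · intro hv
    obtain ⟨s, hs⟩ := (hK.chain v hv).exists_along hK.init
    exact ⟨s, (h s).2 ⟨_, hs⟩, hs.path⟩

theorem PlaysIn.trans_iff {c : Conf G} {K : G.V → Prop} (h : σ.PlaysIn K) (hK : c.Fam K)
    (e : G.E) : σ.Trans e ↔ K (G.src e) ∧ K (G.tgt e) := by
  rw [← h.pos_iff hK, ← h.pos_iff hK]
  refine ⟨Trans.pos, fun ⟨h1, h2⟩ => ?_⟩
  rw [h.pos_iff hK] at h1 h2
  obtain ⟨s, hs⟩ := (hK.chain _ h1).exists_along hK.init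
  exact ⟨s, (h _).2 ⟨_, hs.append (.single h1 h2)⟩⟩

/-- Closure under meets provides the missing vertex in one direction, closure under residuals in the
other. -/
theorem PlaysIn.cube {c : Conf G} {K : G.V → Prop} (h : σ.PlaysIn K) (hK : c.Fam K) :
    σ.Cube := by
  have htr := h.trans_iff hK
  have hmk : ∀ {m p n q}, G.src m = G.src n → G.src p = G.tgt m → G.src q = G.tgt n →
      c.ev p = c.ev n → c.ev q = c.ev m → σ.Trans m → σ.Trans p → σ.Trans n → σ.Trans q →
      σ.Tile m p n q := by
    intro m p n q h1 h2 h3 h4 h5 k1 k2 k3 k4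
    refine ⟨c.tile_mk h1 (fun h => ?_) h2 h3 h4 h5, k1, k2, k3, k4⟩
    subst h
    exact c.ev_notMem p (h2 ▸ h4 ▸ c.ev_mem_tgt m)
  intro m₁ m₂ m₃ p₁ p₂ p₃
  constructor
  · rintro ⟨a, b, d, ⟨t1, k1⟩, ⟨t2, k2⟩, t3, k3⟩
    obtain ⟨b11, b12, b13, b14⟩ := G.tile_bound t1
    obtain ⟨b21, b22, b23, b24⟩ := G.tile_bound t2
    obtain ⟨b31, b32, b33, b34⟩ := G.tile_bound t3
    obtain ⟨e11, e12⟩ := c.tile_ev t1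
    obtain ⟨e21, e22⟩ := c.tile_ev t2
    obtain ⟨e31, e32⟩ := c.tile_ev t3
    have hm₂ : G.src m₂ = G.tgt m₁ := b11.trans b22.symm
    have hp₂ : G.src p₂ = G.tgt p₁ := (b23.trans b31).symm
    have hp₁ : c.ev p₁ = c.ev m₃ := e22.trans e12
    have hep₂ : c.ev p₂ = c.ev m₂ := e32.trans e11.symm
    have hp₃ : c.ev p₃ = c.ev m₁ := e31.symm.trans e21.symm
    obtain ⟨u, hu1, hu2, hu3, hu4⟩ := Conf.hexagon_inter (Conf.step_edge m₁)
      (hm₂ ▸ Conf.step_edge m₂) (b12 ▸ Conf.step_edge m₃)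
      (b21 ▸ hp₁ ▸ Conf.step_edge p₁) (hp₂ ▸ hep₂ ▸ Conf.step_edge p₂)
    have hK₂ : ∀ {e}, σ.Trans e → K (G.tgt e) := fun h => ((htr _).1 h).2
    have hKu := hK.inter _ _ _ (hK₂ k1.1) (hK₂ k3.2.2.1) hu4
    obtain ⟨d', f1, f2, f3⟩ := hu1.exists_edge
    obtain ⟨e', f4, f5, f6⟩ := hu2.exists_edge
    obtain ⟨f', f7, f8, f9⟩ := hu3.exists_edge
    have hd' : σ.Trans d' := (htr _).2 ⟨f1 ▸ ((htr _).1 k2.1).1, f2 ▸ hKu⟩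
    have he' : σ.Trans e' := (htr _).2 ⟨f4 ▸ hKu, f5 ▸ hK₂ k1.1⟩
    have hf' : σ.Trans f' := (htr _).2 ⟨f7 ▸ hKu, f8 ▸ hK₂ k3.2.2.1⟩
    exact ⟨d', e', f',
      hmk f1.symm hm₂ (f4.trans f2.symm) f3.symm f6 k2.1 k1.1 hd' he',
      hmk (f4.trans f7.symm) (b12.symm.trans f5.symm) (b33.symm.trans f8.symm) f9.symm
        (hp₃.trans f6.symm) he' k1.2.1 hf' k3.2.2.2,
      hmk (f1.trans b21) (f7.trans f2.symm) hp₂ (f9.trans hp₁.symm) (hep₂.trans f3.symm) hd' hf'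
        k2.2.2.1 k3.2.2.1⟩
  · rintro ⟨d, e, f, ⟨t1, k1⟩, ⟨t2, k2⟩, t3, k3⟩
    obtain ⟨b11, b12, b13, b14⟩ := G.tile_bound t1
    obtain ⟨b21, b22, b23, b24⟩ := G.tile_bound t2
    obtain ⟨b31, b32, b33, b34⟩ := G.tile_bound t3
    obtain ⟨e11, e12⟩ := c.tile_ev t1
    obtain ⟨e21, e22⟩ := c.tile_ev t2
    obtain ⟨e31, e32⟩ := c.tile_ev t3
    have hm₃ : G.src m₃ = G.tgt m₂ := b22.symm.trans b14.symm
    have hp₁ : c.ev p₁ = c.ev m₃ := e32.trans e22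
    have hp₁' : G.src p₁ = G.src m₁ := b31.symm.trans b11.symm
    have hp₃ : c.ev p₃ = c.ev m₁ := e21.symm.trans e11.symm
    have hp₃' : G.src p₃ = G.tgt p₂ := b23.symm.trans b34
    have hep₂ : c.ev p₂ = c.ev m₂ := e31.symm.trans e12
    obtain ⟨w, hw1, hw2, hw3⟩ := Conf.hexagon_union (Conf.step_edge m₁)
      (b12 ▸ Conf.step_edge m₂) (hm₃ ▸ Conf.step_edge m₃) (hp₁' ▸ hp₁ ▸ Conf.step_edge p₁)
    have hK₂ : ∀ {e}, σ.Trans e → K (G.tgt e) := fun h => ((htr _).1 h).2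
    have hKw : K w := hK.res _ _ _ _ _ _ ((htr _).1 k1.1).1 (Conf.step_edge m₁)
      (hp₁' ▸ hp₁ ▸ Conf.step_edge p₁) (hK₂ k1.1) (hK₂ k3.2.2.1) hw1
    obtain ⟨a', f1, f2, f3⟩ := hw1.exists_edge
    obtain ⟨c', f4, f5, f6⟩ := hw2.exists_edge
    obtain ⟨b', f7, f8, f9⟩ := hw3.exists_edge
    have ha' : σ.Trans a' := (htr _).2 ⟨f1 ▸ hK₂ k1.1, f2 ▸ hKw⟩
    have hc' : σ.Trans c' := (htr _).2 ⟨f4 ▸ hK₂ k3.2.2.1, f5 ▸ hKw⟩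
    have hb' : σ.Trans b' := (htr _).2 ⟨f7 ▸ hKw, f8 ▸ hK₂ k2.2.1⟩
    exact ⟨a', b', c',
      hmk (b12.symm.trans f1.symm) hm₃ (f7.trans f2.symm) f3.symm f9 k1.2.1 k2.2.1 ha' hb',
      hmk hp₁'.symm f1 f4 (f3.trans hp₁.symm) f6 k1.1 ha' k3.2.2.1 hc',
      hmk (f4.trans b33) (f7.trans f5.symm) hp₃' (f9.trans hep₂.symm) (hp₃.trans f6.symm) hc' hb'
        k3.2.2.2 k2.2.2.2⟩

theorem PlaysIn.isIngenuous {c : Conf G} {K : G.V → Prop} (h : σ.PlaysIn K) (hK : c.Fam K) :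
    σ.IsIngenuous := by
  have htr := h.trans_iff hK
  have hpos := h.pos_iff hK
  have hsrc : ∀ {s x}, s ∈ σ.plays → G.Path G.init s x → K x := fun hs hx =>
    (hpos _).1 ⟨_, hs, hx⟩
  have hext : ∀ {s m}, s ∈ σ.plays → G.Path G.init s (G.src m) → K (G.tgt m) →
      s ++ [m] ∈ σ.plays := by
    intro s m hs hx hm
    obtain ⟨y, hy⟩ := (h s).1 hs
    obtain rfl := path_target hx hy.path
    exact (h _).2 ⟨_, hy.append (.single hy.right hm)⟩
  have htile : ∀ {m p n q}, G.tile m p n q → c.Step (G.src m) (c.ev m) (G.tgt m) ∧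
      c.Step (G.src m) (c.ev n) (G.tgt n) ∧ c.Step (G.tgt m) (c.ev n) (G.tgt p) := fun ht => by
    obtain ⟨h1, -⟩ := G.tile_bound ht
    refine ⟨Conf.step_edge _, ?_, (Conf.tile_step ht).1⟩
    rw [h1]; exact Conf.step_edge _
  have hres : ∀ {m p n q}, G.tile m p n q → K (G.src m) → K (G.tgt m) → K (G.tgt n) →
      K (G.tgt p) := fun ht h1 h2 h3 => by
    obtain ⟨s1, s2, s3⟩ := htile ht
    exact hK.res _ _ _ _ _ _ h1 s1 s2 h2 h3 s3
  refine ⟨?_, ?_, ?_, ?_, ?_, ?_, ?_, ?_⟩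
  -- Whether `u` extends a play only depends on the positions that `u` meets.
  · intro s t u x y hs ht hu hsu hst htt
    obtain ⟨z, hz⟩ := (h _).1 hsu
    obtain ⟨w, hw1, hw2⟩ := hz.append_inv
    obtain rfl := path_target hs hw1.path
    obtain ⟨w, hw3⟩ := (h _).1 htt
    obtain rfl := path_target ht hw3.path
    exact (h _).2 ⟨_, hw3.append hw2⟩
  · intro m n hmn hne hP hm hn
    rw [htr] at hm hn
    have hs := Conf.step_edge (c := c) n
    rw [← hmn] at hs
    obtain ⟨u, hu, hKu⟩ := hK.det hm.1 (Conf.step_edge m) hs hm.2 hn.2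
      (fun h => hne (c.edge_ext hmn h)) ((c.pol_ev m).symm.trans hP)
    obtain ⟨p, hp, hp2, hp'⟩ := hu.exists_edge
    obtain ⟨q, hq, hq2, hq'⟩ := ((Conf.step_edge m).swap hs hu).exists_edge
    refine ⟨p, q, c.tile_mk hmn hne hp hq hp' hq', (htr q).2 ⟨hq ▸ hn.2, hq2 ▸ hKu⟩⟩
  · intro s x m hs hx hm hO
    subst hm
    exact hext hs hx (hK.recep (hsrc hs hx) (Conf.step_edge m) ((c.pol_ev m).symm.trans hO))
  · intro s x hs hx hno
    rcases hK.total (hsrc hs hx) (fun a w ha hO => by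
      obtain ⟨m, rfl, rfl, rfl⟩ := ha.exists_edge
      exact hno m rfl ((c.pol_ev m).trans hO)) with h1 | ⟨a, w, ha, hP, hw⟩
    · exact .inl fun m hm => h1 _ _ (hm ▸ Conf.step_edge m)
    · obtain ⟨m, rfl, rfl, rfl⟩ := ha.exists_edge
      exact .inr ⟨m, rfl, (c.pol_ev m).trans hP, hext hs hx hw⟩
  · intro m p n q ht hm hp hpol
    obtain ⟨b1, b2, b3, b4⟩ := G.tile_bound ht
    obtain ⟨s1, s2, s3⟩ := htile ht
    rw [htr] at hm hp
    have hn : K (G.tgt n) := by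
      rcases hpol with hP | hO
      · exact hK.court hm.1 s1 s2 s3 hm.2 hp.2 ((c.pol_ev m).symm.trans hP)
      -- If `p` is Opponent then so is `n`, of which it is the residual: this half of courtesy is an
      -- instance of receptivity.
      · refine hK.recep hm.1 s2 ?_
        rw [← c.pol_ev, (G.tile_pol ht).2, hO]
    exact ⟨(htr n).2 ⟨b1 ▸ hm.1, hn⟩, (htr q).2 ⟨b3 ▸ hn, b4 ▸ hp.2⟩⟩
  · intro m p n q ht hm hn
    obtain ⟨b1, b2, b3, b4⟩ := G.tile_bound ht
    rw [htr] at hm hn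
    have := hres ht hm.1 hm.2 hn.2
    exact ⟨(htr p).2 ⟨b2 ▸ hm.2, this⟩, (htr q).2 ⟨b3 ▸ hn.2, b4 ▸ this⟩⟩
  · exact h.cube hK
  · intro x y z hx hy h1 h2 h3
    rw [hpos] at hx hy ⊢
    refine hK.inter z x y hx hy ?_
    obtain ⟨u, hu⟩ := c.inter x y
    have hu1 : c.evs u ⊆ c.evs x := hu.le.trans Set.inter_subset_left
    have hu2 : c.evs u ⊆ c.evs y := hu.le.trans Set.inter_subset_right
    refine Set.Subset.antisymm (Set.subset_inter (c.reach_iff.1 h1) (c.reach_iff.1 h2)) ?_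
    rw [← hu]
    exact c.reach_iff.1 (h3 u (c.reach_of_subset hu1) (c.reach_of_subset hu2))

end Strategy
end AsyncGame
end AsyncConc

namespace AsyncConc

/-! ### Joint well-foundedness of scheduled relations -/

theorem WellFounded.or_of_subsingleton {I : Type} [Subsingleton I] {R R' : I → I → Prop}
    (h : WellFounded R) (h' : WellFounded R') : WellFounded fun i j => R i j ∨ R' i j := by
  refine ⟨fun a => ⟨a, fun b hb => ?_⟩⟩
  obtain rfl := Subsingleton.elim a b
  rcases hb with hb | hb
  · exact absurd hb (h.irrefl.irrefl a)
  · exact absurd hb (h'.irrefl.irrefl a)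

/-- A descent along `R` outside `p` is summarised by the transitive closure of `R` between its ends,
so only what happens inside `p` matters. -/
theorem WellFounded.or_subtype {I : Type} {p : I → Prop} {R : I → I → Prop}
    {R' : {i // p i} → {i // p i} → Prop} (hR : WellFounded R)
    (h : WellFounded fun i j : {i // p i} => Relation.TransGen R i.1 j.1 ∨ R' i j) :
    WellFounded fun i j => R i j ∨ ∃ hi hj, R' ⟨i, hi⟩ ⟨j, hj⟩ := by
  rw [WellFounded.wellFounded_iff_has_min]
  intro C hC
  by_contra hno
  push Not at hno
  -- An `R`-minimal element of `C` has a predecessor for the other relation, hence satisfies `p`.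
  have hne : {j : {i // p i} | j.1 ∈ C}.Nonempty := by
    obtain ⟨m, hm, hmin⟩ := hR.has_min C hC
    obtain ⟨k, hk, hk'⟩ := hno m hm
    obtain ⟨-, hj, -⟩ := hk'.resolve_left (hmin k hk)
    exact ⟨⟨m, hj⟩, hm⟩
  obtain ⟨⟨j, hj⟩, hjC, hmin⟩ := h.has_min _ hne
  obtain ⟨k, hk, hk'⟩ := hno j hjC
  rcases hk' with hk' | ⟨hkp, _, hk'⟩
  -- An `R`-minimal element among those below `j` again satisfies `p`, against the minimality of
  -- `j`.
  · obtain ⟨l, ⟨hl, hlj⟩, hlmin⟩ := hR.has_min {k | k ∈ C ∧ Relation.TransGen R k j}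
      ⟨k, hk, .single hk'⟩
    obtain ⟨n, hn, hn'⟩ := hno l hl
    rcases hn' with hn' | ⟨-, hlp, -⟩
    · exact hlmin n ⟨hn, .head hn' hlj⟩ hn'
    · exact hmin ⟨l, hlp⟩ hl (.inl hlj)
  · exact hmin ⟨k, hkp⟩ hk (.inr hk')

/-- Two relations on transitions that are pairwise separated by a connective have a well-founded
union as soon as each of them is compatible with all the switchings of one kind. -/
def JointlyWF {E S : Type} (Bf : Bool → S → E → E → Prop) : Prop :=
  ∀ (I : Type) (f : I → E) (d : Bool) (R R' : I → I → Prop),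
    (∀ i j, i ≠ j → ∃ d s, Bf d s (f i) (f j)) →
    (∀ s, WellFounded fun i j => R i j ∨ Bf d s (f i) (f j)) →
    (∀ s, WellFounded fun i j => R' i j ∨ Bf (!d) s (f i) (f j)) →
    WellFounded fun i j => R i j ∨ R' i j

namespace JointlyWF

variable {E S : Type} {Bf : Bool → S → E → E → Prop}

/-- The relation `R` may also involve indices that are not transitions of the game. -/
theorem context [Nonempty S] (h : JointlyWF Bf) {I : Type} {p : I → Prop} {f : {i // p i} → E}
    {d : Bool} {R : I → I → Prop} {R' : {i // p i} → {i // p i} → Prop}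
    (hsep : ∀ i j, i ≠ j → ∃ d s, Bf d s (f i) (f j))
    (hR : ∀ s, WellFounded fun i j => R i j ∨ ∃ hi hj, Bf d s (f ⟨i, hi⟩) (f ⟨j, hj⟩))
    (hR' : ∀ s, WellFounded fun i j => R' i j ∨ Bf (!d) s (f i) (f j)) :
    WellFounded fun i j => R i j ∨ ∃ hi hj, R' ⟨i, hi⟩ ⟨j, hj⟩ := by
  have hR₀ : WellFounded R :=
    Subrelation.wf (fun h => Or.inl h) (hR (Classical.arbitrary S))
  refine WellFounded.or_subtype hR₀ (h _ f d _ R' hsep (fun s => ?_) hR')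
  refine Subrelation.wf ?_ (InvImage.wf Subtype.val (hR s).transGen)
  rintro i j (hij | hij)
  · exact Relation.TransGen.mono (fun _ _ h => Or.inl h) _ _ hij
  · exact .single (.inr ⟨i.2, j.2, hij⟩)

/-- Without connectives to separate them, there is at most one transition. -/
theorem of_false (hBf : ∀ d s e e', ¬ Bf d s e e') [Nonempty S] : JointlyWF Bf := by
  intro I f d R R' hsep hR hR'
  have : Subsingleton I := ⟨fun i j => by
    by_contra hij
    obtain ⟨d, s, h⟩ := hsep i j hij
    exact hBf _ _ _ _ h⟩
  exact WellFounded.or_of_subsingleton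
    (Subrelation.wf (fun h => Or.inl h) (hR (Classical.arbitrary S)))
    (Subrelation.wf (fun h => Or.inl h) (hR' (Classical.arbitrary S)))

theorem comap {S' : Type} (h : JointlyWF Bf) (g : S' → S) (hg : Function.Surjective g) :
    JointlyWF fun d s => Bf d (g s) := by
  intro I f d R R' hsep hR hR'
  refine h I f d R R' (fun i j hij => ?_) (hg.forall.2 hR) (hg.forall.2 hR')
  obtain ⟨d, s, h⟩ := hsep i j hij
  exact ⟨d, g s, h⟩

/-- The relations of the two components of a product, one of them coming before the other one
according to a boolean. -/
def prodBf {G H : AsyncGame} {S₁ S₂ : Type} (d₀ : Bool) (B₁ : Bool → S₁ → G.E → G.E → Prop)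
    (B₂ : Bool → S₂ → H.E → H.E → Prop) (d : Bool) (s : Bool × S₁ × S₂) :
    (G.prod H).E → (G.prod H).E → Prop :=
  prodRel (B₁ d s.2.1) (B₂ d s.2.2) (d = d₀ ∧ s.1 = true) (d = d₀ ∧ s.1 = false)

/-- One of the two relations is compatible with both orders of the components, hence never crosses
between them. It splits into one relation on each component, and these halves are added to the other
relation one after the other, by the hypotheses on the components. -/
theorem prod {G H : AsyncGame} {S₁ S₂ : Type} [Nonempty S₁] [Nonempty S₂] {d₀ : Bool}
    {B₁ : Bool → S₁ → G.E → G.E → Prop} {B₂ : Bool → S₂ → H.E → H.E → Prop}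
    (h₁ : JointlyWF B₁) (h₂ : JointlyWF B₂) : JointlyWF (prodBf d₀ B₁ B₂) := by
  -- The conclusion is symmetric in `R` and `R'`, so `R` may be taken to be the relation whose
  -- switchings order the two components.
  have key : ∀ (I : Type) (f : I → (G.prod H).E) (R R' : I → I → Prop),
      (∀ i j, i ≠ j → ∃ d s, prodBf d₀ B₁ B₂ d s (f i) (f j)) →
      (∀ s, WellFounded fun i j => R i j ∨ prodBf d₀ B₁ B₂ d₀ s (f i) (f j)) →
      (∀ s, WellFounded fun i j => R' i j ∨ prodBf d₀ B₁ B₂ (!d₀) s (f i) (f j)) →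
      WellFounded fun i j => R i j ∨ R' i j := by
    intro I f R R' hsep hR hR'
    let p : I → Prop := fun i => ∃ m, f i = .inl m
    have hq : ∀ i, ¬ p i → ∃ n, f i = .inr n := by
      intro i hi
      rcases hfi : f i with m | n
      · exact absurd ⟨m, hfi⟩ hi
      · exact ⟨n, rfl⟩
    choose f₁ hf₁ using fun i : {i // p i} => i.2
    choose f₂ hf₂ using fun i : {i // ¬ p i} => hq i.1 i.2
    obtain ⟨s₁⟩ := ‹Nonempty S₁›
    obtain ⟨s₂⟩ := ‹Nonempty S₂›
    have hcross : ∀ i j, R i j → (p i ↔ p j) := by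
      intro i j hij
      by_cases hi : p i <;> by_cases hj : p j
      · exact iff_of_true hi hj
      -- The switching that goes against `R i j` would create a cycle of length two.
      · have : prodBf d₀ B₁ B₂ d₀ (false, s₁, s₂) (f j) (f i) := by
          rw [hf₁ ⟨i, hi⟩, hf₂ ⟨j, hj⟩]; exact ⟨rfl, rfl⟩
        exact absurd (Or.inr this) ((hR (false, s₁, s₂)).asymmetric _ _ (.inl hij))
      · have : prodBf d₀ B₁ B₂ d₀ (true, s₁, s₂) (f j) (f i) := by
          rw [hf₁ ⟨j, hj⟩, hf₂ ⟨i, hi⟩]; exact ⟨rfl, rfl⟩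
        exact absurd (Or.inr this) ((hR (true, s₁, s₂)).asymmetric _ _ (.inl hij))
      · exact iff_of_false hi hj
    have hsep₁ : ∀ i j : {i // p i}, i ≠ j → ∃ d s, B₁ d s (f₁ i).1 (f₁ j).1 := by
      intro i j hij
      obtain ⟨d, s, h⟩ := hsep i.1 j.1 fun h => hij (Subtype.ext h)
      rw [hf₁ i, hf₁ j] at h
      exact ⟨d, _, h⟩
    have hsep₂ : ∀ i j : {i // ¬ p i}, i ≠ j → ∃ d s, B₂ d s (f₂ i).2 (f₂ j).2 := by
      intro i j hij
      obtain ⟨d, s, h⟩ := hsep i.1 j.1 fun h => hij (Subtype.ext h)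
      rw [hf₂ i, hf₂ j] at h
      exact ⟨d, _, h⟩
    -- The left half of `R` is added while `s₂` stays free, as needed for adding the right half. The
    -- boolean `true` below is arbitrary: kind `!d₀` imposes nothing across the components, and the
    -- left half of `R` lives in one component.
    have hA : ∀ s₂, WellFounded fun i j => (R' i j ∨ ∃ hi hj, B₂ (!d₀) s₂ (f₂ ⟨i, hi⟩).2
        (f₂ ⟨j, hj⟩).2) ∨ ∃ (_ : p i) (_ : p j), R i j := by
      intro s₂
      refine h₁.context (p := p) (f := fun i => (f₁ i).1) (d := !d₀)
        (R' := fun i j : {i // p i} => R i.1 j.1) hsep₁ (fun s₁ => ?_) fun s₁ => ?_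
      · refine Subrelation.wf ?_ (hR' (true, s₁, s₂))
        rintro i j ((h | ⟨hi, hj, h⟩) | ⟨hi, hj, h⟩)
        · exact .inl h
        · refine .inr ?_
          rw [hf₂ ⟨i, hi⟩, hf₂ ⟨j, hj⟩]; exact h
        · refine .inr ?_
          rw [hf₁ ⟨i, hi⟩, hf₁ ⟨j, hj⟩]; exact h
      · rw [Bool.not_not]
        refine Subrelation.wf ?_ (InvImage.wf Subtype.val (hR (true, s₁, s₂)))
        rintro i j (h | h)
        · exact .inl h
        · refine .inr ?_
          rw [hf₁ i, hf₁ j]; exact h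
    have hB : WellFounded fun i j => (R' i j ∨ ∃ (_ : p i) (_ : p j), R i j) ∨
        ∃ (_ : ¬ p i) (_ : ¬ p j), R i j := by
      refine h₂.context (p := fun i => ¬ p i) (f := fun i => (f₂ i).2) (d := !d₀)
        (R' := fun i j : {i // ¬ p i} => R i.1 j.1) hsep₂ (fun s₂ => ?_) fun s₂ => ?_
      · refine Subrelation.wf ?_ (hA s₂)
        rintro i j ((h | h) | h)
        · exact .inl (.inl h)
        · exact .inr h
        · exact .inl (.inr h)
      · rw [Bool.not_not]
        refine Subrelation.wf ?_ (InvImage.wf Subtype.val (hR (true, s₁, s₂)))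
        rintro i j (h | h)
        · exact .inl h
        · refine .inr ?_
          rw [hf₂ i, hf₂ j]; exact h
    refine Subrelation.wf ?_ hB
    rintro i j (h | h)
    · by_cases hi : p i
      · exact .inl (.inr ⟨hi, (hcross i j h).1 hi, h⟩)
      · exact .inr ⟨hi, fun hj => hi ((hcross i j h).2 hj), h⟩
    · exact .inl (.inl h)
  intro I f d R R' hsep hR hR'
  cases d <;> cases d₀
  · exact key I f R R' hsep hR hR'
  · exact Subrelation.wf (fun h => Or.symm h) (key I f R' R hsep hR' hR)
  · exact Subrelation.wf (fun h => Or.symm h) (key I f R' R hsep hR' hR)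
  · exact key I f R R' hsep hR hR'

theorem choiceRel_inr {p : Polarity} {ι : Type} {G : ι → AsyncGame}
    {R : ∀ i, (G i).E → (G i).E → Prop} {i : ι} {m n : (G i).E} :
    ChoiceRel (p := p) R (.inr ⟨i, m⟩) (.inr ⟨i, n⟩) ↔ R i m n := by
  constructor
  · intro h
    cases h with
    | mk _ h => exact h
  · exact fun h => .mk i h

/-- Transitions of different summands are never separated by a connective, so as soon as there are
two indices they all live in the same summand. -/
theorem choice {p : Polarity} {ι : Type} {G : ι → AsyncGame} [Nonempty S]
    {B : ∀ i, Bool → S → (G i).E → (G i).E → Prop} (h : ∀ i, JointlyWF (B i)) :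
    JointlyWF fun d s => ChoiceRel (p := p) fun i => B i d s := by
  intro I f d R R' hsep hR hR'
  have hR₁ : WellFounded R := Subrelation.wf (fun h => Or.inl h) (hR (Classical.arbitrary S))
  have hR₂ : WellFounded R' := Subrelation.wf (fun h => Or.inl h) (hR' (Classical.arbitrary S))
  by_cases hsub : Subsingleton I
  · exact WellFounded.or_of_subsingleton hR₁ hR₂
  rw [not_subsingleton_iff_nontrivial] at hsub
  obtain ⟨i₀, j₀, hij₀⟩ := exists_pair_ne I
  obtain ⟨d₁, s₁, hsep₀⟩ := hsep i₀ j₀ hij₀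
  generalize hfi₀ : f i₀ = e₀ at hsep₀
  generalize f j₀ = e₁ at hsep₀
  obtain ⟨k, hm⟩ := hsep₀
  have hg : ∀ j, ∃ n : (G k).E, f j = .inr ⟨k, n⟩ := by
    intro j
    by_cases hj : i₀ = j
    · exact ⟨_, hj ▸ hfi₀⟩
    · obtain ⟨d, s, hs⟩ := hsep i₀ j hj
      rw [hfi₀] at hs
      generalize f j = e at hs
      cases hs with
      | mk _ h => exact ⟨_, rfl⟩
  choose g hg using hg
  refine h k I g d R R' (fun i j hij => ?_) (fun s => ?_) fun s => ?_
  · obtain ⟨d, s, hs⟩ := hsep i j hij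
    rw [hg, hg] at hs
    exact ⟨d, s, choiceRel_inr.1 hs⟩
  · refine Subrelation.wf (fun h => ?_) (hR s)
    rw [hg, hg]
    exact h.imp_right choiceRel_inr.2
  · refine Subrelation.wf (fun h => ?_) (hR' s)
    rw [hg, hg]
    exact h.imp_right choiceRel_inr.2

end JointlyWF

theorem nonempty_switching {X : Type} : ∀ A : Formula X, Nonempty (Switching A)
  | .var _ => ⟨()⟩
  | .dvar _ => ⟨()⟩
  | .par A B => ⟨(true, (nonempty_switching A).some, (nonempty_switching B).some)⟩
  | .tens A B => ⟨(true, (nonempty_switching A).some, (nonempty_switching B).some)⟩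
  | .with_ A B => ⟨((nonempty_switching A).some, (nonempty_switching B).some)⟩
  | .plus A B => ⟨((nonempty_switching A).some, (nonempty_switching B).some)⟩

theorem jointlyWF_choice_bool {p : Polarity} {G H : AsyncGame} {S₁ S₂ : Type}
    [Nonempty S₁] [Nonempty S₂] {B₁ : Bool → S₁ → G.E → G.E → Prop}
    {B₂ : Bool → S₂ → H.E → H.E → Prop} (h₁ : JointlyWF B₁) (h₂ : JointlyWF B₂) :
    JointlyWF fun d (s : S₁ × S₂) =>
      ChoiceRel (p := p) (G := fun b : Bool => Bool.rec H G b) fun b =>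
        Bool.rec (B₂ d s.2) (B₁ d s.1) b := by
  refine JointlyWF.choice (G := fun b : Bool => Bool.rec H G b)
    (B := fun b d (s : S₁ × S₂) => Bool.rec (B₂ d s.2) (B₁ d s.1) b) fun b => ?_
  cases b
  · exact h₂.comap Prod.snd Prod.snd_surjective
  · exact h₁.comap Prod.fst Prod.fst_surjective

/-- Pars are ordered by the switchings of the dual (`d₀ = true`), tensors by those of the formula
itself (`d₀ = false`). -/
theorem jointlyWF_before {X : Type} (ρ : X → AsyncGame) :
    ∀ A : Formula X, JointlyWF (Before ρ A)
  | .var x => by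
    have := nonempty_switching (Formula.var x)
    exact .of_false fun _ _ _ _ h => h
  | .dvar x => by
    have := nonempty_switching (Formula.dvar x)
    exact .of_false fun _ _ _ _ h => h
  | .par A B => by
    have := nonempty_switching A
    have := nonempty_switching B
    have := nonempty_switching (A.par B)
    exact .choice fun _ : Unit => .prod (d₀ := true) (jointlyWF_before ρ A) (jointlyWF_before ρ B)
  | .tens A B => by
    have := nonempty_switching A
    have := nonempty_switching B
    have := nonempty_switching (A.tens B)
    exact .choice fun _ : Unit => .prod (d₀ := false) (jointlyWF_before ρ A) (jointlyWF_before ρ B)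
  | .with_ A B => by
    have := nonempty_switching A
    have := nonempty_switching B
    exact jointlyWF_choice_bool (jointlyWF_before ρ A) (jointlyWF_before ρ B)
  | .plus A B => by
    have := nonempty_switching A
    have := nonempty_switching B
    exact jointlyWF_choice_bool (jointlyWF_before ρ A) (jointlyWF_before ρ B)

end AsyncConc

/-! ### Switching relations on events -/

namespace AsyncConc
open AsyncGame

namespace AsyncGame.Conf

/-- The relation `Q` on transitions only depends on events, and does not distinguish between
conflicting transitions. -/
structure Respects {G : AsyncGame} (c : Conf G) (Q : G.E → G.E → Prop) : Prop where
  inv : ∀ {e₁ e₂ e₁' e₂'}, c.ev e₁ = c.ev e₁' → c.ev e₂ = c.ev e₂' → Q e₁ e₂ → Q e₁' e₂'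
  irrefl : ∀ {e e'}, c.ev e = c.ev e' → ¬ Q e e'
  left : ∀ {e e' e''}, G.src e = G.src e' → (¬ ∃ p q, G.tile e p e' q) → G.src e'' = G.src e →
    Q e e'' → Q e' e''
  right : ∀ {e e' e''}, G.src e = G.src e' → (¬ ∃ p q, G.tile e p e' q) → G.src e'' = G.src e →
    Q e'' e → Q e'' e'

theorem Respects.of_false {G : AsyncGame} {c : Conf G} {Q : G.E → G.E → Prop}
    (h : ∀ e e', ¬ Q e e') : c.Respects Q :=
  ⟨fun _ _ hq => absurd hq (h _ _), fun _ => h _ _, fun _ _ _ hq => absurd hq (h _ _),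
    fun _ _ _ hq => absurd hq (h _ _)⟩

/-- Coinitial transitions of different components always form a tile, so conflicting transitions lie
in the same component and are seen alike from the other one. -/
theorem Respects.prod {G H : AsyncGame} {c : Conf G} {d : Conf H} {Q : G.E → G.E → Prop}
    {Q' : H.E → H.E → Prop} (h : c.Respects Q) (h' : d.Respects Q') (l r : Prop) :
    (c.prod d).Respects (prodRel Q Q' l r) where
  inv := by
    rintro (⟨m₁, y₁⟩ | ⟨x₁, n₁⟩) (⟨m₂, y₂⟩ | ⟨x₂, n₂⟩) (⟨m₃, y₃⟩ | ⟨x₃, n₃⟩) (⟨m₄, y₄⟩ | ⟨x₄, n₄⟩)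
      h₁ h₂ hq <;> first | cases h₁ | cases h₂ | skip
    · exact h.inv (Sum.inl.inj h₁) (Sum.inl.inj h₂) hq
    · exact hq
    · exact hq
    · exact h'.inv (Sum.inr.inj h₁) (Sum.inr.inj h₂) hq
  irrefl := by
    rintro (⟨m₁, y₁⟩ | ⟨x₁, n₁⟩) (⟨m₂, y₂⟩ | ⟨x₂, n₂⟩) h₁
    · exact h.irrefl (Sum.inl.inj h₁)
    · cases h₁
    · cases h₁
    · exact h'.irrefl (Sum.inr.inj h₁)
  left := by
    rintro (⟨m₁, y₁⟩ | ⟨x₁, n₁⟩) (⟨m₂, y₂⟩ | ⟨x₂, n₂⟩) e h₁ ht h₂ hq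
    · obtain ⟨h3, h4⟩ := Prod.mk.inj h₁
      subst h4
      rcases e with ⟨m₃, y₃⟩ | ⟨x₃, n₃⟩
      · exact h.left h3 (fun ⟨p, q, h⟩ => ht ⟨_, _, .left _ h⟩) (Prod.mk.inj h₂).1 hq
      · exact hq
    · obtain ⟨h3, h4⟩ := Prod.mk.inj h₁
      subst h3 h4
      exact absurd ⟨_, _, .leftRight _ _⟩ ht
    · obtain ⟨h3, h4⟩ := Prod.mk.inj h₁
      subst h3 h4
      exact absurd ⟨_, _, .rightLeft _ _⟩ ht
    · obtain ⟨h3, h4⟩ := Prod.mk.inj h₁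
      subst h3
      rcases e with ⟨m₃, y₃⟩ | ⟨x₃, n₃⟩
      · exact hq
      · exact h'.left h4 (fun ⟨p, q, h⟩ => ht ⟨_, _, .right _ h⟩) (Prod.mk.inj h₂).2 hq
  right := by
    rintro (⟨m₁, y₁⟩ | ⟨x₁, n₁⟩) (⟨m₂, y₂⟩ | ⟨x₂, n₂⟩) e h₁ ht h₂ hq
    · obtain ⟨h3, h4⟩ := Prod.mk.inj h₁
      subst h4
      rcases e with ⟨m₃, y₃⟩ | ⟨x₃, n₃⟩
      · exact h.right h3 (fun ⟨p, q, h⟩ => ht ⟨_, _, .left _ h⟩) (Prod.mk.inj h₂).1 hq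
      · exact hq
    · obtain ⟨h3, h4⟩ := Prod.mk.inj h₁
      subst h3 h4
      exact absurd ⟨_, _, .leftRight _ _⟩ ht
    · obtain ⟨h3, h4⟩ := Prod.mk.inj h₁
      subst h3 h4
      exact absurd ⟨_, _, .rightLeft _ _⟩ ht
    · obtain ⟨h3, h4⟩ := Prod.mk.inj h₁
      subst h3
      rcases e with ⟨m₃, y₃⟩ | ⟨x₃, n₃⟩
      · exact hq
      · exact h'.right h4 (fun ⟨p, q, h⟩ => ht ⟨_, _, .right _ h⟩) (Prod.mk.inj h₂).2 hq

theorem Respects.choice {p : Polarity} {ι : Type} {G : ι → AsyncGame} {c : ∀ i, Conf (G i)}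
    {Q : ∀ i, (G i).E → (G i).E → Prop} (h : ∀ i, (c i).Respects (Q i)) :
    (choice (p := p) c).Respects (ChoiceRel Q) where
  inv := by
    rintro _ _ (i₁ | ⟨i₁, m₁⟩) (i₂ | ⟨i₂, m₂⟩) h₁ h₂ ⟨i, hq⟩ <;>
      first | cases h₁ | cases h₂ | skip
    obtain ⟨h3, h4⟩ := Sigma.mk.inj (Sum.inr.inj h₁)
    dsimp only at h3
    subst h3
    obtain ⟨h5, h6⟩ := Sigma.mk.inj (Sum.inr.inj h₂)
    dsimp only at h5
    subst h5
    exact .mk i ((h i).inv (eq_of_heq h4) (eq_of_heq h6) hq)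
  irrefl := by
    rintro _ _ h₁ ⟨i, hq⟩
    obtain ⟨-, h4⟩ := Sigma.mk.inj (Sum.inr.inj h₁)
    exact (h i).irrefl (eq_of_heq h4) hq
  left := by
    rintro _ (i₂ | ⟨i₂, m₂⟩) _ h₁ ht h₂ ⟨i, hq⟩
    · cases h₁
    · obtain ⟨h3, h4⟩ := Sigma.mk.inj (Option.some.inj h₁)
      subst h3
      obtain ⟨-, h5⟩ := Sigma.mk.inj (Option.some.inj h₂)
      exact .mk i ((h i).left (eq_of_heq h4) (fun ⟨p, q, h⟩ => ht ⟨_, _, .mk i h⟩)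
        (eq_of_heq h5) hq)
  right := by
    rintro _ (i₂ | ⟨i₂, m₂⟩) _ h₁ ht h₂ ⟨i, hq⟩
    · cases h₁
    · obtain ⟨h3, h4⟩ := Sigma.mk.inj (Option.some.inj h₁)
      subst h3
      obtain ⟨-, h5⟩ := Sigma.mk.inj (Option.some.inj h₂)
      exact .mk i ((h i).right (eq_of_heq h4) (fun ⟨p, q, h⟩ => ht ⟨_, _, .mk i h⟩)
        (eq_of_heq h5) hq)

/-- A relation on events that presents the relation `Q` on transitions. -/
def evRel {G : AsyncGame} (c : Conf G) (Q : G.E → G.E → Prop) (a b : c.Ev) : Prop :=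
  ∃ e e', c.ev e = a ∧ c.ev e' = b ∧ Q e e'

theorem Respects.evRel_iff {G : AsyncGame} {c : Conf G} {Q : G.E → G.E → Prop} (h : c.Respects Q)
    {e e' : G.E} : c.evRel Q (c.ev e) (c.ev e') ↔ Q e e' :=
  ⟨fun ⟨_, _, h1, h2, hq⟩ => h.inv h1 h2 hq, fun hq => ⟨e, e', rfl, rfl, hq⟩⟩

end AsyncGame.Conf

/-- Configurations of a game with the relations induced by switchings. -/
structure SwConf {G : AsyncGame} {S : Type} (Bf : Bool → S → G.E → G.E → Prop) where
  conf : Conf G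
  respects : ∀ d s, conf.Respects (Bf d s)
  sep : ∀ {e e' w}, G.src e = G.src e' → e ≠ e' → conf.evs (G.tgt e) ⊆ conf.evs w →
    conf.evs (G.tgt e') ⊆ conf.evs w → ∃ d s, Bf d s e e'
  -- A single linearization obeys a switching of the dual and one of the game at once, because each
  -- connective is ordered by only one of them. The two sides of the copy-cat strategy will follow
  -- it.
  lin : ∀ s t w, ∃ l, G.Path G.init l w ∧
    l.Pairwise fun e e' => ¬ Bf true s e' e ∧ ¬ Bf false t e' e

namespace SwConf

theorem of_sequential {G : AsyncGame} (h : G.IsSequential) {S : Type}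
    {Bf : Bool → S → G.E → G.E → Prop} (hBf : ∀ d s e e', ¬ Bf d s e e') :
    Nonempty (SwConf Bf) :=
  ⟨{ conf := .ofSequential h
     respects := fun _ _ => .of_false (hBf _ _)
     sep := fun h1 hne h2 h3 => by
       obtain ⟨p, q, ht⟩ := (Conf.ofSequential h).tile_of_subset h1 hne h2 h3
       exact absurd ht (h.no_tile _ _ _ _)
     lin := fun s t w => by
       obtain ⟨l, hl⟩ := G.reachable w
       exact ⟨l, hl, List.pairwise_of_forall fun _ _ => ⟨hBf _ _ _ _, hBf _ _ _ _⟩⟩ }⟩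

/-- The same data for the dual game. -/
def dual {G : AsyncGame} {S : Type} {Bf : Bool → S → G.E → G.E → Prop}
    (h : SwConf Bf) : SwConf (G := G.dual) Bf where
  conf := h.conf.dual
  respects d s := ⟨(h.respects d s).inv, (h.respects d s).irrefl, (h.respects d s).left,
    (h.respects d s).right⟩
  sep := h.sep
  lin := h.lin

theorem comap {G : AsyncGame} {S S' : Type} {Bf : Bool → S → G.E → G.E → Prop} (h : SwConf Bf)
    (g : S' → S) (hg : Function.Surjective g) : Nonempty (SwConf fun d s => Bf d (g s)) :=
  ⟨{ conf := h.conf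
     respects := fun d s => h.respects d _
     sep := fun h1 hne h2 h3 => by
       obtain ⟨d, s, h4⟩ := h.sep h1 hne h2 h3
       obtain ⟨s, rfl⟩ := hg s
       exact ⟨d, s, h4⟩
     lin := fun s t w => h.lin _ _ w }⟩

theorem prod {G H : AsyncGame} {S₁ S₂ : Type} [Nonempty S₁] [Nonempty S₂] (d₀ : Bool)
    {B₁ : Bool → S₁ → G.E → G.E → Prop} {B₂ : Bool → S₂ → H.E → H.E → Prop}
    (h₁ : SwConf B₁) (h₂ : SwConf B₂) : Nonempty (SwConf (JointlyWF.prodBf d₀ B₁ B₂)) := by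
  obtain ⟨s₁⟩ := ‹Nonempty S₁›
  obtain ⟨s₂⟩ := ‹Nonempty S₂›
  refine ⟨{ conf := h₁.conf.prod h₂.conf, respects := fun d s => ?_, sep := ?_, lin := ?_ }⟩
  · exact (h₁.respects d s.2.1).prod (h₂.respects d s.2.2) _ _
  · rintro (⟨m, y⟩ | ⟨x, n⟩) (⟨m', y'⟩ | ⟨x', n'⟩) w h hne hw hw'
    · obtain ⟨h3, h4⟩ := Prod.mk.inj h
      subst h4
      obtain ⟨d, s, hs⟩ := h₁.sep h3 (fun h => hne (by rw [h])) (Conf.prodEvs_subset.1 hw).1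
        (Conf.prodEvs_subset.1 hw').1
      exact ⟨d, (true, s, s₂), hs⟩
    · exact ⟨d₀, (true, s₁, s₂), rfl, rfl⟩
    · exact ⟨d₀, (false, s₁, s₂), rfl, rfl⟩
    · obtain ⟨h3, h4⟩ := Prod.mk.inj h
      subst h3
      obtain ⟨d, s, hs⟩ := h₂.sep h4 (fun h => hne (by rw [h])) (Conf.prodEvs_subset.1 hw).2
        (Conf.prodEvs_subset.1 hw').2
      exact ⟨d, (true, s₁, s), hs⟩
  · rintro s t ⟨x, y⟩
    obtain ⟨l₁, hl₁, hp₁⟩ := h₁.lin s.2.1 t.2.1 x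
    obtain ⟨l₂, hl₂, hp₂⟩ := h₂.lin s.2.2 t.2.2 y
    have hleft : ∀ z, (G.prod H).Path (G.init, z) (l₁.map fun m => .inl (m, z)) (x, z) := fun z =>
      isPathOn_map (src := G.src) (tgt := G.tgt) (src' := prodSrc G H) (tgt' := prodTgt G H)
        (fun v => (v, z)) (fun m => .inl (m, z)) (fun _ => rfl) (fun _ => rfl) hl₁
    have hright : ∀ z, (G.prod H).Path (z, H.init) (l₂.map fun n => .inr (z, n)) (z, y) := fun z =>
      isPathOn_map (src := H.src) (tgt := H.tgt) (src' := prodSrc G H) (tgt' := prodTgt G H)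
        (fun v => (z, v)) (fun n => .inr (z, n)) (fun _ => rfl) (fun _ => rfl) hl₂
    -- `d₀` tells which of the two switchings orders this connective; the other one imposes nothing
    -- across the components.
    by_cases hfirst : (d₀ = true ∧ s.1 = false) ∨ (d₀ = false ∧ t.1 = false)
    · refine ⟨_, (hright G.init).append (hleft y), ?_⟩
      rw [List.pairwise_append]
      refine ⟨List.pairwise_map.2 hp₂, List.pairwise_map.2 hp₁, ?_⟩
      intro e he e' he'
      obtain ⟨n, -, rfl⟩ := List.mem_map.1 he
      obtain ⟨m, -, rfl⟩ := List.mem_map.1 he'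
      constructor
      · rintro ⟨h1, h2⟩
        rcases hfirst with ⟨h3, h4⟩ | ⟨h3, h4⟩
        · exact Bool.noConfusion (h2.symm.trans h4)
        · exact Bool.noConfusion (h1.trans h3)
      · rintro ⟨h1, h2⟩
        rcases hfirst with ⟨h3, h4⟩ | ⟨h3, h4⟩
        · exact Bool.noConfusion (h1.trans h3)
        · exact Bool.noConfusion (h2.symm.trans h4)
    · refine ⟨_, (hleft H.init).append (hright x), ?_⟩
      rw [List.pairwise_append]
      refine ⟨List.pairwise_map.2 hp₁, List.pairwise_map.2 hp₂, ?_⟩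
      intro e he e' he'
      obtain ⟨n, -, rfl⟩ := List.mem_map.1 he
      obtain ⟨m, -, rfl⟩ := List.mem_map.1 he'
      exact ⟨fun ⟨h1, h2⟩ => hfirst (.inl ⟨h1.symm, h2⟩),
        fun ⟨h1, h2⟩ => hfirst (.inr ⟨h1.symm, h2⟩)⟩

theorem choice {p : Polarity} {ι S : Type} {G : ι → AsyncGame} [Nonempty S]
    {B : ∀ i, Bool → S → (G i).E → (G i).E → Prop} (h : ∀ i, SwConf (B i)) :
    Nonempty (SwConf fun d s => ChoiceRel (p := p) fun i => B i d s) := by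
  refine ⟨{ conf := .choice fun i => (h i).conf, respects := fun d s => ?_, sep := ?_, lin := ?_ }⟩
  · exact .choice fun i => (h i).respects d s
  · rintro (i | ⟨i, m⟩) (j | ⟨j, n⟩) w hs hne h1 h2
    · obtain ⟨y', h4, h5⟩ := Conf.choiceEvs_subset h2
      obtain ⟨y, rfl, h3⟩ := Conf.choiceEvs_subset h1
      cases h4
      exact absurd rfl hne
    · cases hs
    · cases hs
    · obtain ⟨h3, h4⟩ := Sigma.mk.inj (Option.some.inj hs)
      subst h3
      obtain ⟨y', h6, h7⟩ := Conf.choiceEvs_subset h2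
      obtain ⟨y, rfl, h5⟩ := Conf.choiceEvs_subset h1
      cases h6
      obtain ⟨d, s, hs⟩ := (h i).sep (eq_of_heq h4) (fun h => hne (by rw [h])) h5 h7
      exact ⟨d, s, .mk i hs⟩
  · rintro s t (_ | ⟨i, x⟩)
    · exact ⟨[], rfl, .nil⟩
    · obtain ⟨l, hl, hp⟩ := (h i).lin s t x
      refine ⟨.inl i :: l.map (fun m => .inr ⟨i, m⟩), ⟨rfl,
        isPathOn_map (src := (G i).src) (tgt := (G i).tgt) (src' := choiceSrc G)
          (tgt' := choiceTgt G) (fun v => some ⟨i, v⟩) (fun m => .inr ⟨i, m⟩)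
          (fun _ => rfl) (fun _ => rfl) hl⟩, ?_⟩
      refine List.pairwise_cons.2 ⟨fun e _ => ⟨(nomatch ·), (nomatch ·)⟩, ?_⟩
      refine List.pairwise_map.2 (hp.imp ?_)
      rintro e e' ⟨h1, h2⟩
      exact ⟨fun h => h1 (JointlyWF.choiceRel_inr.1 h), fun h => h2 (JointlyWF.choiceRel_inr.1 h)⟩

theorem choice_bool {p : Polarity} {G H : AsyncGame} {S₁ S₂ : Type}
    [Nonempty S₁] [Nonempty S₂] {B₁ : Bool → S₁ → G.E → G.E → Prop}
    {B₂ : Bool → S₂ → H.E → H.E → Prop} (h₁ : SwConf B₁) (h₂ : SwConf B₂) :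
    Nonempty (SwConf fun d (s : S₁ × S₂) =>
      ChoiceRel (p := p) (G := fun b : Bool => Bool.rec H G b) fun b =>
        Bool.rec (B₂ d s.2) (B₁ d s.1) b) := by
  refine SwConf.choice (G := fun b : Bool => Bool.rec H G b)
    (B := fun b d (s : S₁ × S₂) => Bool.rec (B₂ d s.2) (B₁ d s.1) b) fun b => ?_
  refine Nonempty.some ?_
  cases b
  · exact h₂.comap Prod.snd Prod.snd_surjective
  · exact h₁.comap Prod.fst Prod.fst_surjective

end SwConf

theorem nonempty_swConf {X : Type} {ρ : X → AsyncGame} (hρ : ∀ x, (ρ x).IsSequential) :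
    ∀ A : Formula X, Nonempty (SwConf (Before ρ A))
  | .var x => SwConf.of_sequential (hρ x) fun _ _ _ _ h => h
  | .dvar x => ⟨(SwConf.of_sequential (hρ x) (Bf := fun _ _ _ _ => False)
      fun _ _ _ _ h => h).some.dual⟩
  | .par A B => by
    have := nonempty_switching A
    have := nonempty_switching B
    have := nonempty_switching (A.par B)
    exact SwConf.choice fun _ : Unit =>
      (SwConf.prod true (nonempty_swConf hρ A).some (nonempty_swConf hρ B).some).some
  | .tens A B => by
    have := nonempty_switching A
    have := nonempty_switching B
    have := nonempty_switching (A.tens B)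
    exact SwConf.choice fun _ : Unit =>
      (SwConf.prod false (nonempty_swConf hρ A).some (nonempty_swConf hρ B).some).some
  | .with_ A B => by
    have := nonempty_switching A
    have := nonempty_switching B
    exact SwConf.choice_bool (nonempty_swConf hρ A).some (nonempty_swConf hρ B).some
  | .plus A B => by
    have := nonempty_switching A
    have := nonempty_switching B
    exact SwConf.choice_bool (nonempty_swConf hρ A).some (nonempty_swConf hρ B).some

end AsyncConc

/-! ### Scheduling as reachability through closed positions -/

namespace AsyncConc
open AsyncGame

namespace AsyncGame.Conf

section prod

variable {G H : AsyncGame} {c : Conf G} {d : Conf H} {x x' : G.V} {y y' : H.V}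

theorem prod_subset {v w : G.V × H.V} :
    (c.prod d).evs v ⊆ (c.prod d).evs w ↔ c.evs v.1 ⊆ c.evs w.1 ∧ d.evs v.2 ⊆ d.evs w.2 :=
  prodEvs_subset

theorem prod_evs_eq_inter {u v w : G.V × H.V} (h₁ : c.evs u.1 = c.evs v.1 ∩ c.evs w.1)
    (h₂ : d.evs u.2 = d.evs v.2 ∩ d.evs w.2) :
    (c.prod d).evs u = (c.prod d).evs v ∩ (c.prod d).evs w := by
  ext (a | b)
  · exact Set.ext_iff.1 h₁ a
  · exact Set.ext_iff.1 h₂ b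

theorem prod_evs_inter {u v w : G.V × H.V}
    (h : (c.prod d).evs u = (c.prod d).evs v ∩ (c.prod d).evs w) :
    c.evs u.1 = c.evs v.1 ∩ c.evs w.1 ∧ d.evs u.2 = d.evs v.2 ∩ d.evs w.2 :=
  ⟨Set.ext fun a => Set.ext_iff.1 h (.inl a), Set.ext fun a => Set.ext_iff.1 h (.inr a)⟩

theorem Step.prod_left {a : c.Ev} (h : c.Step x a x') (y : H.V) :
    (c.prod d).Step (x, y) (.inl a) (x', y) :=
  ⟨h.1, prodEvs_insert_left h.2 y⟩

theorem Step.prod_right {b : d.Ev} (x : G.V) (h : d.Step y b y') :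
    (c.prod d).Step (x, y) (.inr b) (x, y') :=
  ⟨h.1, prodEvs_insert_right x h.2⟩

theorem step_prod_inl {a : c.Ev} : (c.prod d).Step (x, y) (.inl a) (x', y') ↔
    c.Step x a x' ∧ y' = y := by
  constructor
  · rintro ⟨h1, h2⟩
    have key := Set.ext_iff.1 h2
    refine ⟨⟨h1, ?_⟩, d.evs_injective ?_⟩
    · ext b
      refine (key (.inl b)).trans ?_
      simp only [Set.mem_insert_iff]
      exact or_congr Sum.inl_injective.eq_iff Iff.rfl
    · ext b
      refine (key (.inr b)).trans ?_
      exact ⟨fun h => Or.resolve_left h (nomatch ·), Or.inr⟩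
  · rintro ⟨h, rfl⟩
    exact h.prod_left _

theorem step_prod_inr {b : d.Ev} : (c.prod d).Step (x, y) (.inr b) (x', y') ↔
    x' = x ∧ d.Step y b y' := by
  constructor
  · rintro ⟨h1, h2⟩
    have key := Set.ext_iff.1 h2
    refine ⟨c.evs_injective ?_, ⟨h1, ?_⟩⟩
    · ext a
      refine (key (.inl a)).trans ?_
      exact ⟨fun h => Or.resolve_left h (nomatch ·), Or.inr⟩
    · ext a
      refine (key (.inr a)).trans ?_
      simp only [Set.mem_insert_iff]
      exact or_congr Sum.inr_injective.eq_iff Iff.rfl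
  · rintro ⟨rfl, h⟩
    exact h.prod_right _

theorem step_prod_cases {v w : G.V × H.V} {e : c.Ev ⊕ d.Ev} (h : (c.prod d).Step v e w) :
    (∃ a, e = .inl a ∧ c.Step v.1 a w.1 ∧ w.2 = v.2) ∨
      ∃ b, e = .inr b ∧ w.1 = v.1 ∧ d.Step v.2 b w.2 := by
  obtain ⟨x, y⟩ := v
  obtain ⟨x', y'⟩ := w
  rcases e with a | b
  · exact .inl ⟨a, rfl, step_prod_inl.1 h⟩
  · exact .inr ⟨b, rfl, step_prod_inr.1 h⟩

end prod

variable {G : AsyncGame} {c : Conf G}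

/-- The position `v` contains, with each event, all the events of `w` that precede it for `Q`. -/
def ClosedIn (c : Conf G) (Q : G.E → G.E → Prop) (w v : G.V) : Prop :=
  ∀ a ∈ c.evs v, ∀ b ∈ c.evs w, c.evRel Q b a → b ∈ c.evs v

/-- The target of `e` is closed, so an event that has to precede `e` is already there and cannot be
added later on. -/
theorem pairwise_of_along {Q : G.E → G.E → Prop} (hQ : c.Respects Q) {K : G.V → Prop} {w : G.V}
    (hK : ∀ u, K u → c.ClosedIn Q w u) {x : G.V} {t : List G.E} (h : G.Along K x t w) :
    t.Pairwise fun e e' => ¬ Q e' e := by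
  have hlater : ∀ {x : G.V} {t : List G.E}, G.Path x t w → ∀ e ∈ t, c.ev e ∉ c.evs x := by
    intro x t ht e he hx
    obtain ⟨t₁, t₂, rfl⟩ := List.append_of_mem he
    obtain ⟨z, h1, rfl, -⟩ := isPathOn_append_inv ht
    exact c.ev_notMem e (c.evs_mono_path h1 hx)
  induction t generalizing x with
  | nil => exact .nil
  | cons e t ih =>
    obtain ⟨rfl, -, h2⟩ := h
    refine List.pairwise_cons.2 ⟨fun e' he' hq => ?_, ih h2⟩
    refine hlater h2.path e' he' (hK _ h2.left (c.ev e) (c.ev_mem_tgt e) _ ?_ (hQ.evRel_iff.2 hq))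
    exact (c.mem_evs_of_path h2.path _).2 (.inr ⟨e', he', rfl⟩)

/-- An event of `w` that is missing from `u` is added after all those of `u`, so it precedes none of
them for `Q`. -/
theorem closedIn_of_pairwise {Q : G.E → G.E → Prop} (hQ : c.Respects Q) {w u : G.V}
    {s t : List G.E} (hs : G.Path G.init s u) (ht : G.Path u t w)
    (h : (s ++ t).Pairwise fun e e' => ¬ Q e' e) : c.ClosedIn Q w u := by
  intro a ha b hb hab
  rw [c.mem_evs_of_path hs, c.evs_init] at ha
  obtain ⟨e, he, rfl⟩ := ha.resolve_left (Set.notMem_empty a)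
  rcases (c.mem_evs_of_path ht b).1 hb with hb | ⟨e', he', rfl⟩
  · exact hb
  · exact absurd (hQ.evRel_iff.1 hab) ((List.pairwise_append.1 h).2.2 e he e' he')

/-- Plays with the same target are homotopic, so the criterion only asks for one well-ordered path
inside `K` to each position. -/
theorem scheduled_iff {Q : G.E → G.E → Prop} (hQ : c.Respects Q) {K : G.V → Prop}
    {σ : Strategy G} (h : σ.PlaysIn K) (hK : c.Fam K) :
    (∀ s ∈ σ.plays, ∃ t ∈ σ.plays, G.Homotopic s t ∧ t.Pairwise fun e e' => ¬ Q e' e) ↔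
      ∀ w, K w → c.Chain (fun u => K u ∧ c.ClosedIn Q w u) G.init w := by
  constructor
  · intro hs w hw
    obtain ⟨s, hs₁, hs₂⟩ := (h.pos_iff hK w).2 hw
    obtain ⟨t, ht₁, ht₂, ht₃⟩ := hs s hs₁
    obtain ⟨w', hw'⟩ := (h t).1 ht₁
    obtain rfl := path_target (ht₂.path.1 hs₂) hw'.path
    refine Along.chain (s := t) (.of_path hw'.path fun t' ht' v hv => ?_) c
    refine ⟨hw'.of_prefix ht' hv, ?_⟩
    obtain ⟨u, rfl⟩ := ht'
    obtain ⟨v', h1, h2⟩ := isPathOn_append_inv hw'.path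
    obtain rfl := path_target hv h1
    exact closedIn_of_pairwise hQ h1 h2 ht₃
  · intro hc s hs
    obtain ⟨w, hw⟩ := (h s).1 hs
    have hinit : K G.init ∧ c.ClosedIn Q w G.init :=
      ⟨hK.init, fun a ha => absurd (c.evs_init ▸ ha) (Set.notMem_empty a)⟩
    obtain ⟨t, ht⟩ := (hc w hw.right).exists_along hinit
    exact ⟨t, (h t).2 ⟨w, ht.mono fun _ h => h.1⟩, c.homotopic_of_path hw.path ht.path,
      pairwise_of_along hQ (fun _ h => h.2) ht⟩

theorem evRel_prod_inl {G H : AsyncGame} {c : Conf G} {d : Conf H} {Q : G.E → G.E → Prop}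
    {Q' : H.E → H.E → Prop} {l r : Prop} {a b : c.Ev} :
    (c.prod d).evRel (prodRel Q Q' l r) (.inl a) (.inl b) ↔ c.evRel Q a b := by
  constructor
  · rintro ⟨⟨m, y⟩ | ⟨x, n⟩, ⟨m', y'⟩ | ⟨x', n'⟩, h1, h2, h3⟩
    · exact ⟨m, m', Sum.inl.inj h1, Sum.inl.inj h2, h3⟩
    · cases h2
    · cases h1
    · cases h1
  · rintro ⟨m, m', rfl, rfl, h⟩
    exact ⟨.inl (m, H.init), .inl (m', H.init), rfl, rfl, h⟩

theorem evRel_prod_inr {G H : AsyncGame} {c : Conf G} {d : Conf H} {Q : G.E → G.E → Prop}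
    {Q' : H.E → H.E → Prop} {l r : Prop} {a b : d.Ev} :
    (c.prod d).evRel (prodRel Q Q' l r) (.inr a) (.inr b) ↔ d.evRel Q' a b := by
  constructor
  · rintro ⟨⟨m, y⟩ | ⟨x, n⟩, ⟨m', y'⟩ | ⟨x', n'⟩, h1, h2, h3⟩
    · cases h1
    · cases h1
    · cases h2
    · exact ⟨n, n', Sum.inr.inj h1, Sum.inr.inj h2, h3⟩
  · rintro ⟨m, m', rfl, rfl, h⟩
    exact ⟨.inr (G.init, m), .inr (G.init, m'), rfl, rfl, h⟩

theorem closedIn_prod {G H : AsyncGame} {c : Conf G} {d : Conf H} {Q : G.E → G.E → Prop}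
    {Q' : H.E → H.E → Prop} {v w : G.V × H.V} :
    (c.prod d).ClosedIn (prodRel Q Q' False False) w v ↔
      c.ClosedIn Q w.1 v.1 ∧ d.ClosedIn Q' w.2 v.2 := by
  constructor
  · intro h
    exact ⟨fun a ha b hb hab => h (.inl a) ha (.inl b) hb (evRel_prod_inl.2 hab),
      fun a ha b hb hab => h (.inr a) ha (.inr b) hb (evRel_prod_inr.2 hab)⟩
  · rintro ⟨h1, h2⟩ (a | a) ha (b | b) hb hab
    · exact h1 a ha b hb (evRel_prod_inl.1 hab)
    · obtain ⟨⟨m, y⟩ | ⟨x, n⟩, ⟨m', y'⟩ | ⟨x', n'⟩, h1, h2, h3⟩ := hab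
      · cases h1
      · cases h1
      · exact h3.elim
      · cases h2
    · obtain ⟨⟨m, y⟩ | ⟨x, n⟩, ⟨m', y'⟩ | ⟨x', n'⟩, h1, h2, h3⟩ := hab
      · cases h2
      · exact h3.elim
      · cases h1
      · cases h1
    · exact h2 a ha b hb (evRel_prod_inr.1 hab)

theorem ClosedIn.inter {Q : G.E → G.E → Prop} {w u v v' : G.V} (h : c.ClosedIn Q w v)
    (h' : c.ClosedIn Q w v') (hu : c.evs u = c.evs v ∩ c.evs v') : c.ClosedIn Q w u := by
  intro a ha b hb hab
  rw [hu] at ha ⊢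
  exact ⟨h a ha.1 b hb hab, h' a ha.2 b hb hab⟩

theorem ClosedIn.union {Q : G.E → G.E → Prop} {w u v v' : G.V} (h : c.ClosedIn Q w v)
    (h' : c.ClosedIn Q w v') (hu : c.evs u = c.evs v ∪ c.evs v') : c.ClosedIn Q w u := by
  intro a ha b hb hab
  rw [hu] at ha ⊢
  exact ha.imp (fun ha => h a ha b hb hab) fun ha => h' a ha b hb hab

/-- A chain is transported along the join with a position. -/
theorem Chain.join_left {K P : G.V → Prop} (hK : c.ResClosed K) {z v w : G.V} (hz : P z)
    (hP : ∀ u, P u → K u) (h : c.Chain P z w) (hv : c.Chain K z v) (hvw : c.evs v ⊆ c.evs w) :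
    c.Chain (fun u => K u ∧ ∃ u₀, P u₀ ∧ c.evs u = c.evs u₀ ∪ c.evs v) v w := by
  -- Taking unions with `v` collapses the steps whose event is in `v` and keeps the others.
  have key : ∀ w', c.Chain P z w' → c.evs w' ⊆ c.evs w → ∃ u, c.evs u = c.evs w' ∪ c.evs v ∧
      c.Chain (fun u => K u ∧ ∃ u₀, P u₀ ∧ c.evs u = c.evs u₀ ∪ c.evs v) v u := by
    intro w' h'
    induction h' with
    | refl => exact fun _ => ⟨v, (Set.union_eq_self_of_subset_left hv.subset).symm, .refl⟩
    | @tail w₁ w₂ h1 h2 ih =>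
      intro hw
      obtain ⟨p1, p2, a, ha⟩ := h2
      obtain ⟨u, hu, hu'⟩ := ih (ha.subset.trans hw)
      by_cases hav : a ∈ c.evs v
      · refine ⟨u, ?_, hu'⟩
        rw [hu, ha.2]
        ext b; simp only [Set.mem_union, Set.mem_insert_iff]
        constructor
        · tauto
        · rintro ((rfl | h) | h) <;> tauto
      · obtain ⟨u₂, hu₂⟩ := c.union hw hvw
        have hstep : c.Step u a u₂ := by
          refine ⟨by rw [hu]; rintro (h | h); exacts [ha.1 h, hav h], ?_⟩
          rw [hu₂, hu, ha.2, Set.insert_union]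
        have hK₁ := (Chain.join hK (hP _ hz) (Chain.mono h1 fun u hu _ _ => hP u hu) hv hu).1
        have hK₂ := (Chain.join hK (hP _ hz) (Chain.mono (Relation.ReflTransGen.tail h1
          ⟨p1, p2, a, ha⟩) fun u hu _ _ => hP u hu) hv hu₂).1
        exact ⟨u₂, hu₂, .tail hu' ⟨⟨hK₁, _, p1, hu⟩, ⟨hK₂, _, p2, hu₂⟩, a, hstep⟩⟩
  obtain ⟨u, hu, hu'⟩ := key w h subset_rfl
  rw [Set.union_eq_self_of_subset_right hvw] at hu
  obtain rfl := c.evs_injective hu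
  exact hu'

end AsyncGame.Conf

/-! ### Absence of deadlocks -/

/-- There are dependencies between the transitions `f i`, compatible with all the switchings of
kind `d`, such that each transition which is not available depends on some other one. -/
def Blocked {E S I : Type} (Bf : Bool → S → E → E → Prop) (d : Bool) (f : I → E) (D : I → Prop) :
    Prop :=
  ∃ R : I → I → Prop, (∀ s, WellFounded fun i j => R i j ∨ Bf d s (f i) (f j)) ∧
    ∀ i, ¬ D i → ∃ j, R j i

namespace Blocked

variable {E S I : Type} {Bf : Bool → S → E → E → Prop} {d : Bool} {f : I → E} {D D' : I → Prop}

/-- A transition minimal for the union of the two dependency relations would wait for nothing, hence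
be available on both sides. -/
theorem isEmpty (hBf : JointlyWF Bf) (hsep : ∀ i j, i ≠ j → ∃ d s, Bf d s (f i) (f j))
    (h : Blocked Bf d f D) (h' : Blocked Bf (!d) f D') (hD : ∀ i, D i → ¬ D' i) : IsEmpty I := by
  obtain ⟨R, h1, h2⟩ := h
  obtain ⟨R', h3, h4⟩ := h'
  by_contra hne
  rw [not_isEmpty_iff] at hne
  obtain ⟨i, -, hi⟩ := (hBf I f d R R' hsep h1 h3).has_min Set.univ Set.univ_nonempty
  by_cases hDi : D i
  · obtain ⟨j, hj⟩ := h4 i (hD i hDi)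
    exact hi j trivial (.inr hj)
  · obtain ⟨j, hj⟩ := h2 i hDi
    exact hi j trivial (.inl hj)

theorem comap {J : Type} {f' : J → E} (h : Blocked Bf d f D) (g : J → I)
    (hg : Function.Surjective g)
    (hf : ∀ s i j, Bf d s (f' i) (f' j) → Bf d s (f (g i)) (f (g j))) :
    Blocked Bf d f' (D ∘ g) := by
  obtain ⟨R, h1, h2⟩ := h
  refine ⟨fun i j => R (g i) (g j), fun s => ?_, fun i hi => ?_⟩
  · refine Subrelation.wf ?_ (InvImage.wf g (h1 s))
    intro i j hij
    exact hij.imp_right (hf s i j)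
  · obtain ⟨j, hj⟩ := h2 _ hi
    obtain ⟨j, rfl⟩ := hg j
    exact ⟨j, hj⟩

/-- The dependencies inside a set of positions closed under meets: `j` precedes `i` if all the
positions that contain `i` contain `j`. -/
theorem of_chain {G : AsyncGame} {c : Conf G} {K : G.V → Prop} (hK : c.InterClosed K) {v w : G.V}
    (hw : K w) (g : I → c.Ev) (hgw : ∀ i, g i ∈ c.evs w) (hgv : ∀ i, g i ∉ c.evs v) [Nonempty S]
    (hirr : ∀ s i j, g i = g j → ¬ Bf d s (f i) (f j))
    (hchain : ∀ s, c.Chain (fun u => K u ∧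
      ∀ i j, g i ∈ c.evs u → Bf d s (f j) (f i) → g j ∈ c.evs u) v w)
    (hstep : ∀ a u, c.Step v a u → K u → c.evs u ⊆ c.evs w → ∃ j, g j = a) :
    Blocked Bf d f fun i => ∃ u, c.Step v (g i) u ∧ K u := by
  have hchain₀ : c.Chain K v w := (hchain (Classical.arbitrary S)).mono fun u hu _ _ => hu.1
  refine ⟨fun j i => g j ≠ g i ∧ ∀ u, K u → c.evs v ⊆ c.evs u → c.evs u ⊆ c.evs w →
    g i ∈ c.evs u → g j ∈ c.evs u, fun s => ?_, fun i hi => ?_⟩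
  · rw [WellFounded.wellFounded_iff_has_min]
    rintro C ⟨i₀, hi₀⟩
    by_contra hno
    push Not at hno
    -- Along a chain that obeys `s`, no element of `C` can be the first one to occur: its
    -- predecessor in `C` has to be there already.
    have key : ∀ u, c.Chain (fun u => K u ∧
        ∀ i j, g i ∈ c.evs u → Bf d s (f j) (f i) → g j ∈ c.evs u) v u → c.evs u ⊆ c.evs w →
        ∀ i ∈ C, g i ∉ c.evs u := by
      intro u hu
      induction hu with
      | refl => exact fun _ i _ => hgv i
      | @tail u u' h1 h2 ih =>
        intro huw i hi hiu
        have hvu' : c.evs v ⊆ c.evs u' := Conf.Chain.subset (Relation.ReflTransGen.tail h1 h2)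
        obtain ⟨-, k2, a, ha⟩ := h2
        have hsub := ha.subset.trans huw
        have hia : g i = a := ((ha.mem_iff _).1 hiu).resolve_right (ih hsub i hi)
        obtain ⟨j, hj, hji⟩ := hno i hi
        have hne : g j ≠ g i ∧ g j ∈ c.evs u' := by
          rcases hji with ⟨h3, h4⟩ | h3
          · exact ⟨h3, h4 u' k2.1 hvu' huw hiu⟩
          · exact ⟨fun h => hirr s j i h h3, k2.2 i j hiu h3⟩
        exact ih hsub j hj (((ha.mem_iff _).1 hne.2).resolve_left (hia ▸ hne.1))
    exact key w (hchain s) subset_rfl i₀ hi₀ (hgw i₀)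
  -- In the least position above `v` that contains `g i`, the first event of a chain from `v` is one
  -- on which `i` depends; it is not `g i`, which is not available at `v`.
  · obtain ⟨u, ⟨hu1, hu2, hu3⟩, hmin⟩ := c.exists_least
      (Q := fun u => K u ∧ c.evs v ⊆ c.evs u ∧ g i ∈ c.evs u) ⟨w, hw, hchain₀.subset, hgw i⟩
      fun u x y hx hy hu => ⟨hK u x y hx.1 hy.1 hu,
        by rw [hu]; exact Set.subset_inter hx.2.1 hy.2.1,
        by rw [hu]; exact ⟨hx.2.2, hy.2.2⟩⟩
    have huw := hmin w ⟨hw, hchain₀.subset, hgw i⟩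
    have hvu := hchain₀.inter hK hu1 huw hu2
    rcases Relation.ReflTransGen.cases_head hvu with rfl | ⟨v', ⟨-, hv', a, ha⟩, h'⟩
    · exact absurd hu3 (hgv i)
    · have hv'u : c.evs v' ⊆ c.evs u := Conf.Chain.subset h'
      obtain ⟨j, rfl⟩ := hstep a v' ha hv' (hv'u.trans huw)
      refine ⟨j, fun h => hi ⟨v', h ▸ ha, hv'⟩, fun x hx hvx _ hix => ?_⟩
      exact hmin x ⟨hx, hvx, hix⟩ (hv'u ha.mem)

end Blocked

end AsyncConc

/-! ### Interactions without deadlocks -/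

namespace AsyncConc
open AsyncGame

namespace AsyncGame.Conf

/-- The set of positions `K` is closed under residuals and meets, and `w` is reached inside `K`
while satisfying any of the properties `P s`. -/
structure Lin {G : AsyncGame} (c : Conf G) (K : G.V → Prop) {S : Type} (P : S → G.V → Prop)
    (w : G.V) : Prop where
  res : c.ResClosed K
  inter : c.InterClosed K
  init : K G.init
  chain : ∀ s, c.Chain (fun u => K u ∧ P s u) G.init w

/-- Any of the given chains to `w`, intersected with `u`, leads to `u`. -/
theorem Lin.reach {G : AsyncGame} {c : Conf G} {K : G.V → Prop} {S : Type} [Nonempty S]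
    {P : S → G.V → Prop} {w : G.V} (h : c.Lin K P w) {u : G.V} (hu : K u)
    (huw : c.evs u ⊆ c.evs w) : c.Chain K G.init u := by
  have h₀ : c.Chain K G.init w := (h.chain (Classical.arbitrary S)).mono fun u hu _ _ => hu.1
  exact h₀.inter h.inter hu huw (by rw [c.evs_init]; exact Set.empty_subset _)

theorem Lin.top {G : AsyncGame} {c : Conf G} {K : G.V → Prop} {S : Type} [Nonempty S]
    {P : S → G.V → Prop} {w : G.V} (h : c.Lin K P w) : K w :=
  ((h.chain (Classical.arbitrary S)).mono (K' := K) fun _ hu _ _ => hu.1).right h.init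

theorem Lin.chain_of_le {G : AsyncGame} {c : Conf G} {K : G.V → Prop} {S : Type} [Nonempty S]
    {P : S → G.V → Prop} {w : G.V} (h : c.Lin K P w) {u : G.V} (hu : K u)
    (huw : c.evs u ⊆ c.evs w) : c.Chain K u w :=
  (h.reach hu huw).of_subset h.res (h.reach h.top subset_rfl) huw

theorem closedIn_init {G : AsyncGame} (c : Conf G) (Q : G.E → G.E → Prop) (w : G.V) :
    c.ClosedIn Q w G.init :=
  fun a ha => absurd (c.evs_init ▸ ha) (Set.notMem_empty a)

end AsyncGame.Conf

theorem Blocked.mono {E S I : Type} {Bf : Bool → S → E → E → Prop} {d : Bool} {f : I → E}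
    {D D' : I → Prop} (h : Blocked Bf d f D) (hD : ∀ i, D i → D' i) : Blocked Bf d f D' := by
  obtain ⟨R, h1, h2⟩ := h
  exact ⟨R, h1, fun i hi => h2 i fun hi' => hi (hD i hi')⟩

/-- The transitions from `y` that lead to a position below `w`. -/
def AsyncGame.Conf.Enabled {G : AsyncGame} (c : Conf G) (y w : G.V) : Type :=
  {e : G.E // G.src e = y ∧ c.evs (G.tgt e) ⊆ c.evs w}

/-- Interactions of two sets of positions, in the product of three games. -/
def Inter {A B C : AsyncGame} (K₁ : (A.prod B).V → Prop) (K₂ : (B.dual.prod C).V → Prop)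
    (v : (A.prod (B.prod C)).V) : Prop :=
  K₁ (v.1, v.2.1) ∧ K₂ v.2

namespace SwConf

variable {B : AsyncGame} {S : Type} {Bf : Bool → S → B.E → B.E → Prop}

theorem sep_enabled (sw : SwConf Bf) {y w : B.V} (i j : sw.conf.Enabled y w) (hij : i ≠ j) :
    ∃ d s, Bf d s i.1 j.1 :=
  sw.sep (i.2.1.trans j.2.1.symm) (fun h => hij (Subtype.ext h)) i.2.2 j.2.2

variable [Nonempty S]

/-- A strategy that cannot move in `G` on its way to `(x', y')` can only start with moves of `B`.
The scheduled chains to `(x', y')`, joined with the current position, show that its dependencies are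
compatible with every switching. -/
theorem blocked_right (sw : SwConf Bf) {G : AsyncGame} {c : Conf G} {d : Bool}
    {K : (G.prod B).V → Prop} {x x' : G.V} {y y' : B.V}
    (h : (c.prod sw.conf).Lin K (fun s u => sw.conf.ClosedIn (Bf d s) y' u.2) (x', y'))
    (hv : K (x, y)) (hx : c.evs x ⊆ c.evs x') (hy : sw.conf.evs y ⊆ sw.conf.evs y')
    (hno : ∀ a x₁, c.Step x a x₁ → c.evs x₁ ⊆ c.evs x' → ¬ K (x₁, y)) :
    Blocked Bf d (fun i : sw.conf.Enabled y y' => i.1) fun i => K (x, B.tgt i.1) := by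
  have hle : (c.prod sw.conf).evs (x, y) ⊆ (c.prod sw.conf).evs (x', y') :=
    Conf.prod_subset.2 ⟨hx, hy⟩
  refine (Blocked.of_chain (c := c.prod sw.conf) (K := K) (v := (x, y)) (w := (x', y')) h.inter
    h.top (fun i => .inr (sw.conf.ev i.1)) (fun i => ?_) (fun i => ?_) (fun s i j hij => ?_)
    (fun s => ?_) fun a u ha hu huw => ?_).mono ?_
  · exact i.2.2 (sw.conf.ev_mem_tgt i.1)
  · have := sw.conf.ev_notMem i.1
    rw [i.2.1] at this
    exact this
  · exact (sw.respects d s).irrefl (Sum.inr.inj hij)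
  · refine (Conf.Chain.join_left h.res ⟨h.init, Conf.closedIn_init _ _ _⟩ (fun u hu => hu.1)
      (h.chain s) (h.reach hv hle) hle).mono ?_
    rintro u ⟨hu, u₀, hu₀, he⟩ - -
    refine ⟨hu, fun i j hi hji => ?_⟩
    -- Events enabled at `y` are not in the current position, so in the union they come from the
    -- scheduled chain and inherit its closure property.
    have hi' : (Sum.inr (sw.conf.ev i.1) : (c.prod sw.conf).Ev) ∈ (c.prod sw.conf).evs u₀ := by
      refine Or.resolve_right (he ▸ hi) ?_
      have := sw.conf.ev_notMem i.1
      rw [i.2.1] at this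
      exact this
    exact he ▸ Or.inl (hu₀.2 _ hi' _ (j.2.2 (sw.conf.ev_mem_tgt j.1))
      ((sw.respects d s).evRel_iff.2 hji))
  · have huw' := Conf.prod_subset.1 huw
    rcases Conf.step_prod_cases ha with ⟨b, rfl, h1, h2⟩ | ⟨b, rfl, h1, h2⟩
    · refine absurd ?_ (hno b u.1 h1 huw'.1)
      rw [← show u.2 = y from h2]
      exact hu
    · obtain ⟨e, h3, h4, h5⟩ := h2.exists_edge
      exact ⟨⟨e, h3, h4 ▸ huw'.2⟩, congrArg Sum.inr h5⟩
  · rintro i ⟨u, h1, h2⟩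
    obtain ⟨u₁, u₂⟩ := u
    obtain ⟨rfl, h3⟩ := Conf.step_prod_inr.1 h1
    have h4 := Conf.step_edge (c := sw.conf) i.1
    rw [i.2.1] at h4
    rw [h4.unique h3]
    exact h2

theorem blocked_left (sw : SwConf Bf) {G : AsyncGame} {c : Conf G} {d : Bool}
    {K : (B.prod G).V → Prop} {x x' : G.V} {y y' : B.V}
    (h : (sw.conf.prod c).Lin K (fun s u => sw.conf.ClosedIn (Bf d s) y' u.1) (y', x'))
    (hv : K (y, x)) (hx : c.evs x ⊆ c.evs x') (hy : sw.conf.evs y ⊆ sw.conf.evs y')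
    (hno : ∀ a x₁, c.Step x a x₁ → c.evs x₁ ⊆ c.evs x' → ¬ K (y, x₁)) :
    Blocked Bf d (fun i : sw.conf.Enabled y y' => i.1) fun i => K (B.tgt i.1, x) := by
  have hle : (sw.conf.prod c).evs (y, x) ⊆ (sw.conf.prod c).evs (y', x') :=
    Conf.prod_subset.2 ⟨hy, hx⟩
  refine (Blocked.of_chain (c := sw.conf.prod c) (K := K) (v := (y, x)) (w := (y', x')) h.inter
    h.top (fun i => .inl (sw.conf.ev i.1)) (fun i => ?_) (fun i => ?_) (fun s i j hij => ?_)
    (fun s => ?_) fun a u ha hu huw => ?_).mono ?_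
  · exact i.2.2 (sw.conf.ev_mem_tgt i.1)
  · have := sw.conf.ev_notMem i.1
    rw [i.2.1] at this
    exact this
  · exact (sw.respects d s).irrefl (Sum.inl.inj hij)
  · refine (Conf.Chain.join_left h.res ⟨h.init, Conf.closedIn_init _ _ _⟩ (fun u hu => hu.1)
      (h.chain s) (h.reach hv hle) hle).mono ?_
    rintro u ⟨hu, u₀, hu₀, he⟩ - -
    refine ⟨hu, fun i j hi hji => ?_⟩
    have hi' : (Sum.inl (sw.conf.ev i.1) : (sw.conf.prod c).Ev) ∈ (sw.conf.prod c).evs u₀ := by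
      refine Or.resolve_right (he ▸ hi) ?_
      have := sw.conf.ev_notMem i.1
      rw [i.2.1] at this
      exact this
    exact he ▸ Or.inl (hu₀.2 _ hi' _ (j.2.2 (sw.conf.ev_mem_tgt j.1))
      ((sw.respects d s).evRel_iff.2 hji))
  · have huw' := Conf.prod_subset.1 huw
    rcases Conf.step_prod_cases ha with ⟨b, rfl, h1, h2⟩ | ⟨b, rfl, h1, h2⟩
    · obtain ⟨e, h3, h4, h5⟩ := h1.exists_edge
      exact ⟨⟨e, h3, h4 ▸ huw'.1⟩, congrArg Sum.inl h5⟩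
    · refine absurd ?_ (hno b u.2 h2 huw'.2)
      rw [← show u.1 = y from h1]
      exact hu
  · rintro i ⟨u, h1, h2⟩
    obtain ⟨u₁, u₂⟩ := u
    obtain ⟨h3, rfl⟩ := Conf.step_prod_inl.1 h1
    have h4 := Conf.step_edge (c := sw.conf) i.1
    rw [i.2.1] at h4
    rw [h4.unique h3]
    exact h2

/-- If nothing could move, both strategies would be blocked in `B`, with dependencies compatible
with the two dual kinds of switchings, and `Blocked.isEmpty` would leave nothing to play there. As
each strategy can reach its target on its own, the targets would already be reached. -/
theorem interaction_step (sw : SwConf Bf) (hBf : JointlyWF Bf) {A C : AsyncGame} {cA : Conf A}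
    {cC : Conf C} {K₁ : (A.prod B).V → Prop} {K₂ : (B.dual.prod C).V → Prop}
    {x x' : A.V} {y y' : B.V} {z z' : C.V}
    (h₁ : (cA.prod sw.conf).Lin K₁ (fun s u => sw.conf.ClosedIn (Bf false s) y' u.2) (x', y'))
    (h₂ : (sw.dual.conf.prod cC).Lin K₂ (fun s u => sw.dual.conf.ClosedIn (Bf true s) y' u.1)
      (y', z'))
    (h : Inter (B := B) K₁ K₂ (x, y, z)) (hx : cA.evs x ⊆ cA.evs x')
    (hy : sw.conf.evs y ⊆ sw.conf.evs y') (hz : cC.evs z ⊆ cC.evs z')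
    (hne : (x, y, z) ≠ (x', y', z')) :
    ∃ a v, (cA.prod (sw.conf.prod cC)).Step (x, y, z) a v ∧ Inter (B := B) K₁ K₂ v ∧
      (cA.prod (sw.conf.prod cC)).evs v ⊆ (cA.prod (sw.conf.prod cC)).evs (x', y', z') := by
  by_contra hno
  push Not at hno
  have hnoA : ∀ a x₁, cA.Step x a x₁ → cA.evs x₁ ⊆ cA.evs x' → ¬ K₁ (x₁, y) :=
    fun a x₁ ha hx₁ hK => hno (.inl a) (x₁, y, z) (ha.prod_left _) ⟨hK, h.2⟩
      (Conf.prod_subset.2 ⟨hx₁, Conf.prod_subset.2 ⟨hy, hz⟩⟩)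
  have hnoC : ∀ a z₁, cC.Step z a z₁ → cC.evs z₁ ⊆ cC.evs z' → ¬ K₂ (y, z₁) :=
    fun a z₁ ha hz₁ hK => hno (.inr (.inr a)) (x, y, z₁) ((ha.prod_right y).prod_right x) ⟨h.1, hK⟩
      (Conf.prod_subset.2 ⟨hx, Conf.prod_subset.2 ⟨hy, hz₁⟩⟩)
  have b₁ := sw.blocked_right h₁ h.1 hx hy hnoA
  have b₂ := sw.dual.blocked_left h₂ h.2 hz hy hnoC
  have hempty := b₁.isEmpty hBf sw.sep_enabled b₂ fun i hi hi' => by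
    have hs := Conf.step_edge (c := sw.conf) i.1
    rw [i.2.1] at hs
    exact hno (.inr (.inl (sw.conf.ev i.1))) (x, B.tgt i.1, z) ((hs.prod_left z).prod_right x)
      ⟨hi, hi'⟩ (Conf.prod_subset.2 ⟨hx, Conf.prod_subset.2 ⟨i.2.2, hz⟩⟩)
  obtain rfl : y = y' := by
    by_contra hyy
    obtain ⟨a, y₁, ha, hy₁⟩ := Conf.exists_step hy hyy
    obtain ⟨e, he1, rfl, -⟩ := ha.exists_edge
    exact hempty.elim ⟨e, he1, hy₁⟩
  -- With `B` finished, a chain of the first strategy to its target could only start in `A`, which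
  -- is excluded.
  obtain rfl : x = x' := by
    by_contra hxx
    have hch := h₁.chain_of_le h.1 (Conf.prod_subset.2 ⟨hx, hy⟩)
    rcases Relation.ReflTransGen.cases_head hch with heq | ⟨v', ⟨-, hv', a, ha⟩, h'⟩
    · exact hxx (Prod.mk.inj heq).1
    · have hsub := Conf.prod_subset.1 (Conf.Chain.subset h')
      rcases Conf.step_prod_cases ha with ⟨b, rfl, k1, k2⟩ | ⟨b, rfl, k1, k2⟩
      · refine hnoA b v'.1 k1 hsub.1 ?_
        rw [← show v'.2 = y from k2]
        exact hv'
      · exact k2.1 (hsub.2 k2.mem)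
  obtain rfl : z = z' := by
    by_contra hzz
    have hch := h₂.chain_of_le h.2 (Conf.prod_subset.2 ⟨hy, hz⟩)
    rcases Relation.ReflTransGen.cases_head hch with heq | ⟨v', ⟨-, hv', a, ha⟩, h'⟩
    · exact hzz (Prod.mk.inj heq).2
    · have hsub := Conf.prod_subset.1 (Conf.Chain.subset h')
      rcases Conf.step_prod_cases ha with ⟨b, rfl, k1, k2⟩ | ⟨b, rfl, k1, k2⟩
      · exact k1.1 (hsub.1 k1.mem)
      · refine hnoC b v'.2 k2 hsub.2 ?_
        rw [← show v'.1 = y from k1]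
        exact hv'
  exact hne rfl

theorem interaction_chain (sw : SwConf Bf) (hBf : JointlyWF Bf) {A C : AsyncGame} {cA : Conf A}
    {cC : Conf C} {K₁ : (A.prod B).V → Prop} {K₂ : (B.dual.prod C).V → Prop}
    {x' : A.V} {y' : B.V} {z' : C.V}
    (h₁ : (cA.prod sw.conf).Lin K₁ (fun s u => sw.conf.ClosedIn (Bf false s) y' u.2) (x', y'))
    (h₂ : (sw.dual.conf.prod cC).Lin K₂ (fun s u => sw.dual.conf.ClosedIn (Bf true s) y' u.1)
      (y', z')) :
    (cA.prod (sw.conf.prod cC)).Chain (Inter (B := B) K₁ K₂) (A.init, B.init, C.init)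
      (x', y', z') := by
  have key : ∀ v, Inter (B := B) K₁ K₂ v →
      (cA.prod (sw.conf.prod cC)).evs v ⊆ (cA.prod (sw.conf.prod cC)).evs (x', y', z') →
      (cA.prod (sw.conf.prod cC)).Chain (Inter (B := B) K₁ K₂) v (x', y', z') := by
    intro v
    induction v using (cA.prod (sw.conf.prod cC)).step_wf.induction with
    | _ v ih =>
      intro hv hle
      by_cases heq : v = (x', y', z')
      · rw [heq]; exact .refl
      · obtain ⟨x, y, z⟩ := v
        have hle' := Conf.prod_subset.1 hle
        have hle'' := Conf.prod_subset.1 hle'.2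
        obtain ⟨a, v', h3, h4, h5⟩ := sw.interaction_step hBf h₁ h₂ hv hle'.1 hle''.1 hle''.2 heq
        exact .head ⟨hv, h4, a, h3⟩ (ih v' ⟨a, h3⟩ h4 h5)
  refine key _ ⟨h₁.init, h₂.init⟩ ?_
  have := (cA.prod (sw.conf.prod cC)).evs_init
  rw [show (cA.prod (sw.conf.prod cC)).evs (A.init, B.init, C.init) = ∅ from this]
  exact Set.empty_subset _

end SwConf

end AsyncConc

/-! ### Projections of interactions and determinism -/

namespace AsyncConc
open AsyncGame

namespace AsyncGame.Conf

/-- The map `f` on positions is the projection onto the events in the image of `j`. -/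
structure Proj {G H : AsyncGame} (c : Conf G) (d : Conf H) (f : G.V → H.V) (j : d.Ev → c.Ev) :
    Prop where
  inj : Function.Injective j
  mem : ∀ v a, a ∈ d.evs (f v) ↔ j a ∈ c.evs v

namespace Proj

variable {G H : AsyncGame} {c : Conf G} {d : Conf H} {f : G.V → H.V} {j : d.Ev → c.Ev}

theorem subset (h : c.Proj d f j) {v w : G.V} (hvw : c.evs v ⊆ c.evs w) :
    d.evs (f v) ⊆ d.evs (f w) :=
  fun a ha => (h.mem w a).2 (hvw ((h.mem v a).1 ha))

theorem step (h : c.Proj d f j) {v w : G.V} {a : d.Ev} (hs : c.Step v (j a) w) :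
    d.Step (f v) a (f w) := by
  refine ⟨fun ha => hs.1 ((h.mem v a).1 ha), Set.ext fun b => ?_⟩
  rw [h.mem, hs.mem_iff, Set.mem_insert_iff, h.mem, h.inj.eq_iff]

theorem eq_of_step (h : c.Proj d f j) {v w : G.V} {a : c.Ev} (hs : c.Step v a w)
    (ha : ∀ b, j b ≠ a) : f w = f v := by
  refine d.evs_injective (Set.ext fun b => ?_)
  rw [h.mem, hs.mem_iff, h.mem]
  exact ⟨fun h => h.resolve_left (ha b), .inr⟩

theorem inter (h : c.Proj d f j) {u v w : G.V} (hu : c.evs u = c.evs v ∩ c.evs w) :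
    d.evs (f u) = d.evs (f v) ∩ d.evs (f w) := by
  ext b
  rw [Set.mem_inter_iff, h.mem, h.mem, h.mem, hu]
  exact Iff.rfl

/-- If one of the two events is invisible, the fourth corner has the same projection as `v₁` or
`v₂`. -/
theorem resClosed (h : c.Proj d f j) {K : H.V → Prop} (hK : d.ResClosed K) :
    c.ResClosed fun v => K (f v) := by
  intro v a b v₁ v₂ w hv ha hb h₁ h₂ hw
  by_cases ha' : ∃ a', j a' = a
  · by_cases hb' : ∃ b', j b' = b
    · obtain ⟨a, rfl⟩ := ha'
      obtain ⟨b, rfl⟩ := hb'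
      exact hK _ a b _ _ _ hv (h.step ha) (h.step hb) h₁ h₂ (h.step hw)
    · rw [h.eq_of_step hw fun b h => hb' ⟨b, h⟩]
      exact h₁
  · rw [h.eq_of_step (ha.swap hb hw) fun b h => ha' ⟨b, h⟩]
    exact h₂

theorem interClosed (h : c.Proj d f j) {K : H.V → Prop} (hK : d.InterClosed K) :
    c.InterClosed fun v => K (f v) :=
  fun _ _ _ hv hw hu => hK _ _ _ hv hw (h.inter hu)

theorem chain (h : c.Proj d f j) {K : G.V → Prop} {K' : H.V → Prop} (hK : ∀ u, K u → K' (f u))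
    {v w : G.V} (hc : c.Chain K v w) : d.Chain K' (f v) (f w) := by
  induction hc with
  | refl => exact .refl
  | tail _ h2 ih =>
    obtain ⟨h3, h4, a, ha⟩ := h2
    by_cases ha' : ∃ a', j a' = a
    · obtain ⟨a, rfl⟩ := ha'
      exact .tail ih ⟨hK _ h3, hK _ h4, a, h.step ha⟩
    · rw [h.eq_of_step ha fun b h => ha' ⟨b, h⟩]
      exact ih

end Proj

section

variable {A B C : AsyncGame} (a : Conf A) (b : Conf B) (c : Conf C)

theorem proj_left_mid : (a.prod (b.prod c)).Proj (a.prod b) (fun v => (v.1, v.2.1))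
    (Sum.map id Sum.inl) where
  inj := Sum.map_injective.2 ⟨Function.injective_id, Sum.inl_injective⟩
  mem := by rintro v (e | e) <;> exact Iff.rfl

theorem proj_mid_right : (a.prod (b.prod c)).Proj (b.dual.prod c) (fun v => v.2) Sum.inr where
  inj := Sum.inr_injective
  mem := by rintro v (e | e) <;> exact Iff.rfl

theorem proj_left_right : (a.prod (b.prod c)).Proj (a.prod c) (fun v => (v.1, v.2.2))
    (Sum.map id Sum.inr) where
  inj := Sum.map_injective.2 ⟨Function.injective_id, Sum.inr_injective⟩
  mem := by rintro v (e | e) <;> exact Iff.rfl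

end

/-- The event `a` is deterministic in `K`: it stays available after any other event. -/
def DetIn {G : AsyncGame} (c : Conf G) (K : G.V → Prop) (a : c.Ev) : Prop :=
  ∀ v b v₁ v₂, K v → c.Step v a v₁ → c.Step v b v₂ → K v₁ → K v₂ → a ≠ b →
    ∃ u, c.Step v₁ b u ∧ K u

/-- The events leading to `v` are pushed one by one along the chain to `q`; determinism replaces a
common bound. -/
theorem Chain.extend {G : AsyncGame} {c : Conf G} {K : G.V → Prop} (hK : c.ResClosed K)
    {m v q : G.V} (hv : c.Chain K m v) (hq : c.Chain K m q)
    (hd : ∀ a ∈ c.evs v, a ∉ c.evs m → c.DetIn K a) :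
    ∃ q', c.Chain K q q' ∧ c.Chain K v q' ∧ c.evs q' ⊆ c.evs q ∪ c.evs v := by
  induction hv using Relation.ReflTransGen.head_induction_on generalizing q with
  | refl => exact ⟨q, .refl, hq, Set.subset_union_left⟩
  | head h1 h2 ih =>
    obtain ⟨h3, h4, a, ha⟩ := h1
    have hav : a ∈ c.evs v := Chain.subset h2 ha.mem
    have hd' : ∀ b ∈ c.evs v, b ∉ c.evs _ → c.DetIn K b :=
      fun b hb hb' => hd b hb fun h => hb' (ha.subset h)
    rcases hq.push (hd a hav ha.1) ha h4 with h5 | ⟨q₁, h5, h6, h7⟩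
    · exact ih (hq.front hK ha h4 (ha.subset_of hq.subset h5)) hd'
    · obtain ⟨q', h8, h9, h10⟩ := ih h7 hd'
      refine ⟨q', .head ⟨Chain.right hq h3, h6, a, h5⟩ h8, h9, fun b hb => ?_⟩
      rcases h10 hb with h | h
      · rcases (h5.mem_iff b).1 h with rfl | h
        · exact .inr hav
        · exact .inl h
      · exact .inr h

theorem Step.prod_diamond {G H : AsyncGame} {c : Conf G} {d : Conf H} {v v₁ v₂ : (G.prod H).V}
    {a : c.Ev} {b : d.Ev} (ha : (c.prod d).Step v (.inl a) v₁)
    (hb : (c.prod d).Step v (.inr b) v₂) :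
    ∃ u, (c.prod d).Step v₁ (.inr b) u ∧ (c.prod d).Step v₂ (.inl a) u := by
  obtain ⟨x, y⟩ := v
  obtain ⟨x₁, y₁⟩ := v₁
  obtain ⟨x₂, y₂⟩ := v₂
  obtain ⟨h1, rfl⟩ := step_prod_inl.1 ha
  obtain ⟨rfl, h2⟩ := step_prod_inr.1 hb
  exact ⟨(x₁, y₂), h2.prod_right _, h1.prod_left _⟩

end AsyncGame.Conf

/-- The positions of the composite. -/
def Visible {A B C : AsyncGame} (K₁ : (A.prod B).V → Prop) (K₂ : (B.dual.prod C).V → Prop)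
    (v : (A.prod C).V) : Prop :=
  ∃ y, Inter K₁ K₂ (v.1, y, v.2)

/-- Two sets of positions of ingenuous strategies which interact without deadlocks. -/
structure Interacts {A B C : AsyncGame} (a : Conf A) (b : Conf B) (c : Conf C)
    (K₁ : (A.prod B).V → Prop) (K₂ : (B.dual.prod C).V → Prop) : Prop where
  left : (a.prod b).Fam K₁
  right : (b.dual.prod c).Fam K₂
  chain : ∀ v, Inter K₁ K₂ v →
    (a.prod (b.prod c)).Chain (Inter K₁ K₂) (A.init, B.init, C.init) v

namespace Interacts

variable {A B C : AsyncGame} {a : Conf A} {b : Conf B} {c : Conf C} {K₁ : (A.prod B).V → Prop}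
  {K₂ : (B.dual.prod C).V → Prop}

theorem res (h : Interacts a b c K₁ K₂) : (a.prod (b.prod c)).ResClosed (Inter K₁ K₂) :=
  fun _ _ _ _ _ _ hv ha hb h₁ h₂ hw =>
    ⟨(Conf.proj_left_mid a b c).resClosed h.left.res _ _ _ _ _ _ hv.1 ha hb h₁.1 h₂.1 hw,
      (Conf.proj_mid_right a b c).resClosed h.right.res _ _ _ _ _ _ hv.2 ha hb h₁.2 h₂.2 hw⟩

theorem inter (h : Interacts a b c K₁ K₂) : (a.prod (b.prod c)).InterClosed (Inter K₁ K₂) :=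
  fun _ _ _ hv hw hu =>
    ⟨(Conf.proj_left_mid a b c).interClosed h.left.inter _ _ _ hv.1 hw.1 hu,
      (Conf.proj_mid_right a b c).interClosed h.right.inter _ _ _ hv.2 hw.2 hu⟩

theorem chain_of_subset (h : Interacts a b c K₁ K₂) {v w : (A.prod (B.prod C)).V}
    (hv : Inter K₁ K₂ v) (hw : Inter K₁ K₂ w)
    (hvw : (a.prod (b.prod c)).evs v ⊆ (a.prod (b.prod c)).evs w) :
    (a.prod (b.prod c)).Chain (Inter K₁ K₂) v w :=
  (h.chain v hv).of_subset h.res (h.chain w hw) hvw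

/-- All events are deterministic in an interaction, but for the visible Opponent moves. -/
theorem detIn (h : Interacts a b c K₁ K₂) {e : (a.prod (b.prod c)).Ev}
    (hl : ∀ e', e = .inl e' → a.polEv e' = .P) (hr : ∀ e', e = .inr (.inr e') → c.polEv e' = .P) :
    (a.prod (b.prod c)).DetIn (Inter K₁ K₂) e := by
  intro v e' v₁ v₂ hv hs hs' h₁ h₂ hne
  suffices hu : ∃ u, (a.prod (b.prod c)).Step v₁ e' u by
    obtain ⟨u, hu⟩ := hu
    exact ⟨u, hu, h.res _ _ _ _ _ _ hv hs hs' h₁ h₂ hu⟩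
  have p₁ := Conf.proj_left_mid a b c
  have p₂ := Conf.proj_mid_right a b c
  obtain ⟨x₁, w₁⟩ := v₁
  obtain ⟨x₂, w₂⟩ := v₂
  obtain ⟨x, w⟩ := v
  rcases e with e | e <;> rcases e' with e' | e'
  · obtain ⟨⟨u, y⟩, hu, -⟩ := h.left.det hv.1 (p₁.step (a := .inl e) hs)
      (p₁.step (a := .inl e') hs') h₁.1 h₂.1 (fun h => hne (congrArg Sum.inl (Sum.inl.inj h)))
      (hl e rfl)
    exact ⟨(u, w₁), (Conf.step_prod_inl.1 hu).1.prod_left _⟩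
  · obtain ⟨u, hu, -⟩ := hs.prod_diamond hs'
    exact ⟨u, hu⟩
  · obtain ⟨u, -, hu⟩ := hs'.prod_diamond hs
    exact ⟨u, hu⟩
  · suffices hu : ∃ u, (b.prod c).Step w₁ e' u by
      obtain ⟨u, hu⟩ := hu
      exact ⟨_, hu.prod_right x₁⟩
    have hs₂ := (Conf.step_prod_inr.1 hs).2
    have hs₂' := (Conf.step_prod_inr.1 hs').2
    have hright : (b.dual.prod c).polEv e = .P → ∃ u, (b.prod c).Step w₁ e' u := fun hP => by
      obtain ⟨u, hu, -⟩ := h.right.det hv.2 (p₂.step (a := e) hs) (p₂.step (a := e') hs') h₁.2 h₂.2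
        (fun h => hne (congrArg Sum.inr h)) hP
      exact ⟨u, hu⟩
    rcases e with e | e <;> rcases e' with e' | e'
    -- A hidden event is Proponent for one of the two strategies, and the determinism of that one
    -- applies.
    · cases hp : b.polEv e with
      | O => exact hright (congrArg Polarity.opp hp)
      | P =>
        obtain ⟨⟨x, u⟩, hu, -⟩ := h.left.det hv.1 (p₁.step (a := .inr e) hs)
          (p₁.step (a := .inr e') hs') h₁.1 h₂.1
          (fun h => hne (congrArg (fun e => Sum.inr (Sum.inl e)) (Sum.inr.inj h))) hp
        exact ⟨(u, w₁.2), (Conf.step_prod_inr.1 hu).2.prod_left w₁.2⟩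
    · obtain ⟨u, hu, -⟩ := hs₂.prod_diamond hs₂'
      exact ⟨u, hu⟩
    · obtain ⟨u, -, hu⟩ := hs₂'.prod_diamond hs₂
      exact ⟨u, hu⟩
    · exact hright (hr e rfl)

end Interacts
end AsyncConc

/-! ### Visible positions of the composite -/

namespace AsyncConc
open AsyncGame

namespace Interacts

variable {A B C : AsyncGame} {a : Conf A} {b : Conf B} {c : Conf C} {K₁ : (A.prod B).V → Prop}
  {K₂ : (B.dual.prod C).V → Prop} {x x' : A.V} {y y' y₁ : B.V} {z z' : C.V}

theorem detIn_mid (h : Interacts a b c K₁ K₂) (e : b.Ev) :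
    (a.prod (b.prod c)).DetIn (Inter K₁ K₂) (.inr (.inl e)) :=
  h.detIn (fun _ h => nomatch h) fun _ h => nomatch Sum.inr.inj h

theorem subset_iff : (a.prod (b.prod c)).evs (x, y, z) ⊆ (a.prod (b.prod c)).evs (x', y', z') ↔
    a.evs x ⊆ a.evs x' ∧ b.evs y ⊆ b.evs y' ∧ c.evs z ⊆ c.evs z' :=
  Conf.prod_subset.trans (and_congr Iff.rfl Conf.prod_subset)

/-- Hidden events are deterministic, so those that lead from `y` to `y₁` can be added to any later
interaction. -/
theorem extend (h : Interacts a b c K₁ K₂) (hm : Inter K₁ K₂ (x, y, z))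
    (hv : Inter K₁ K₂ (x, y₁, z)) (hq : Inter K₁ K₂ (x', y', z')) (hy₁ : b.evs y ⊆ b.evs y₁)
    (hx : a.evs x ⊆ a.evs x') (hy : b.evs y ⊆ b.evs y') (hz : c.evs z ⊆ c.evs z') :
    ∃ y'', Inter K₁ K₂ (x', y'', z') ∧ b.evs y'' = b.evs y' ∪ b.evs y₁ := by
  obtain ⟨⟨x'', y'', z''⟩, h1, h2, h3⟩ := Conf.Chain.extend h.res
    (h.chain_of_subset hm hv (subset_iff.2 ⟨subset_rfl, hy₁, subset_rfl⟩))
    (h.chain_of_subset hm hq (subset_iff.2 ⟨hx, hy, hz⟩)) fun e he he' => by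
      rcases e with e | e | e
      · exact absurd he he'
      · exact h.detIn_mid e
      · exact absurd he he'
  obtain ⟨k1, k2, k3⟩ := subset_iff.1 h1.subset
  obtain ⟨-, k4, -⟩ := subset_iff.1 h2.subset
  obtain rfl : x' = x'' := a.evs_injective (k1.antisymm fun e he =>
    (h3 (a := .inl e) he).elim id fun h => hx h)
  obtain rfl : z' = z'' := c.evs_injective (k3.antisymm fun e he =>
    (h3 (a := .inr (.inr e)) he).elim id fun h => hz h)
  exact ⟨y'', h1.right hq, Set.Subset.antisymm (fun e he => h3 (a := .inr (.inl e)) he)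
    (Set.union_subset k2 k4)⟩

/-- The meet of the two interactions has visible part `(x, z)`, so it differs from the first one by
hidden events only, which are then added to the second one. -/
theorem confluence (h : Interacts a b c K₁ K₂) (hv : Inter K₁ K₂ (x, y, z))
    (hw : Inter K₁ K₂ (x', y', z')) (hx : a.evs x ⊆ a.evs x') (hz : c.evs z ⊆ c.evs z') :
    ∃ y'', Inter K₁ K₂ (x', y'', z') ∧ b.evs y'' = b.evs y' ∪ b.evs y := by
  obtain ⟨u, hu⟩ := b.inter y y'
  have hm : Inter K₁ K₂ (x, u, z) := by
    refine h.inter _ _ _ hv hw (Conf.prod_evs_eq_inter ?_ (Conf.prod_evs_eq_inter hu ?_))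
    · exact (Set.inter_eq_left.2 hx).symm
    · exact (Set.inter_eq_left.2 hz).symm
  exact h.extend hm hv hw (hu.le.trans Set.inter_subset_left) hx
    (hu.le.trans Set.inter_subset_right) hz

/-- A visible step of the composite is a step of some interaction. -/
theorem exists_common (h : Interacts a b c K₁ K₂) (hv : Inter K₁ K₂ (x, y, z))
    (hw : Visible K₁ K₂ (x', z')) {e : (a.prod c).Ev} (he : (a.prod c).Step (x, z) e (x', z')) :
    ∃ y₁, b.evs y ⊆ b.evs y₁ ∧ Inter K₁ K₂ (x, y₁, z) ∧ Inter K₁ K₂ (x', y₁, z') := by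
  obtain ⟨y', hw⟩ := hw
  have hsub := Conf.prod_subset.1 he.subset
  -- A chain to the merged interaction makes hidden moves and the single visible move `e`; the
  -- hidden position reached just before `e` is the common one.
  obtain ⟨w, hw', hwe⟩ := h.confluence hv hw hsub.1 hsub.2
  have p := Conf.proj_left_right a b c
  have hc := h.chain_of_subset hv hw' (subset_iff.2
    ⟨hsub.1, hwe.ge.trans' Set.subset_union_right, hsub.2⟩)
  clear hwe hw hsub
  generalize hq : ((x', w, z') : (A.prod (B.prod C)).V) = q at hc
  generalize hu : ((x, y, z) : (A.prod (B.prod C)).V) = u at hc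
  induction hc using Relation.ReflTransGen.head_induction_on generalizing y with
  | refl =>
    subst hq
    cases hu
    exact absurd he.mem he.1
  | @head u u' h1 h2 ih =>
    subst hq hu
    obtain ⟨h3, h4, f, hf⟩ := h1
    obtain ⟨x₁, y₁, z₁⟩ := u'
    have hvis : ∀ g : (a.prod c).Ev, Sum.map id Sum.inr g = f → y₁ = y →
        Inter K₁ K₂ (x', y, z') := by
      rintro g rfl rfl
      have h5 := p.step hf
      have h6 : g = e := ((he.mem_iff g).1 (p.subset (Conf.Chain.subset h2) h5.mem)).resolve_right
        h5.1
      subst h6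
      obtain ⟨rfl, rfl⟩ := Prod.mk.inj (he.unique h5)
      exact h4
    rcases f with f | f | f
    · exact ⟨y, subset_rfl, hv, hvis (.inl f) rfl (Prod.mk.inj (Conf.step_prod_inl.1 hf).2).1⟩
    · obtain ⟨rfl, hf₂⟩ := Conf.step_prod_inr.1 hf
      obtain ⟨hf₃, rfl⟩ := Conf.step_prod_inl.1 hf₂
      obtain ⟨y₂, h5, h6⟩ := ih h4 rfl
      exact ⟨y₂, hf₃.subset.trans h5, h6⟩
    · exact ⟨y, subset_rfl, hv,
        hvis (.inr f) rfl (Conf.step_prod_inr.1 (Conf.step_prod_inr.1 hf).2).1⟩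

theorem lift_step {e : (a.prod c).Ev} (he : (a.prod c).Step (x, z) e (x', z')) (y : B.V) :
    (a.prod (b.prod c)).Step (x, y, z) (Sum.map id Sum.inr e) (x', y, z') := by
  rcases e with e | e
  · obtain ⟨h1, rfl⟩ := Conf.step_prod_inl.1 he
    exact h1.prod_left _
  · obtain ⟨rfl, h1⟩ := Conf.step_prod_inr.1 he
    exact (h1.prod_right y).prod_right _

/-- The hidden moves needed for the second step are added, by `extend`, to the interaction in which
the first step has been made. -/
theorem exists_common₂ (h : Interacts a b c K₁ K₂) {v v₁ v₂ : (A.prod C).V}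
    {e₁ e₂ : (a.prod c).Ev} (hv : Visible K₁ K₂ v) (h₁ : Visible K₁ K₂ v₁)
    (h₂ : Visible K₁ K₂ v₂) (he₁ : (a.prod c).Step v e₁ v₁) (he₂ : (a.prod c).Step v e₂ v₂) :
    ∃ y, Inter K₁ K₂ (v.1, y, v.2) ∧ Inter K₁ K₂ (v₁.1, y, v₁.2) ∧
      Inter K₁ K₂ (v₂.1, y, v₂.2) := by
  obtain ⟨y, hv⟩ := hv
  obtain ⟨y₁, -, hv, h₁⟩ := h.exists_common hv h₁ he₁
  obtain ⟨y₂, hy₂, hv₂, h₂⟩ := h.exists_common hv h₂ he₂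
  have hsub := Conf.prod_subset.1 he₁.subset
  obtain ⟨y₃, h₃, he⟩ := h.extend hv hv₂ h₁ hy₂ hsub.1 subset_rfl hsub.2
  rw [Set.union_eq_self_of_subset_left hy₂] at he
  obtain rfl := b.evs_injective he
  exact ⟨y₃, hv₂, h₃, h₂⟩

/-- Courtesy, for interactions. -/
theorem court_inter (h : Interacts a b c K₁ K₂) {v v₁ v₂ w : (A.prod (B.prod C)).V}
    {e : (a.prod c).Ev} {f : (a.prod (b.prod c)).Ev} (hv : Inter K₁ K₂ v)
    (he : (a.prod (b.prod c)).Step v (Sum.map id Sum.inr e) v₁)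
    (hf : (a.prod (b.prod c)).Step v f v₂) (hw : (a.prod (b.prod c)).Step v₁ f w)
    (h₁ : Inter K₁ K₂ v₁) (hKw : Inter K₁ K₂ w) (hP : (a.prod c).polEv e = .P) :
    Inter K₁ K₂ v₂ := by
  have p₁ := Conf.proj_left_mid a b c
  have p₂ := Conf.proj_mid_right a b c
  have hw' := he.swap hf hw
  rcases e with e | e
  · refine ⟨?_, ?_⟩
    · by_cases hf' : ∃ f', Sum.map id Sum.inl f' = f
      · obtain ⟨f, rfl⟩ := hf'
        exact h.left.court hv.1 (p₁.step (a := .inl e) he) (p₁.step hf) (p₁.step hw) h₁.1 hKw.1 hP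
      · have := p₁.eq_of_step hf fun g hg => hf' ⟨g, hg⟩
        exact this ▸ hv.1
    · have := p₂.eq_of_step hw' fun g hg => nomatch hg
      exact this ▸ hKw.2
  · refine ⟨?_, ?_⟩
    · have := p₁.eq_of_step hw' fun g hg => by
        rcases g with g | g
        · cases hg
        · cases Sum.inr.inj hg
      exact this ▸ hKw.1
    · by_cases hf' : ∃ f', Sum.inr f' = f
      · obtain ⟨f, rfl⟩ := hf'
        exact h.right.court hv.2 (p₂.step (a := .inr e) he) (p₂.step hf) (p₂.step hw) h₁.2 hKw.2 hP
      · have := p₂.eq_of_step hf fun g hg => hf' ⟨g, hg⟩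
        exact this ▸ hv.2

/-- The interaction may need hidden moves between `e` and `f`. Courtesy moves each of them before
`e`, and can then be applied to `f` itself. -/
theorem court (h : Interacts a b c K₁ K₂) {v v₁ v₂ w : (A.prod C).V} {e f : (a.prod c).Ev}
    (hv : Visible K₁ K₂ v) (he : (a.prod c).Step v e v₁) (hf : (a.prod c).Step v f v₂)
    (hw : (a.prod c).Step v₁ f w) (h₁ : Visible K₁ K₂ v₁) (hKw : Visible K₁ K₂ w)
    (hP : (a.prod c).polEv e = .P) : Visible K₁ K₂ v₂ := by
  obtain ⟨y, hv⟩ := hv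
  obtain ⟨y, -, hv, h₁⟩ := h.exists_common hv h₁ he
  obtain ⟨y', hy', h₁', hKw⟩ := h.exists_common h₁ hKw hw
  have hv' : Inter K₁ K₂ (v.1, y', v.2) := by
    have hc := h.chain_of_subset h₁ h₁' (subset_iff.2 ⟨subset_rfl, hy', subset_rfl⟩)
    clear hKw h₁'
    generalize hu : ((v₁.1, y', v₁.2) : (A.prod (B.prod C)).V) = u at hc
    induction hc generalizing y' with
    | refl => cases hu; exact hv
    | @tail u u' h1 h2 ih =>
      obtain ⟨h3, h4, g, hg⟩ := h2
      obtain ⟨x₁, y₁, z₁⟩ := u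
      subst hu
      have s1 := subset_iff.1 (Conf.Chain.subset h1)
      have s2 := subset_iff.1 hg.subset
      obtain rfl := a.evs_injective (s1.1.antisymm s2.1)
      obtain rfl := c.evs_injective (s1.2.2.antisymm s2.2.2)
      rcases g with g | g | g
      · exact absurd (hg.mem : g ∈ a.evs v₁.1) hg.1
      · obtain ⟨-, hg'⟩ := Conf.step_prod_inr.1 hg
        obtain ⟨hg', -⟩ := Conf.step_prod_inl.1 hg'
        exact h.court_inter (ih _ s1.2.1 rfl) (lift_step he y₁)
          ((hg'.prod_left _).prod_right _) hg h3 h4 hP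
      · exact absurd (hg.mem : g ∈ c.evs v₁.2) hg.1
  exact ⟨y', h.court_inter hv' (lift_step he y') (lift_step hf y') (lift_step hw y') h₁' hKw hP⟩

/-- The properties of the composite, except for totality. -/
theorem fam (h : Interacts a b c K₁ K₂)
    (htotal : ∀ {v}, Visible K₁ K₂ v → (∀ e w, (a.prod c).Step v e w → (a.prod c).polEv e ≠ .O) →
      (∀ e w, ¬ (a.prod c).Step v e w) ∨
        ∃ e w, (a.prod c).Step v e w ∧ (a.prod c).polEv e = .P ∧ Visible K₁ K₂ w) :
    (a.prod c).Fam (Visible K₁ K₂) where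
  init := ⟨B.init, h.left.init, h.right.init⟩
  chain := by
    rintro v ⟨y, hv⟩
    exact (Conf.proj_left_right a b c).chain (fun u hu => ⟨u.2.1, hu⟩) (h.chain _ hv)
  det := by
    intro v e f v₁ v₂ hv he hf h₁ h₂ hne hP
    obtain ⟨y, hv, h₁, h₂⟩ := h.exists_common₂ hv h₁ h₂ he hf
    have p := Conf.proj_left_right a b c
    obtain ⟨u, hu, hK⟩ := h.detIn (e := Sum.map id Sum.inr e) (fun e' he' => by
        rcases e with e | e
        · cases he'; exact hP
        · cases he') (fun e' he' => by
        rcases e with e | e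
        · cases he'
        · cases he'; exact hP) _ _ _ _ hv (lift_step he y) (lift_step hf y) h₁ h₂
        fun h => hne (p.inj h)
    exact ⟨_, p.step hu, u.2.1, hK⟩
  recep := by
    rintro v e w ⟨y, hv⟩ he hO
    rcases e with e | e
    · obtain ⟨x, z⟩ := v
      obtain ⟨x', z'⟩ := w
      obtain ⟨h1, rfl⟩ := Conf.step_prod_inl.1 he
      exact ⟨y, h.left.recep hv.1 (h1.prod_left y) hO, hv.2⟩
    · obtain ⟨x, z⟩ := v
      obtain ⟨x', z'⟩ := w
      obtain ⟨rfl, h1⟩ := Conf.step_prod_inr.1 he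
      exact ⟨y, hv.1, h.right.recep hv.2 (h1.prod_right y) hO⟩
  total := htotal
  court := h.court
  res := by
    intro v e f v₁ v₂ w hv he hf h₁ h₂ hw
    obtain ⟨y, hv, h₁, h₂⟩ := h.exists_common₂ hv h₁ h₂ he hf
    exact ⟨y, h.res _ _ _ _ _ _ hv (lift_step he y) (lift_step hf y) h₁ h₂ (lift_step hw y)⟩
  inter := by
    rintro u v w ⟨y, hv⟩ ⟨y', hw⟩ hu
    obtain ⟨y'', hy⟩ := b.inter y y'
    obtain ⟨h1, h2⟩ := Conf.prod_evs_inter hu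
    exact ⟨y'', h.inter _ _ _ hv hw (Conf.prod_evs_eq_inter h1 (Conf.prod_evs_eq_inter hy h2))⟩

end Interacts
end AsyncConc

/-! ### Halting positions and totality of the composite -/

namespace AsyncConc
open AsyncGame

namespace AsyncGame.Conf

variable {G : AsyncGame} {c : Conf G}

/-- The positions of `K` from which no Proponent step inside `K` starts. -/
def Halt (c : Conf G) (K : G.V → Prop) (v : G.V) : Prop :=
  K v ∧ ∀ e w, c.Step v e w → K w → c.polEv e ≠ .P

/-- Opponent moves are always received, and when there are none totality gives a Proponent move
unless the game is over; no play is infinite. -/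
theorem Fam.exists_terminal {K : G.V → Prop} (hK : c.Fam K) {v : G.V} (hv : K v) :
    ∃ w, c.Chain K v w ∧ K w ∧ ∀ e u, ¬ c.Step w e u := by
  induction v using c.step_wf.induction with
  | _ v ih =>
    have next : ∀ {e w}, c.Step v e w → K w → ∃ w, c.Chain K v w ∧ K w ∧ ∀ e u, ¬ c.Step w e u := by
      intro e w he hw
      obtain ⟨u, h1, h2⟩ := ih w ⟨e, he⟩ hw
      exact ⟨u, .head ⟨hv, hw, e, he⟩ h1, h2⟩
    by_cases hO : ∃ e w, c.Step v e w ∧ c.polEv e = .O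
    · obtain ⟨e, w, he, hp⟩ := hO
      exact next he (hK.recep hv he hp)
    · rcases hK.total hv fun e w he hp => hO ⟨e, w, he, hp⟩ with h | ⟨e, w, he, -, hw⟩
      · exact ⟨v, .refl, hv, h⟩
      · exact next he hw

/-- A transition which is enabled below a maximal position is in it, or in conflict with one of its
transitions. -/
theorem exists_conflict (c : Conf G) {y w : G.V} (hyw : c.evs y ⊆ c.evs w)
    (hw : ∀ e u, ¬ c.Step w e u) {e : G.E} (he : G.src e = y) :
    ∃ i : c.Enabled y w, e = i.1 ∨ ¬ ∃ p q, G.tile e p i.1 q := by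
  subst he
  -- An occurrence `e₁` of the event of `e` is carried along the path to `w` as long as tiles exist;
  -- a conflict met on the way is brought back to the source of `e` by `conflict_enabled`.
  have key : ∀ (t : List G.E) (e₁ : G.E), c.evs (G.src e) ⊆ c.evs (G.src e₁) → c.ev e = c.ev e₁ →
      G.Path (G.src e₁) t w → ∃ i : c.Enabled (G.src e) w, e = i.1 ∨ ¬ ∃ p q, G.tile e p i.1 q := by
    intro t
    induction t with
    | nil =>
      intro e₁ h1 h2 h3
      exact absurd ((show G.src e₁ = w from h3) ▸ step_edge e₁) (hw _ _)
    | cons f t ih =>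
      rintro e₁ h1 h2 ⟨h3, h4⟩
      have hf : c.ev f ∈ c.evs w := c.evs_mono_path h4 (c.ev_mem_tgt f)
      by_cases hef : e₁ = f
      · subst hef
        exact ⟨⟨e, rfl, (step_edge e).subset_of hyw (h2 ▸ hf)⟩, .inl rfl⟩
      · by_cases ht : ∃ p q, G.tile e₁ p f q
        · obtain ⟨p, q, ht⟩ := ht
          obtain ⟨-, -, h5, -⟩ := G.tile_bound ht
          refine ih q ?_ (h2.trans (c.tile_ev ht).1) (h5 ▸ h4)
          rw [← h5]
          exact (h1.trans (congrArg c.evs h3).ge).trans (c.src_subset_tgt f)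
        · obtain ⟨e₃, h5, h6, h7⟩ := c.conflict_enabled h1 h2 h3.symm ht
          refine ⟨⟨e₃, h5, (step_edge e₃).subset_of (h5 ▸ hyw) (h6 ▸ hf)⟩, .inr h7⟩
  obtain ⟨t, ht⟩ := c.reach_of_subset hyw
  exact key t e subset_rfl rfl ht

end AsyncGame.Conf

namespace Interacts

variable {A B C : AsyncGame} {a : Conf A} {b : Conf B} {c : Conf C} {K₁ : (A.prod B).V → Prop}
  {K₂ : (B.dual.prod C).V → Prop} {x : A.V} {y y₁ : B.V} {z : C.V}

/-- Hidden dialogues are finite, so they can be carried on until no hidden move is left. -/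
theorem exists_maximal (hv : Inter K₁ K₂ (x, y, z)) :
    ∃ y', b.evs y ⊆ b.evs y' ∧ Inter K₁ K₂ (x, y', z) ∧
      ∀ e y₁, b.Step y' e y₁ → ¬ Inter K₁ K₂ (x, y₁, z) := by
  induction y using b.step_wf.induction with
  | _ y ih =>
    by_cases h : ∃ e y₁, b.Step y e y₁ ∧ Inter K₁ K₂ (x, y₁, z)
    · obtain ⟨e, y₁, h1, h2⟩ := h
      obtain ⟨y', h3, h4⟩ := ih y₁ ⟨e, h1⟩ h2
      exact ⟨y', h1.subset.trans h3, h4⟩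
    · exact ⟨y, subset_rfl, hv, fun e y₁ h1 h2 => h ⟨e, y₁, h1, h2⟩⟩

/-- A move that is Proponent for the first strategy is received by the second one, so it would be a
step of the interaction. -/
theorem pol_left (h : Interacts a b c K₁ K₂) (hv : Inter K₁ K₂ (x, y, z)) {e : b.Ev}
    (he : b.Step y e y₁) (hno : ¬ Inter K₁ K₂ (x, y₁, z)) (hK : K₁ (x, y₁)) : b.polEv e = .O := by
  cases hp : b.polEv e with
  | O => rfl
  | P =>
    exact absurd ⟨hK, h.right.recep hv.2 (Conf.Step.prod_left (c := b.dual) he z)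
      (congrArg Polarity.opp hp)⟩ hno

theorem pol_right (h : Interacts a b c K₁ K₂) (hv : Inter K₁ K₂ (x, y, z)) {e : b.Ev}
    (he : b.Step y e y₁) (hno : ¬ Inter K₁ K₂ (x, y₁, z)) (hK : K₂ (y₁, z)) : b.polEv e = .P := by
  cases hp : b.polEv e with
  | P => rfl
  | O => exact absurd ⟨h.left.recep hv.1 (he.prod_right x) hp, hK⟩ hno

/-- When hidden moves are exhausted, a Proponent move of either strategy would be visible.
Conversely, a hidden move is Proponent for one of the strategies; if both halt there is none, and a
visible Proponent move would belong to a strategy that halts. -/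
theorem halt_iff (h : Interacts a b c K₁ K₂) :
    (a.prod c).Halt (Visible K₁ K₂) (x, z) ↔
      ∃ y, (a.prod b).Halt K₁ (x, y) ∧ (b.dual.prod c).Halt K₂ (y, z) := by
  constructor
  · rintro ⟨⟨y, hv⟩, hno⟩
    obtain ⟨y, -, hv, hmax⟩ := exists_maximal (b := b) hv
    refine ⟨y, ⟨hv.1, ?_⟩, hv.2, ?_⟩
    · rintro (e | e) ⟨x', y'⟩ he hw hP
      · obtain ⟨he', rfl⟩ := Conf.step_prod_inl.1 he
        exact hno _ (x', z) (he'.prod_left z) ⟨y', hw, hv.2⟩ hP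
      · obtain ⟨rfl, he'⟩ := Conf.step_prod_inr.1 he
        exact nomatch hP.symm.trans (h.pol_left hv he' (hmax _ _ he') hw)
    · rintro (e | e) ⟨y', z'⟩ he hw hP
      · obtain ⟨he', rfl⟩ := Conf.step_prod_inl.1 he
        have := h.pol_right hv he' (hmax _ _ he') hw
        exact nomatch hP.symm.trans (congrArg Polarity.opp this)
      · obtain ⟨rfl, he'⟩ := Conf.step_prod_inr.1 he
        exact hno _ (x, z') (he'.prod_right x) ⟨y', hv.1, hw⟩ hP
  · rintro ⟨y, ⟨h1, h2⟩, h3, h4⟩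
    have hv : Inter K₁ K₂ (x, y, z) := ⟨h1, h3⟩
    refine ⟨⟨y, hv⟩, ?_⟩
    rintro e ⟨x', z'⟩ he hw hP
    obtain ⟨y₁, hy₁, hv₁, hw⟩ := h.exists_common hv hw he
    rcases Relation.ReflTransGen.cases_head
      (h.chain_of_subset hv hv₁ (subset_iff.2 ⟨subset_rfl, hy₁, subset_rfl⟩)) with
      heq | ⟨⟨x₂, y₂, z₂⟩, ⟨-, hu, f, hf⟩, hc⟩
    · obtain rfl := (Prod.mk.inj (Prod.mk.inj heq).2).1
      rcases e with e | e
      · obtain ⟨he', rfl⟩ := Conf.step_prod_inl.1 he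
        exact h2 (.inl e) (x', y) (he'.prod_left y) hw.1 hP
      · obtain ⟨rfl, he'⟩ := Conf.step_prod_inr.1 he
        exact h4 (.inr e) (y, z') (he'.prod_right y) hw.2 hP
    · have hsub := subset_iff.1 (Conf.Chain.subset hc)
      rcases f with f | f | f
      · exact hf.1 (hsub.1 (hf.mem : f ∈ a.evs x₂))
      · obtain ⟨rfl, hf'⟩ := Conf.step_prod_inr.1 hf
        obtain ⟨hf'', rfl⟩ := Conf.step_prod_inl.1 hf'
        cases hp : b.polEv f with
        | O =>
          exact h4 (.inl f) (y₂, z₂) (Conf.Step.prod_left (c := b.dual) hf'' z₂) hu.2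
            (congrArg Polarity.opp hp)
        | P => exact h2 (.inr f) (x₂, y₂) (hf''.prod_right x₂) hu.1 hp
      · exact hf.1 (hsub.2.2 (hf.mem : f ∈ c.evs z₂))

/-- When no move is possible, each strategy is played on alone to a terminal position. The two
terminal positions may conflict in `B`, so the dependencies of the two sides bear on different
transitions. They are compared through `g`, which sends a transition to an equal or conflicting one
of the other side; switchings do not distinguish conflicting transitions, so `Blocked.isEmpty` still
applies. -/
theorem total {S : Type} [Nonempty S] {Bf : Bool → S → B.E → B.E → Prop} {sw : SwConf Bf}
    (hBf : JointlyWF Bf) (h : Interacts a sw.conf c K₁ K₂)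
    (h₁ : ∀ x y, K₁ (x, y) → (a.prod sw.conf).Lin K₁
      (fun s u => sw.conf.ClosedIn (Bf false s) y u.2) (x, y))
    (h₂ : ∀ y z, K₂ (y, z) → (sw.dual.conf.prod c).Lin K₂
      (fun s u => sw.dual.conf.ClosedIn (Bf true s) y u.1) (y, z))
    {v : (A.prod C).V} (hv : Visible K₁ K₂ v)
    (hO : ∀ e w, (a.prod c).Step v e w → (a.prod c).polEv e ≠ .O) :
    (∀ e w, ¬ (a.prod c).Step v e w) ∨
      ∃ e w, (a.prod c).Step v e w ∧ (a.prod c).polEv e = .P ∧ Visible K₁ K₂ w := by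
  obtain ⟨x, z⟩ := v
  obtain ⟨y, hv⟩ := hv
  obtain ⟨y, -, hv, hmax⟩ := exists_maximal (b := sw.conf) hv
  by_cases hP : ∃ e w, (a.prod c).Step (x, z) e w ∧ (a.prod c).polEv e = .P ∧ Visible K₁ K₂ w
  · exact .inr hP
  have hnoA : ∀ e x₁, a.Step x e x₁ → ¬ K₁ (x₁, y) := fun e x₁ he hK => by
    cases hp : a.polEv e with
    | O => exact hO (.inl e) (x₁, z) (he.prod_left z) hp
    | P => exact hP ⟨.inl e, (x₁, z), he.prod_left z, hp, y, hK, hv.2⟩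
  have hnoC : ∀ e z₁, c.Step z e z₁ → ¬ K₂ (y, z₁) := fun e z₁ he hK => by
    cases hp : c.polEv e with
    | O => exact hO (.inr e) (x, z₁) (he.prod_right x) hp
    | P => exact hP ⟨.inr e, (x, z₁), he.prod_right x, hp, y, hv.1, hK⟩
  obtain ⟨⟨x', y₁⟩, hc₁, hw₁, ht₁⟩ := h.left.exists_terminal hv.1
  obtain ⟨⟨y₂, z'⟩, hc₂, hw₂, ht₂⟩ := h.right.exists_terminal hv.2
  obtain ⟨hx, hy₁⟩ := Conf.prod_subset.1 hc₁.subset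
  obtain ⟨hy₂, hz⟩ := Conf.prod_subset.1 hc₂.subset
  have hmax₁ : ∀ e u, ¬ sw.conf.Step y₁ e u := fun e u he => ht₁ _ _ (he.prod_right x')
  have hmax₂ : ∀ e u, ¬ sw.conf.Step y₂ e u := fun e u he =>
    ht₂ _ _ (Conf.Step.prod_left (c := sw.conf.dual) he z')
  have b₁ := sw.blocked_right (h₁ x' y₁ hw₁) hv.1 hx hy₁ fun e x₁ he _ => hnoA e x₁ he
  have b₂ := sw.dual.blocked_left (h₂ y₂ z' hw₂) hv.2 hz hy₂ fun e x₁ he _ => hnoC e x₁ he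
  choose g hg using fun i : sw.conf.Enabled y y₁ => sw.conf.exists_conflict hy₂ hmax₂ i.2.1
  have hleft : ∀ {d s} {i j : B.E}, B.src i = y → B.src j = y → ∀ {k}, B.src k = y →
      (i = j ∨ ¬ ∃ p q, B.tile i p j q) → Bf d s i k → Bf d s j k := by
    rintro d s i j h1 h2 k h3 (rfl | hij) hik
    · exact hik
    · exact (sw.respects d s).left (h1.trans h2.symm) hij (h3.trans h1.symm) hik
  have hright : ∀ {d s} {i j : B.E}, B.src i = y → B.src j = y → ∀ {k}, B.src k = y →
      (i = j ∨ ¬ ∃ p q, B.tile i p j q) → Bf d s k i → Bf d s k j := by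
    rintro d s i j h1 h2 k h3 (rfl | hij) hik
    · exact hik
    · exact (sw.respects d s).right (h1.trans h2.symm) hij (h3.trans h1.symm) hik
  have hempty := b₁.isEmpty hBf sw.sep_enabled (b₂.comap (f' := fun i : sw.conf.Enabled y y₁ => i.1)
    g (fun k => ?_) fun s i j hij => ?_) fun i hi hi' => ?_
  -- Nothing is left to play in `B`, and neither strategy can move outside, so both are already at
  -- their terminal positions.
  · have hyy₁ : y = y₁ := by
      by_contra hne
      obtain ⟨e, u, he, hu⟩ := Conf.exists_step hy₁ hne
      obtain ⟨m, h1, rfl, -⟩ := he.exists_edge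
      exact hempty.elim ⟨m, h1, hu⟩
    have hyy₂ : y = y₂ := by
      by_contra hne
      obtain ⟨e, u, he, hu⟩ := Conf.exists_step (c := sw.conf) hy₂ hne
      exact hmax₁ e u (hyy₁ ▸ he)
    subst hyy₁ hyy₂
    refine .inl ?_
    rintro (e | e) ⟨x₁, z₁⟩ he
    · obtain ⟨he', rfl⟩ := Conf.step_prod_inl.1 he
      rcases Relation.ReflTransGen.cases_head hc₁ with heq | ⟨⟨x₂, y₂⟩, ⟨-, hu, f, hf⟩, hc⟩
      · cases heq
        exact ht₁ _ _ (he'.prod_left y)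
      · rcases f with f | f
        · obtain ⟨hf', rfl⟩ := Conf.step_prod_inl.1 hf
          exact hnoA f x₂ hf' hu
        · exact hmax₁ _ _ (Conf.step_prod_inr.1 hf).2
    · obtain ⟨rfl, he'⟩ := Conf.step_prod_inr.1 he
      rcases Relation.ReflTransGen.cases_head hc₂ with heq | ⟨⟨y₂, z₂⟩, ⟨-, hu, f, hf⟩, hc⟩
      · cases heq
        exact ht₂ _ _ (he'.prod_right y)
      · rcases f with f | f
        · exact hmax₁ _ _ (Conf.step_prod_inl.1 hf).1
        · obtain ⟨rfl, hf'⟩ := Conf.step_prod_inr.1 hf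
          exact hnoC f z₂ hf' hu
  -- For surjectivity of `g`: distinct `g i` and `k` would be separated by a connective, and since
  -- each is equal to or in conflict with `i`, replacing both by `i` would relate `i` to itself.
  · obtain ⟨i, hi⟩ := sw.conf.exists_conflict hy₁ hmax₁ k.2.1
    refine ⟨i, by_contra fun hne => ?_⟩
    obtain ⟨d, s, hds⟩ := sw.dual.sep_enabled (g i) k hne
    have h3 := hleft (g i).2.1 i.2.1 k.2.1 ((hg i).imp Eq.symm fun h ⟨p, q, ht⟩ =>
      h ⟨q, p, B.tile_symm ht⟩) hds
    exact (sw.respects d s).irrefl rfl (hright k.2.1 i.2.1 i.2.1 hi h3)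
  · exact hleft i.2.1 (g i).2.1 (g j).2.1 (hg i) (hright j.2.1 (g j).2.1 i.2.1 (hg j) hij)
  -- A move of `B` available to the first strategy is Opponent and one available to the second is
  -- Proponent, whereas equal or conflicting moves have the same polarity.
  · have hs₁ : sw.conf.Step y (sw.conf.ev i.1) (B.tgt i.1) := by
      have := Conf.step_edge (c := sw.conf) i.1
      rwa [i.2.1] at this
    have hs₂ : sw.conf.Step y (sw.conf.ev (g i).1) (B.tgt (g i).1) := by
      have := Conf.step_edge (c := sw.conf) (g i).1
      rwa [show B.src (g i).1 = y from (g i).2.1] at this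
    have k1 := h.pol_left hv hs₁ (hmax _ _ hs₁) hi
    have k2 := h.pol_right hv hs₂ (hmax _ _ hs₂) hi'
    rw [← sw.conf.pol_ev] at k1 k2
    have hne : B.pol i.1 ≠ B.pol (g i).1 := fun h => nomatch k1.symm.trans (h.trans k2)
    rcases hg i with h3 | h3
    · exact hne (congrArg B.pol h3)
    · exact h3 (sw.conf.tile_of_pol (i.2.1.trans (g i).2.1.symm) hne)

end Interacts
end AsyncConc

/-! ### Plays of the composite and closure under composition -/

namespace AsyncConc
open AsyncGame

namespace AsyncGame

namespace Conf

variable {G H : AsyncGame} (c : Conf G) (d : Conf H)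

theorem proj_fst : (c.prod d).Proj c Prod.fst Sum.inl := ⟨Sum.inl_injective, fun _ _ => Iff.rfl⟩

theorem proj_snd : (c.prod d).Proj d Prod.snd Sum.inr := ⟨Sum.inr_injective, fun _ _ => Iff.rfl⟩

variable {c}

theorem resClosed_closedIn (Q : G.E → G.E → Prop) (w : G.V) : c.ResClosed (c.ClosedIn Q w) := by
  intro v a b v₁ v₂ u _ ha hb h₁ h₂ hu
  refine h₁.union h₂ ?_
  rw [hu.2, hb.2, Set.union_insert, Set.union_eq_self_of_subset_right ha.subset]

theorem interClosed_closedIn (Q : G.E → G.E → Prop) (w : G.V) : c.InterClosed (c.ClosedIn Q w) :=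
  fun _ _ _ h₁ h₂ hu => h₁.inter h₂ hu

theorem ResClosed.and {K K' : G.V → Prop} (h : c.ResClosed K) (h' : c.ResClosed K') :
    c.ResClosed fun v => K v ∧ K' v :=
  fun _ _ _ _ _ _ hv ha hb h₁ h₂ hw =>
    ⟨h _ _ _ _ _ _ hv.1 ha hb h₁.1 h₂.1 hw, h' _ _ _ _ _ _ hv.2 ha hb h₁.2 h₂.2 hw⟩

theorem InterClosed.and {K K' : G.V → Prop} (h : c.InterClosed K) (h' : c.InterClosed K') :
    c.InterClosed fun v => K v ∧ K' v :=
  fun _ _ _ hv hw hu => ⟨h _ _ _ hv.1 hw.1 hu, h' _ _ _ hv.2 hw.2 hu⟩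

end Conf

theorem Along.and {G : AsyncGame} {K K' : G.V → Prop} {x y : G.V} {s : List G.E}
    (hK : G.Along K x s y) (hK' : G.Along K' x s y) : G.Along (fun v => K v ∧ K' v) x s y := by
  induction s generalizing x with
  | nil => exact ⟨hK.1, hK.2, hK'.2⟩
  | cons e s ih => exact ⟨hK.1, ⟨hK.2.1, hK'.2.1⟩, ih hK.2.2 hK'.2.2⟩

/-- A map between the graphs of two games that may collapse some transitions. -/
structure IsGraphProj {G H : AsyncGame} (f : G.V → H.V) (g : G.E → Option H.E) : Prop where
  none : ∀ e, g e = none → f (G.src e) = f (G.tgt e)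
  some : ∀ e e', g e = some e' → H.src e' = f (G.src e) ∧ H.tgt e' = f (G.tgt e)

namespace IsGraphProj

variable {G H : AsyncGame} {f : G.V → H.V} {g : G.E → Option H.E}

theorem path (h : IsGraphProj f g) {x y : G.V} {s : List G.E} (hs : G.Path x s y) :
    H.Path (f x) (s.filterMap g) (f y) :=
  isPathOn_filterMap f g h.none h.some hs

theorem along_iff (h : IsGraphProj f g) {K : H.V → Prop} {x y : G.V} {s : List G.E}
    (hs : G.Path x s y) :
    H.Along K (f x) (s.filterMap g) (f y) ↔ G.Along (fun v => K (f v)) x s y := by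
  induction s generalizing x with
  | nil =>
    cases hs
    exact ⟨fun h => ⟨rfl, h.2⟩, fun h => ⟨rfl, h.2⟩⟩
  | cons e s ih =>
    obtain ⟨rfl, hs⟩ := hs
    cases hg : g e with
    | none =>
      rw [List.filterMap_cons_none hg, h.none e hg, ih hs]
      refine ⟨fun k => ⟨rfl, ?_, k⟩, fun k => k.2.2⟩
      have := k.left
      rwa [← h.none e hg] at this
    | some e' =>
      rw [List.filterMap_cons_some hg]
      obtain ⟨h1, h2⟩ := h.some e e' hg
      constructor
      · rintro ⟨-, k1, k2⟩
        rw [h2, ih hs] at k2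
        exact ⟨rfl, k1, k2⟩
      · rintro ⟨-, k1, k2⟩
        refine ⟨h1, k1, ?_⟩
        rw [h2, ih hs]
        exact k2

end IsGraphProj

section

variable (A B C : AsyncGame)

theorem isGraphProj_projAB : IsGraphProj (G := A.dual.prod (B.prod C)) (H := A.dual.prod B)
    (fun v => (v.1, v.2.1)) (projAB A B C) where
  none := by
    rintro (⟨m, y, z⟩ | ⟨x, ⟨n, z⟩ | ⟨y, p⟩⟩) h
    · cases h
    · cases h
    · rfl
  some := by
    rintro (⟨m, y, z⟩ | ⟨x, ⟨n, z⟩ | ⟨y, p⟩⟩) e' h <;> cases h <;> exact ⟨rfl, rfl⟩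

theorem isGraphProj_projBC : IsGraphProj (G := A.dual.prod (B.prod C)) (H := B.dual.prod C)
    (fun v => v.2) (projBC A B C) where
  none := by
    rintro (⟨m, y, z⟩ | ⟨x, ⟨n, z⟩ | ⟨y, p⟩⟩) h
    · rfl
    · cases h
    · cases h
  some := by
    rintro (⟨m, y, z⟩ | ⟨x, ⟨n, z⟩ | ⟨y, p⟩⟩) e' h <;> cases h <;> exact ⟨rfl, rfl⟩

theorem isGraphProj_projAC : IsGraphProj (G := A.dual.prod (B.prod C)) (H := A.dual.prod C)
    (fun v => (v.1, v.2.2)) (projAC A B C) where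
  none := by
    rintro (⟨m, y, z⟩ | ⟨x, ⟨n, z⟩ | ⟨y, p⟩⟩) h
    · cases h
    · rfl
    · cases h
  some := by
    rintro (⟨m, y, z⟩ | ⟨x, ⟨n, z⟩ | ⟨y, p⟩⟩) e' h <;> cases h <;> exact ⟨rfl, rfl⟩

theorem path_prod_dual {s : List (A.prod B).E} {x y : (A.prod B).V} :
    (A.prod B).Path x s y ↔ (A.dual.prod B).Path x s y := by
  have hsrc : (A.prod B).src = (A.dual.prod B).src := by
    funext e; rcases e with e | e <;> rfl
  have htgt : (A.prod B).tgt = (A.dual.prod B).tgt := by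
    funext e; rcases e with e | e <;> rfl
  unfold Path
  rw [hsrc, htgt]
  exact Iff.rfl

end

variable {A B C : AsyncGame} {σ : Strategy (A.dual.prod B)} {τ : Strategy (B.dual.prod C)}
  {K₁ : (A.dual.prod B).V → Prop} {K₂ : (B.dual.prod C).V → Prop}

theorem isInteraction_iff (hσ : σ.PlaysIn K₁) (hτ : τ.PlaysIn K₂)
    {u : List (A.prod (B.prod C)).E} : IsInteraction σ τ u ↔
      ∃ v, (A.dual.prod (B.prod C)).Along (Inter K₁ K₂) (A.init, B.init, C.init) u v := by
  constructor
  · rintro ⟨⟨v, hv⟩, h1, h2⟩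
    replace hv := path_prod_dual _ _ |>.1 hv
    obtain ⟨w₁, h1⟩ := (hσ _).1 h1
    obtain ⟨w₂, h2⟩ := (hτ _).1 h2
    obtain rfl := path_target h1.path ((isGraphProj_projAB A B C).path hv)
    obtain rfl := path_target h2.path ((isGraphProj_projBC A B C).path hv)
    exact ⟨v, (((isGraphProj_projAB A B C).along_iff hv).1 h1).and
      (((isGraphProj_projBC A B C).along_iff hv).1 h2)⟩
  · rintro ⟨v, hv⟩
    refine ⟨⟨v, path_prod_dual _ _ |>.2 hv.path⟩, (hσ _).2 ⟨(v.1, v.2.1), ?_⟩,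
      (hτ _).2 ⟨v.2, ?_⟩⟩
    · exact ((isGraphProj_projAB A B C).along_iff hv.path).2 (hv.mono fun _ h => h.1)
    · exact ((isGraphProj_projBC A B C).along_iff hv.path).2 (hv.mono fun _ h => h.2)

theorem Conf.path_self {G : AsyncGame} (c : Conf G) {x : G.V} {s : List G.E} (h : G.Path x s x) :
    s = [] := by
  cases s with
  | nil => rfl
  | cons e s =>
    obtain ⟨rfl, h⟩ := h
    exact absurd (c.evs_mono_path h (c.ev_mem_tgt e)) (c.ev_notMem e)

end AsyncGame

variable {A B C : AsyncGame} {σ : Strategy (A.dual.prod B)} {τ : Strategy (B.dual.prod C)}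
  {K₁ : (A.dual.prod B).V → Prop} {K₂ : (B.dual.prod C).V → Prop}

theorem filterMap_append_singleton {α β : Type} {g : α → Option β} {u t : List α} {e : α} {e' : β}
    (ht : t.filterMap g = []) (he : g e = some e') :
    (u ++ t ++ [e]).filterMap g = u.filterMap g ++ [e'] := by
  simp [ht, he]

theorem exists_lift_edge (e : (A.dual.prod C).E) (y : B.V) :
    ∃ e' : (A.dual.prod (B.prod C)).E, projAC A B C e' = some e ∧
      (A.dual.prod (B.prod C)).src e' =
        (((A.dual.prod C).src e).1, y, ((A.dual.prod C).src e).2) ∧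
      (A.dual.prod (B.prod C)).tgt e' =
        (((A.dual.prod C).tgt e).1, y, ((A.dual.prod C).tgt e).2) := by
  rcases e with ⟨m, z⟩ | ⟨x, n⟩
  · exact ⟨.inl (m, y, z), rfl, rfl, rfl⟩
  · exact ⟨.inr (x, .inr (y, n)), rfl, rfl, rfl⟩

/-- To extend an interaction by a visible transition, `exists_common` tells which hidden moves have
to be inserted before it. -/
theorem Interacts.comp_playsIn {a : Conf A.dual} {b : Conf B} {c : Conf C}
    (h : Interacts a b c K₁ K₂) (hσ : σ.PlaysIn K₁) (hτ : τ.PlaysIn K₂) :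
    (σ.comp τ).PlaysIn (Visible K₁ K₂) := by
  intro s
  constructor
  · rintro ⟨u, hu, rfl⟩
    obtain ⟨v, hv⟩ := (isInteraction_iff hσ hτ).1 hu
    exact ⟨_, ((isGraphProj_projAC A B C).along_iff hv.path).2 (hv.mono fun w hw => ⟨w.2.1, hw⟩)⟩
  · rintro ⟨v, hv⟩
    suffices hu : ∃ u y, (A.dual.prod (B.prod C)).Along (Inter K₁ K₂) (A.init, B.init, C.init) u
        (v.1, y, v.2) ∧ u.filterMap (projAC A B C) = s by
      obtain ⟨u, y, hu, hs⟩ := hu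
      exact ⟨u, (isInteraction_iff hσ hτ).2 ⟨_, hu⟩, hs⟩
    induction s using List.reverseRecOn generalizing v with
    | nil =>
      obtain ⟨rfl, -⟩ := hv
      exact ⟨[], B.init, ⟨rfl, h.left.init, h.right.init⟩, rfl⟩
    | append_singleton s e ih =>
      obtain ⟨w, h1, rfl, -, rfl, h2⟩ := hv.append_inv
      obtain ⟨u, y, hu, rfl⟩ := ih _ h1
      obtain ⟨y', hy', h3, h4⟩ := h.exists_common hu.right h2 (Conf.step_edge e)
      obtain ⟨t, ht⟩ := (h.chain_of_subset hu.right h3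
        (subset_iff.2 ⟨subset_rfl, hy', subset_rfl⟩)).exists_along hu.right
      have ht' := (isGraphProj_projAC A B C).path ht.path
      -- The inserted moves are invisible, because they project to a path from a position to itself.
      replace ht' := (a.prod c).path_self (x := (A.dual.prod C).src e) ht'
      obtain ⟨e', he, h5, h6⟩ := exists_lift_edge (A := A) (C := C) e y'
      refine ⟨u ++ t ++ [e'], y', (hu.append ht).append ⟨h5, h3, ?_⟩, ?_⟩
      · rw [h6]
        exact ⟨rfl, h4⟩
      · exact filterMap_append_singleton ht' he

/-- The scheduling criterion, for sets of positions. -/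
def SchedFam {A B : AsyncGame} (a : Conf A) (b : Conf B) {S T : Type} (Q : S → A.E → A.E → Prop)
    (Q' : T → B.E → B.E → Prop) (K : (A.prod B).V → Prop) : Prop :=
  ∀ s t x y, K (x, y) → (a.prod b).Chain
    (fun u => K u ∧ a.ClosedIn (Q s) x u.1 ∧ b.ClosedIn (Q' t) y u.2) (A.init, B.init) (x, y)

section

variable {A B C : AsyncGame} {S T U : Type} {Q : S → A.E → A.E → Prop} {Q' : T → C.E → C.E → Prop}
  {Bf : Bool → U → B.E → B.E → Prop} {a : Conf A} {c : Conf C} {sw : SwConf Bf}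
  {K₁ : (A.prod B).V → Prop} {K₂ : (B.dual.prod C).V → Prop} {x : A.V} {y : B.V} {z : C.V}

/-- The switching of the outer component is absorbed in the set of positions; only that of the
shared component remains free. -/
theorem SchedFam.lin_left {B : AsyncGame} {b : Conf B} {R : T → B.E → B.E → Prop} {y : B.V}
    {K : (A.prod B).V → Prop} (h : SchedFam a b Q R K) (hK : (a.prod b).Fam K) (s : S)
    (hv : K (x, y)) :
    (a.prod b).Lin (fun u => K u ∧ a.ClosedIn (Q s) x u.1) (fun t u => b.ClosedIn (R t) y u.2)
      (x, y) where
  res := (hK.res).and ((Conf.proj_fst a b).resClosed (Conf.resClosed_closedIn _ _))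
  inter := (hK.inter).and ((Conf.proj_fst a b).interClosed (Conf.interClosed_closedIn _ _))
  init := ⟨hK.init, a.closedIn_init _ _⟩
  chain t := (h s t x y hv).mono fun _ hu _ _ => ⟨⟨hu.1, hu.2.1⟩, hu.2.2⟩

theorem SchedFam.lin_right {B : AsyncGame} {b : Conf B} {R : T → B.E → B.E → Prop} {y : B.V}
    {K : (A.prod B).V → Prop} (h : SchedFam a b Q R K) (hK : (a.prod b).Fam K) (t : T)
    (hv : K (x, y)) :
    (a.prod b).Lin (fun u => K u ∧ b.ClosedIn (R t) y u.2) (fun s u => a.ClosedIn (Q s) x u.1)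
      (x, y) where
  res := (hK.res).and ((Conf.proj_snd a b).resClosed (Conf.resClosed_closedIn _ _))
  inter := (hK.inter).and ((Conf.proj_snd a b).interClosed (Conf.interClosed_closedIn _ _))
  init := ⟨hK.init, b.closedIn_init _ _⟩
  chain s := (h s t x y hv).mono fun _ hu _ _ => ⟨⟨hu.1, hu.2.2⟩, hu.2.1⟩

/-- The deadlock argument is run inside the positions that are closed for given outer switchings.
Its chains show both that all interactions are reachable and that the composite is scheduled. -/
theorem SchedFam.comp [Nonempty S] [Nonempty T] [Nonempty U] (hBf : JointlyWF Bf)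
    (hK₁ : (a.prod sw.conf).Fam K₁) (hK₂ : (sw.conf.dual.prod c).Fam K₂)
    (h₁ : SchedFam a sw.conf Q (Bf false) K₁)
    (h₂ : SchedFam (A := B.dual) sw.conf.dual c (Bf true) Q' K₂) :
    Interacts a sw.conf c K₁ K₂ ∧ (a.prod c).Fam (Visible K₁ K₂) ∧
      SchedFam a c Q Q' (Visible K₁ K₂) := by
  have hc : ∀ s t x y z, Inter K₁ K₂ (x, y, z) → (a.prod (sw.conf.prod c)).Chain
      (Inter (fun u => K₁ u ∧ a.ClosedIn (Q s) x u.1) (fun u => K₂ u ∧ c.ClosedIn (Q' t) z u.2))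
      (A.init, B.init, C.init) (x, y, z) := fun s t x y z hv =>
    sw.interaction_chain hBf (h₁.lin_left hK₁ s hv.1) (h₂.lin_right hK₂ t hv.2)
  have h : Interacts a sw.conf c K₁ K₂ := ⟨hK₁, hK₂, fun ⟨x, y, z⟩ hv =>
    (hc (Classical.arbitrary S) (Classical.arbitrary T) x y z hv).mono
      fun u hu _ _ => ⟨hu.1.1, hu.2.1⟩⟩
  refine ⟨h, h.fam (h.total hBf (fun x y hv => ?_) fun y z hv => ?_), ?_⟩
  · exact ⟨hK₁.res, hK₁.inter, hK₁.init, fun s =>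
      (h₁ (Classical.arbitrary S) s x y hv).mono fun u hu _ _ => ⟨hu.1, hu.2.2⟩⟩
  · exact ⟨hK₂.res, hK₂.inter, hK₂.init, fun s =>
      (h₂ s (Classical.arbitrary T) y z hv).mono fun u hu _ _ => ⟨hu.1, hu.2.1⟩⟩
  · rintro s t x z ⟨y, hv⟩
    exact (Conf.proj_left_right a sw.conf c).chain
      (fun u hu => ⟨⟨u.2.1, hu.1.1, hu.2.1⟩, hu.1.2, hu.2.2⟩) (hc s t x y z hv)

end

theorem schedFam_iff {X : Type} {ρ : X → AsyncGame} {A B : Formula X} (swA : SwConf (Before ρ A))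
    (swB : SwConf (Before ρ B)) {σ : Strat ρ A B}
    {K : ((interp ρ A).dual.prod (interp ρ B)).V → Prop}
    (h : σ.PlaysIn K) (hK : (swA.conf.dual.prod swB.conf).Fam K) :
    Scheduled σ ↔ SchedFam (A := (interp ρ A).dual) swA.conf.dual swB.conf (Before ρ A true)
      (Before ρ B false) K := by
  refine forall_congr' fun S => forall_congr' fun T => ?_
  refine (Conf.scheduled_iff (((swA.dual.respects true S).prod (swB.respects false T)) _ _) h
    hK).trans ?_
  constructor
  · intro hc x y hv
    exact (hc _ hv).mono fun u hu _ _ => ⟨hu.1, Conf.closedIn_prod.1 hu.2⟩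
  · rintro hc ⟨x, y⟩ hv
    exact (hc x y hv).mono fun u hu _ _ => ⟨hu.1, Conf.closedIn_prod.2 hu.2⟩

theorem comp_isIngenuous {X : Type} {ρ : X → AsyncGame} (hρ : ∀ x, (ρ x).IsSequential)
    {A B C : Formula X} {σ : Strat ρ A B} {τ : Strat ρ B C} (hσ : σ.IsIngenuous)
    (hσ' : Scheduled σ) (hτ : τ.IsIngenuous) (hτ' : Scheduled τ) :
    (σ.comp τ).IsIngenuous ∧ Scheduled (ρ := ρ) (A := A) (B := C) (σ.comp τ) := by
  have := nonempty_switching A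
  have := nonempty_switching B
  have := nonempty_switching C
  obtain ⟨swA⟩ := nonempty_swConf hρ A
  obtain ⟨swB⟩ := nonempty_swConf hρ B
  obtain ⟨swC⟩ := nonempty_swConf hρ C
  obtain ⟨pσ, fσ⟩ := hσ.fam (swA.conf.dual.prod swB.conf)
  obtain ⟨pτ, fτ⟩ := hτ.fam (swB.conf.dual.prod swC.conf)
  obtain ⟨h1, h2, h3⟩ := SchedFam.comp (jointlyWF_before ρ B) fσ fτ
    ((schedFam_iff swA swB pσ fσ).1 hσ') ((schedFam_iff swB swC pτ fτ).1 hτ')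
  have hp := h1.comp_playsIn pσ pτ
  exact ⟨hp.isIngenuous h2, (schedFam_iff swA swC hp h2).2 h3⟩

end AsyncConc

/-! ### Copy-cat strategies -/

namespace AsyncConc
open AsyncGame

namespace AsyncGame.Conf

variable {G : AsyncGame} {c : Conf G} {x y : G.V}

/-- The positions of the copy-cat strategy. -/
def Copy (c : Conf G) (v : (G.dual.prod G).V) : Prop :=
  (∀ a ∈ c.evs v.1, a ∈ c.evs v.2 ∨ c.polEv a = .P) ∧
    ∀ a ∈ c.evs v.2, a ∈ c.evs v.1 ∨ c.polEv a = .O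

/-- The common position below `x` and `y` can be taken to be their intersection. -/
theorem copyRel_iff (c : Conf G) : CopyRel G x y ↔ c.Copy (x, y) := by
  constructor
  · rintro ⟨z, s, t, hs, hs', ht, ht'⟩
    constructor
    · intro a ha
      rcases (c.mem_evs_of_path hs a).1 ha with h | ⟨e, he, rfl⟩
      · exact .inl (c.evs_mono_path ht h)
      · exact .inr ((c.pol_ev e).symm.trans (hs' e he))
    · intro a ha
      rcases (c.mem_evs_of_path ht a).1 ha with h | ⟨e, he, rfl⟩
      · exact .inl (c.evs_mono_path hs h)
      · exact .inr ((c.pol_ev e).symm.trans (ht' e he))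
  · rintro ⟨h1, h2⟩
    obtain ⟨z, hz⟩ := c.inter x y
    obtain ⟨s, hs⟩ := c.reach_of_subset (hz.le.trans Set.inter_subset_left)
    obtain ⟨t, ht⟩ := c.reach_of_subset (hz.le.trans Set.inter_subset_right)
    have key : ∀ {w : G.V} {l : List G.E}, G.Path z l w → ∀ e ∈ l, c.ev e ∈ c.evs w ∧
        c.ev e ∉ c.evs z := by
      intro w l hl e he
      refine ⟨(c.mem_evs_of_path hl _).2 (.inr ⟨e, he, rfl⟩), fun hez => ?_⟩
      obtain ⟨l₁, l₂, rfl⟩ := List.append_of_mem he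
      obtain ⟨u, h3, rfl, -⟩ := isPathOn_append_inv hl
      exact c.ev_notMem e (c.evs_mono_path h3 hez)
    rw [hz] at key
    refine ⟨z, s, t, hs, fun e he => ?_, ht, fun e he => ?_⟩
    · obtain ⟨h3, h4⟩ := key hs e he
      exact (c.pol_ev e).trans ((h1 _ h3).resolve_left fun h => h4 ⟨h3, h⟩)
    · obtain ⟨h3, h4⟩ := key ht e he
      exact (c.pol_ev e).trans ((h2 _ h3).resolve_left fun h => h4 ⟨h, h3⟩)

theorem copycat_playsIn (c : Conf G) : (copycat G).PlaysIn c.Copy := by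
  intro s
  constructor
  · rintro ⟨⟨v, hv⟩, h⟩
    exact ⟨v, .of_path hv fun t ht w hw => c.copyRel_iff.1 (h t ht w.1 w.2 hw)⟩
  · rintro ⟨v, hv⟩
    exact ⟨⟨v, hv.path⟩, fun t ht x y h => c.copyRel_iff.2 (hv.of_prefix ht h)⟩

/-- Paths of different polarities are compatible. -/
theorem exists_union_of_pol (c : Conf G) {z : G.V} {s t : List G.E} (hs : G.Path z s x)
    (hs' : ∀ e ∈ s, G.pol e = .P) (ht : G.Path z t y) (ht' : ∀ e ∈ t, G.pol e = .O) :
    ∃ w, c.evs x ⊆ c.evs w ∧ c.evs y ⊆ c.evs w := by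
  have push : ∀ {z x : G.V} {s : List G.E}, G.Path z s x → (∀ e ∈ s, G.pol e = .P) → ∀ {f : G.E},
      G.src f = z → G.pol f = .O → ∃ w s', G.Path (G.tgt f) s' w ∧ (∀ e ∈ s', G.pol e = .P) ∧
        c.evs x ⊆ c.evs w := by
    intro z x s
    induction s generalizing z with
    | nil =>
      rintro hs - f rfl -
      cases hs
      exact ⟨_, [], rfl, by simp, c.src_subset_tgt f⟩
    | cons e s ih =>
      rintro ⟨h1, h2⟩ h3 f hf hO
      have hP := h3 e (by simp)
      obtain ⟨p, q, ht⟩ := c.tile_of_pol (h1.trans hf.symm)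
        (by rw [hP, hO]; exact fun h => nomatch h)
      obtain ⟨-, h4, h5, h6⟩ := G.tile_bound ht
      obtain ⟨h7, h8⟩ := G.tile_pol ht
      obtain ⟨w, s', h9, h10, h11⟩ := ih h2 (fun e he => h3 e (by simp [he])) h4.symm
        (h8.symm.trans hO)
      refine ⟨w, q :: s', ⟨h5.symm, h6 ▸ h9⟩, ?_, h11⟩
      rintro e' he'
      rcases List.mem_cons.1 he' with rfl | he'
      · exact h7.symm.trans hP
      · exact h10 e' he'
  induction t generalizing z x s with
  | nil =>
    cases ht
    exact ⟨x, subset_rfl, c.evs_mono_path hs⟩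
  | cons f t ih =>
    obtain ⟨h1, h2⟩ := ht
    obtain ⟨w, s', h3, h4, h5⟩ := push hs hs' h1 (ht' f (by simp))
    obtain ⟨w', h6, h7⟩ := ih h3 h4 h2 fun e he => ht' e (by simp [he])
    exact ⟨w', h5.trans h6, h7⟩

/-- What `x` and `y` add to a common position has opposite polarities, so it is compatible. -/
theorem Copy.exists_union (h : c.Copy (x, y)) : ∃ w, c.evs w = c.evs x ∪ c.evs y := by
  obtain ⟨z, s, t, h1, h2, h3, h4⟩ := c.copyRel_iff.2 h
  obtain ⟨w, h5, h6⟩ := c.exists_union_of_pol h1 h2 h3 h4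
  exact c.union h5 h6

theorem Copy.inter {x' y' u : G.V} (h : c.Copy (x, y)) (hx : c.evs x' = c.evs x ∩ c.evs u)
    (hy : c.evs y' = c.evs y ∩ c.evs u) : c.Copy (x', y') := by
  constructor
  · intro a ha
    replace ha := hx ▸ ha
    exact (h.1 a ha.1).imp_left fun h => hy ▸ ⟨h, ha.2⟩
  · intro a ha
    replace ha := hy ▸ ha
    exact (h.2 a ha.1).imp_left fun h => hx ▸ ⟨h, ha.2⟩

theorem copy_interClosed (c : Conf G) : (c.dual.prod c).InterClosed c.Copy := by
  intro u v w hv hw hu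
  obtain ⟨h1, h2⟩ := prod_evs_inter hu
  constructor
  · intro a ha
    have ha' : a ∈ c.evs v.1 ∩ c.evs w.1 := h1 ▸ ha
    rcases hv.1 a ha'.1 with h3 | h3
    · rcases hw.1 a ha'.2 with h4 | h4
      · exact .inl (h2 ▸ ⟨h3, h4⟩)
      · exact .inr h4
    · exact .inr h3
  · intro a ha
    have ha' : a ∈ c.evs v.2 ∩ c.evs w.2 := h2 ▸ ha
    rcases hv.2 a ha'.1 with h3 | h3
    · rcases hw.2 a ha'.2 with h4 | h4
      · exact .inl (show a ∈ c.evs u.1 from h1 ▸ ⟨h3, h4⟩)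
      · exact .inr h4
    · exact .inr h3

theorem Copy.of_step {v v₁ v₂ w : (G.dual.prod G).V} {a b : (c.dual.prod c).Ev}
    (h₁ : c.Copy v₁) (h₂ : c.Copy v₂) (ha : (c.dual.prod c).Step v a v₁)
    (hb : (c.dual.prod c).Step v b v₂) (hw : (c.dual.prod c).Step v₁ b w) : c.Copy w := by
  have hsub₁ := prod_subset.1 hw.subset
  have hsub₂ := prod_subset.1 (ha.swap hb hw).subset
  have hor : ∀ e, e ∈ (c.dual.prod c).evs w → e ∈ (c.dual.prod c).evs v₁ ∨
      e ∈ (c.dual.prod c).evs v₂ := fun e he =>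
    ((hw.mem_iff e).1 he).elim (fun h => .inr (h ▸ hb.mem)) .inl
  constructor
  · intro e he
    rcases hor (.inl e) he with h | h
    · exact (h₁.1 e h).imp_left fun h => hsub₁.2 h
    · exact (h₂.1 e h).imp_left fun h => hsub₂.2 h
  · intro e he
    rcases hor (.inr e) he with h | h
    · exact (h₁.2 e h).imp_left fun h => hsub₁.1 h
    · exact (h₂.2 e h).imp_left fun h => hsub₂.1 h

theorem copy_resClosed (c : Conf G) : (c.dual.prod c).ResClosed c.Copy :=
  fun _ _ _ _ _ _ _ ha hb h₁ h₂ hw => h₁.of_step h₂ ha hb hw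

theorem step_inter {u u' x₁ x₂ : G.V} {a : c.Ev} (ha : c.Step u a u')
    (h₁ : c.evs x₁ = c.evs x ∩ c.evs u) (h₂ : c.evs x₂ = c.evs x ∩ c.evs u') :
    (a ∈ c.evs x → c.Step x₁ a x₂) ∧ (a ∉ c.evs x → x₂ = x₁) := by
  constructor
  · intro hax
    refine ⟨fun h => ha.1 (h₁ ▸ h).2, ?_⟩
    rw [h₂, h₁, ha.2, Set.inter_insert_of_mem hax]
  · intro hax
    refine c.evs_injective ?_
    rw [h₂, h₁, ha.2, Set.inter_insert_of_notMem hax]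

/-- The copy-cat strategy follows any linearization of the union of two of its positions. -/
theorem Copy.chain {w : G.V} {D : G.V → Prop} (h : c.Copy (x, y))
    (hw : c.evs w = c.evs x ∪ c.evs y) (hD : c.Chain D G.init w) :
    (c.dual.prod c).Chain (fun v => c.Copy v ∧ (∃ u, D u ∧ c.evs v.1 = c.evs x ∩ c.evs u) ∧
      ∃ u, D u ∧ c.evs v.2 = c.evs y ∩ c.evs u) (G.init, G.init) (x, y) := by
  suffices key : ∀ u, c.Chain D G.init u → c.evs u ⊆ c.evs w → ∀ x' y',
      c.evs x' = c.evs x ∩ c.evs u → c.evs y' = c.evs y ∩ c.evs u →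
      (c.dual.prod c).Chain (fun v => c.Copy v ∧ (∃ u, D u ∧ c.evs v.1 = c.evs x ∩ c.evs u) ∧
        ∃ u, D u ∧ c.evs v.2 = c.evs y ∩ c.evs u) (G.init, G.init) (x', y') by
    refine key w hD subset_rfl x y ?_ ?_
    · rw [hw, Set.inter_eq_left.2 Set.subset_union_left]
    · rw [hw, Set.inter_eq_left.2 Set.subset_union_right]
  intro u hu
  induction hu with
  | refl =>
    intro _ x' y' hx hy
    rw [c.evs_init, Set.inter_empty, ← c.evs_init] at hx hy
    rw [c.evs_injective hx, c.evs_injective hy]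
    exact .refl
  | @tail u u' h1 h2 ih =>
    intro huw x₂ y₂ hx₂ hy₂
    obtain ⟨d1, d2, a, ha⟩ := h2
    obtain ⟨x₁, hx₁⟩ := c.inter x u
    obtain ⟨y₁, hy₁⟩ := c.inter y u
    have hc := ih (ha.subset.trans huw) x₁ y₁ hx₁ hy₁
    obtain ⟨sx, sx'⟩ := step_inter ha hx₁ hx₂
    obtain ⟨sy, sy'⟩ := step_inter ha hy₁ hy₂
    have k₁ : c.Copy (x₁, y₁) := h.inter hx₁ hy₁
    have k₂ : c.Copy (x₂, y₂) := h.inter hx₂ hy₂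
    by_cases hax : a ∈ c.evs x
    · by_cases hay : a ∈ c.evs y
      · have sx := sx hax
        have sy := sy hay
        cases hp : c.polEv a with
        -- An Opponent move of `G` is played on the right and then copied to the left; a Proponent
        -- move goes the other way.
        | O =>
          have k₃ : c.Copy (x₁, y₂) := by
            refine ⟨fun b hb => (k₁.1 b hb).imp_left fun h => sy.subset h, fun b hb => ?_⟩
            rcases (sy.mem_iff b).1 hb with rfl | hb
            · exact .inr hp
            · exact k₁.2 b hb
          refine .tail (.tail hc ⟨⟨k₁, ⟨u, d1, hx₁⟩, u, d1, hy₁⟩, ⟨k₃, ⟨u, d1, hx₁⟩, u', d2, hy₂⟩,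
            .inr a, sy.prod_right x₁⟩) ⟨⟨k₃, ⟨u, d1, hx₁⟩, u', d2, hy₂⟩,
            ⟨k₂, ⟨u', d2, hx₂⟩, u', d2, hy₂⟩, .inl a, Step.prod_left (c := c.dual) sx y₂⟩
        | P =>
          have k₃ : c.Copy (x₂, y₁) := by
            refine ⟨fun b hb => ?_, fun b hb => (k₁.2 b hb).imp_left fun h => sx.subset h⟩
            rcases (sx.mem_iff b).1 hb with rfl | hb
            · exact .inr hp
            · exact k₁.1 b hb
          refine .tail (.tail hc ⟨⟨k₁, ⟨u, d1, hx₁⟩, u, d1, hy₁⟩, ⟨k₃, ⟨u', d2, hx₂⟩, u, d1, hy₁⟩,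
            .inl a, Step.prod_left (c := c.dual) sx y₁⟩) ⟨⟨k₃, ⟨u', d2, hx₂⟩, u, d1, hy₁⟩,
            ⟨k₂, ⟨u', d2, hx₂⟩, u', d2, hy₂⟩, .inr a, sy.prod_right x₂⟩
      · obtain rfl := sy' hay
        exact .tail hc ⟨⟨k₁, ⟨u, d1, hx₁⟩, u, d1, hy₁⟩, ⟨k₂, ⟨u', d2, hx₂⟩, u, d1, hy₁⟩, .inl a,
          Step.prod_left (c := c.dual) (sx hax) y₂⟩
    · obtain rfl := sx' hax
      have hay : a ∈ c.evs y := by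
        have := huw ha.mem
        rw [hw] at this
        exact this.resolve_left hax
      exact .tail hc ⟨⟨k₁, ⟨u, d1, hx₁⟩, u, d1, hy₁⟩, ⟨k₂, ⟨u, d1, hx₁⟩, u', d2, hy₂⟩, .inr a,
        (sy hay).prod_right x₂⟩

theorem Copy.step_left {x' : G.V} {a : c.Ev} (h : c.Copy (x, y)) (ha : c.Step x a x')
    (ha' : a ∈ c.evs y ∨ c.polEv a = .P) : c.Copy (x', y) := by
  refine ⟨fun b hb => ?_, fun b hb => (h.2 b hb).imp_left fun h => ha.subset h⟩
  rcases (ha.mem_iff b).1 hb with rfl | hb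
  · exact ha'
  · exact h.1 b hb

theorem Copy.step_right {y' : G.V} {a : c.Ev} (h : c.Copy (x, y)) (ha : c.Step y a y')
    (ha' : a ∈ c.evs x ∨ c.polEv a = .O) : c.Copy (x, y') := by
  refine ⟨fun b hb => (h.1 b hb).imp_left fun h => ha.subset h, fun b hb => ?_⟩
  rcases (ha.mem_iff b).1 hb with rfl | hb
  · exact ha'
  · exact h.2 b hb

/-- A position of the copy-cat strategy is on the diagonal unless some move can be copied. -/
theorem Copy.eq_or_exists (h : c.Copy (x, y)) : x = y ∨ ∃ a v, (c.dual.prod c).Step (x, y) a v ∧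
    (c.dual.prod c).polEv a = .P ∧ c.Copy v := by
  obtain ⟨w, hw⟩ := h.exists_union
  by_cases hx : x = w
  · by_cases hy : y = w
    · exact .inl (hx.trans hy.symm)
    · obtain ⟨a, y', h1, h2⟩ := exists_step (hw.ge.trans' Set.subset_union_right) hy
      have hax : a ∈ c.evs x := hx ▸ h2 h1.mem
      have hp : c.polEv a = .P := (h.1 a hax).resolve_left h1.1
      exact .inr ⟨.inr a, (x, y'), h1.prod_right x, hp, h.step_right h1 (.inl hax)⟩
  · obtain ⟨a, x', h1, h2⟩ := exists_step (hw.ge.trans' Set.subset_union_left) hx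
    have hay : a ∈ c.evs y := by
      have := h2 h1.mem
      rw [hw] at this
      exact this.resolve_left h1.1
    have hp : c.polEv a = .O := (h.2 a hay).resolve_left h1.1
    exact .inr ⟨.inl a, (x', y), Step.prod_left (c := c.dual) h1 y, congrArg Polarity.opp hp,
      h.step_left h1 (.inl hay)⟩

theorem opp_eq_O {p : Polarity} (h : p.opp = .O) : p = .P := by cases p <;> trivial

theorem opp_eq_P {p : Polarity} (h : p.opp = .P) : p = .O := by cases p <;> trivial

theorem copy_fam (c : Conf G) : (c.dual.prod c).Fam c.Copy where
  init := ⟨fun a ha => .inl ha, fun a ha => .inl ha⟩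
  chain := by
    rintro ⟨x, y⟩ hv
    obtain ⟨w, hw⟩ := hv.exists_union
    obtain ⟨s, hs⟩ := G.reachable w
    have hD : c.Chain (fun _ => True) G.init w :=
      Along.chain (s := s) (.of_path hs fun _ _ _ _ => trivial) c
    exact (hv.chain hw hD).mono fun _ hu _ _ => hu.1
  det := by
    rintro ⟨x, y⟩ a b ⟨x₁, y₁⟩ ⟨x₂, y₂⟩ hv ha hb h₁ h₂ hne hP
    suffices hu : ∃ u, (c.dual.prod c).Step (x₁, y₁) b u by
      obtain ⟨u, hu⟩ := hu
      exact ⟨u, hu, h₁.of_step h₂ ha hb hu⟩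
    obtain ⟨w, hw⟩ := hv.exists_union
    have hxw : c.evs x ⊆ c.evs w := hw.ge.trans' Set.subset_union_left
    have hyw : c.evs y ⊆ c.evs w := hw.ge.trans' Set.subset_union_right
    rcases a with a | a <;> rcases b with b | b
    · obtain ⟨ha', rfl⟩ := step_prod_inl.1 ha
      obtain ⟨hb', rfl⟩ := step_prod_inl.1 hb
      have hO : c.polEv a = .O := opp_eq_P hP
      -- A Proponent move of the copy-cat strategy copies a move already made on the other side. The
      -- second move either is also a copy, and the union `w` bounds both, or has the opposite
      -- polarity.
      have hay : a ∈ c.evs y₂ := (h₁.1 a ha'.mem).resolve_right fun h => nomatch h.symm.trans hO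
      suffices hu : ∃ u, c.Step x₁ b u by
        obtain ⟨u, hu⟩ := hu
        exact ⟨(u, y₂), Step.prod_left (c := c.dual) hu y₂⟩
      rcases h₂.1 b hb'.mem with hby | hbP
      · obtain ⟨u, hu, -⟩ := Step.diamond (c := c) ha' hb' (fun h => hne (h ▸ rfl))
          (ha'.subset_of hxw (hyw hay)) (hb'.subset_of hxw (hyw hby))
        exact ⟨u, hu⟩
      · obtain ⟨u, hu, -⟩ := Step.diamond_of_pol (c := c) ha' hb'
          (by rw [hO, hbP]; exact fun h => nomatch h)
        exact ⟨u, hu⟩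
    · obtain ⟨u, hu, -⟩ := ha.prod_diamond hb
      exact ⟨u, hu⟩
    · obtain ⟨u, -, hu⟩ := hb.prod_diamond ha
      exact ⟨u, hu⟩
    · obtain ⟨rfl, ha'⟩ := step_prod_inr.1 ha
      obtain ⟨rfl, hb'⟩ := step_prod_inr.1 hb
      have hax : a ∈ c.evs x₂ := (h₁.2 a ha'.mem).resolve_right fun h => nomatch h.symm.trans hP
      suffices hu : ∃ u, c.Step y₁ b u by
        obtain ⟨u, hu⟩ := hu
        exact ⟨_, hu.prod_right x₂⟩
      rcases h₂.2 b hb'.mem with hbx | hbO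
      · obtain ⟨u, hu, -⟩ := ha'.diamond hb' (fun h => hne (h ▸ rfl))
          (ha'.subset_of hyw (hxw hax)) (hb'.subset_of hyw (hxw hbx))
        exact ⟨u, hu⟩
      · obtain ⟨u, hu, -⟩ := ha'.diamond_of_pol hb' fun h => nomatch hP.symm.trans (h.trans hbO)
        exact ⟨u, hu⟩
  recep := by
    rintro ⟨x, y⟩ (a | a) ⟨x', y'⟩ hv ha hO
    · obtain ⟨ha', rfl⟩ := step_prod_inl.1 ha
      exact hv.step_left ha' (.inr (opp_eq_O hO))
    · obtain ⟨rfl, ha'⟩ := step_prod_inr.1 ha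
      exact hv.step_right ha' (.inr hO)
  total := by
    rintro ⟨x, y⟩ hv hno
    rcases hv.eq_or_exists with rfl | h
    · refine .inl ?_
      rintro (a | a) ⟨x', y'⟩ ha
      · have ha' : c.Step x a x' := (step_prod_inl.1 ha).1
        cases hp : c.polEv a with
        | O => exact hno (.inr a) (x, x') (ha'.prod_right x) hp
        | P => exact hno _ _ ha (congrArg Polarity.opp hp)
      · have ha' := (step_prod_inr.1 ha).2
        cases hp : c.polEv a with
        | O => exact hno _ _ ha hp
        | P =>
          exact hno (.inl a) (y', x) (Step.prod_left (c := c.dual) (d := c) ha' x)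
            (congrArg Polarity.opp hp)
    · exact .inr h
  court := by
    rintro ⟨x, y⟩ a b ⟨x₁, y₁⟩ ⟨x₂, y₂⟩ ⟨x₃, y₃⟩ hv ha hb hw h₁ hKw hP
    rcases a with a | a <;> rcases b with b | b
    · obtain ⟨hb', rfl⟩ := step_prod_inl.1 hb
      obtain ⟨hw', rfl⟩ := step_prod_inl.1 hw
      obtain ⟨-, rfl⟩ := step_prod_inl.1 ha
      exact hv.step_left hb' (hKw.1 b hw'.mem)
    · obtain ⟨rfl, hb'⟩ := step_prod_inr.1 hb
      obtain ⟨rfl, hw'⟩ := step_prod_inr.1 hw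
      obtain ⟨ha', rfl⟩ := step_prod_inl.1 ha
      refine hv.step_right hb' ?_
      rcases hKw.2 b hw'.mem with h | h
      · rcases (ha'.mem_iff b).1 h with rfl | h
        · exact .inr (opp_eq_P hP)
        · exact .inl h
      · exact .inr h
    · obtain ⟨hb', rfl⟩ := step_prod_inl.1 hb
      obtain ⟨hw', rfl⟩ := step_prod_inl.1 hw
      obtain ⟨rfl, ha'⟩ := step_prod_inr.1 ha
      refine hv.step_left hb' ?_
      rcases hKw.1 b hw'.mem with h | h
      · rcases (ha'.mem_iff b).1 h with rfl | h
        · exact .inr hP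
        · exact .inl h
      · exact .inr h
    · obtain ⟨rfl, hb'⟩ := step_prod_inr.1 hb
      obtain ⟨rfl, hw'⟩ := step_prod_inr.1 hw
      obtain ⟨rfl, -⟩ := step_prod_inr.1 ha
      exact hv.step_right hb' (hKw.2 b hw'.mem)
  res := c.copy_resClosed
  inter := c.copy_interClosed

/-- Off the diagonal some move remains to be copied; on the diagonal there is none. -/
theorem halt_copy : (c.dual.prod c).Halt c.Copy (x, y) ↔ x = y := by
  constructor
  · rintro ⟨h1, h2⟩
    exact h1.eq_or_exists.resolve_right fun ⟨a, v, h3, h4, h5⟩ => h2 a v h3 h5 h4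
  · rintro rfl
    refine ⟨⟨fun a ha => .inl ha, fun a ha => .inl ha⟩, ?_⟩
    rintro (a | a) ⟨x', y'⟩ ha hK hP
    · obtain ⟨ha', rfl⟩ := step_prod_inl.1 ha
      rcases hK.1 a ha'.mem with h | h
      · exact ha'.1 h
      · exact nomatch h.symm.trans (opp_eq_P hP)
    · obtain ⟨rfl, ha'⟩ := step_prod_inr.1 ha
      rcases hK.2 a ha'.mem with h | h
      · exact ha'.1 h
      · exact nomatch h.symm.trans hP

end AsyncGame.Conf

/-- Both sides follow one linearization of the union of `x` and `y` that obeys the two switchings at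
once. -/
theorem SwConf.schedFam_copy {G : AsyncGame} {S : Type} {Bf : Bool → S → G.E → G.E → Prop}
    (sw : SwConf Bf) :
    SchedFam (A := G.dual) sw.conf.dual sw.conf (Bf true) (Bf false) sw.conf.Copy := by
  intro s t x y hv
  obtain ⟨w, hw⟩ := hv.exists_union
  obtain ⟨l, hl, hp⟩ := sw.lin s t w
  have hD : sw.conf.Chain (fun u => sw.conf.ClosedIn (Bf true s) w u ∧
      sw.conf.ClosedIn (Bf false t) w u) G.init w := by
    refine Along.chain (s := l) (.of_path hl fun l' hl' v hv => ?_) sw.conf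
    obtain ⟨l'', rfl⟩ := hl'
    obtain ⟨v', h1, h2⟩ := isPathOn_append_inv hl
    obtain rfl := path_target hv h1
    exact ⟨Conf.closedIn_of_pairwise (sw.respects true s) h1 h2 (hp.imp fun h => h.1),
      Conf.closedIn_of_pairwise (sw.respects false t) h1 h2 (hp.imp fun h => h.2)⟩
  refine (hv.chain hw hD).mono ?_
  rintro u ⟨h1, ⟨u₁, h2, h3⟩, u₂, h4, h5⟩ - -
  refine ⟨h1, fun a ha b hb hab => ?_, fun a ha b hb hab => ?_⟩
  · have ha' : a ∈ sw.conf.evs x ∩ sw.conf.evs u₁ := h3 ▸ ha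
    exact (h3 ▸ ⟨hb, h2.1 a ha'.2 b (hw ▸ .inl hb) hab⟩ : b ∈ sw.conf.evs u.1)
  · have ha' : a ∈ sw.conf.evs y ∩ sw.conf.evs u₂ := h5 ▸ ha
    exact (h5 ▸ ⟨hb, h4.2 a ha'.2 b (hw ▸ .inr hb) hab⟩ : b ∈ sw.conf.evs u.2)

theorem copycat_isIngenuous {X : Type} {ρ : X → AsyncGame} (hρ : ∀ x, (ρ x).IsSequential)
    (A : Formula X) : (copycat (interp ρ A)).IsIngenuous ∧
      Scheduled (ρ := ρ) (A := A) (B := A) (copycat (interp ρ A)) := by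
  obtain ⟨sw⟩ := nonempty_swConf hρ A
  exact ⟨sw.conf.copycat_playsIn.isIngenuous sw.conf.copy_fam,
    (schedFam_iff sw sw sw.conf.copycat_playsIn sw.conf.copy_fam).2 sw.schedFam_copy⟩

end AsyncConc

/-! ### Copy-cat strategies as units -/

namespace AsyncConc
open AsyncGame

namespace AsyncGame.Conf

variable {G : AsyncGame} {c : Conf G} {K : G.V → Prop} {v w m : G.V}

theorem chain_of_subset_game (c : Conf G) (h : c.evs v ⊆ c.evs w) :
    c.Chain (fun u => c.evs v ⊆ c.evs u ∧ c.evs u ⊆ c.evs w) v w := by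
  obtain ⟨s, hs⟩ := c.reach_of_subset h
  exact (Along.chain (K := fun _ => True) (s := s) (.of_path hs fun _ _ _ _ => trivial) c).mono
    fun u _ h1 h2 => ⟨h1, h2⟩

theorem Chain.map {H : AsyncGame} {d : Conf H} {K' : H.V → Prop} {f : G.V → H.V}
    (hf : ∀ u a u', c.Step u a u' → ∃ a', d.Step (f u) a' (f u')) (hK : ∀ u, K u → K' (f u))
    (h : c.Chain K v w) : d.Chain K' (f v) (f w) := by
  induction h with
  | refl => exact .refl
  | tail _ h2 ih =>
    obtain ⟨h3, h4, a, ha⟩ := h2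
    exact .tail ih ⟨hK _ h3, hK _ h4, hf _ a _ ha⟩

/-- Proponent moves can be delayed. -/
theorem Fam.of_subset_pol (hK : c.Fam K) (hw : K w) (hm : c.evs m ⊆ c.evs w)
    (hP : ∀ a ∈ c.evs w, a ∉ c.evs m → c.polEv a = .P) : K m := by
  have hc := hK.chain w hw
  induction hc generalizing m with
  | refl =>
    rw [c.evs_init] at hm
    rw [c.evs_injective ((Set.subset_empty_iff.1 hm).trans c.evs_init.symm)]
    exact hK.init
  | @tail w' w h1 h2 ih =>
    obtain ⟨h3, h4, b, hb⟩ := h2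
    obtain ⟨m', hm'⟩ := c.inter m w'
    have hm'w : c.evs m' ⊆ c.evs w' := hm'.le.trans Set.inter_subset_right
    have hP' : ∀ a ∈ c.evs w', a ∉ c.evs m' → c.polEv a = .P := fun a ha ha' =>
      hP a (hb.subset ha) fun h => ha' (hm' ▸ ⟨h, ha⟩)
    have hKm' := ih h3 hm'w hP'
    by_cases hbm : b ∈ c.evs m
    · have hmb : c.Step m' b m := by
        refine ⟨fun h => hb.1 (hm'w h), ?_⟩
        rw [hm']
        ext e
        constructor
        · intro he
          exact ((hb.mem_iff e).1 (hm he)).imp_right fun h => ⟨he, h⟩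
        · rintro (rfl | h)
          · exact hbm
          · exact h.1
      -- Courtesy brings the last event `b` back along a chain to `w'` that only adds Proponent
      -- events.
      have key : ∀ v, c.Chain K v w' → c.evs m' ⊆ c.evs v → ∀ u, c.Step v b u → K u := by
        intro v hv
        induction hv using Relation.ReflTransGen.head_induction_on with
        | refl => intro _ u hu; rw [hu.unique hb]; exact h4
        | head k1 k2 ih' =>
          intro hmv u hu
          obtain ⟨k3, k4, a, ha⟩ := k1
          have hsub := Chain.subset k2
          have hvw := ha.subset.trans (hsub.trans hb.subset)
          obtain ⟨u₁, h5, h6, -⟩ := ha.diamond hu (fun h => hb.1 (h ▸ hsub ha.mem))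
            (hsub.trans hb.subset) (hu.subset_of hvw hb.mem)
          exact hK.court k3 ha hu h5 k4 (ih' (hmv.trans ha.subset) u₁ h5)
            (hP' a (hsub ha.mem) fun h => ha.1 (hmv h))
      exact key m' ((hK.chain _ hKm').of_subset hK.res h1 hm'w) subset_rfl m hmb
    · have : m = m' := by
        refine c.evs_injective ?_
        rw [hm', eq_comm, Set.inter_eq_left]
        intro e he
        exact ((hb.mem_iff e).1 (hm he)).resolve_left fun h => hbm (h ▸ he)
      exact this ▸ hKm'

theorem Fam.of_superset_pol (hK : c.Fam K) (hm : K m) (hmw : c.evs m ⊆ c.evs w)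
    (hO : ∀ a ∈ c.evs w, a ∉ c.evs m → c.polEv a = .O) : K w := by
  have hc : c.Chain (fun u => c.evs m ⊆ c.evs u) m w :=
    (c.chain_of_subset_game hmw).mono fun _ hu _ _ => hu.1
  clear hmw
  induction hc with
  | refl => exact hm
  | tail _ h2 ih =>
    obtain ⟨h3, h4, a, ha⟩ := h2
    exact hK.recep (ih fun b hb hb' => hO b (ha.subset hb) hb') ha
      (hO a ha.mem fun h => ha.1 (h3 h))

end AsyncGame.Conf

section

variable {A B : AsyncGame} {a : Conf A} {b : Conf B} {K : (A.dual.prod B).V → Prop}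

/-- Seen from `A*`, the events of `y` missing from `x` are Proponent and can be withdrawn, while
those of `x` missing from `y` are Opponent and are received; the passage is through the meet of `x`
and `y`. -/
theorem visible_copy_left (hK : (a.dual.prod b).Fam K) (v : (A.dual.prod B).V) :
    Visible a.Copy K v ↔ K v := by
  obtain ⟨x, z⟩ := v
  constructor
  · rintro ⟨y, h1, h2⟩
    obtain ⟨m, hm⟩ := a.inter x y
    have k : K (m, z) := by
      refine hK.of_subset_pol h2 (Conf.prod_subset.2 ⟨?_, subset_rfl⟩) ?_
      · exact hm.le.trans Set.inter_subset_right
      · rintro (e | e) he he'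
        · have h3 := (h1.2 e he).resolve_left fun h =>
            he' (show e ∈ a.evs m from hm ▸ ⟨h, he⟩)
          exact congrArg Polarity.opp h3
        · exact absurd he he'
    refine hK.of_superset_pol k (Conf.prod_subset.2 ⟨?_, subset_rfl⟩) ?_
    · exact hm.le.trans Set.inter_subset_left
    · rintro (e | e) he he'
      · have h3 := (h1.1 e he).resolve_left fun h =>
          he' (show e ∈ a.evs m from hm ▸ ⟨he, h⟩)
        exact congrArg Polarity.opp h3
      · exact absurd he he'
  · exact fun h => ⟨x, ⟨fun e he => .inl he, fun e he => .inl he⟩, h⟩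

theorem visible_copy_right (hK : (a.dual.prod b).Fam K) (v : (A.dual.prod B).V) :
    Visible K b.Copy v ↔ K v := by
  obtain ⟨x, z⟩ := v
  constructor
  · rintro ⟨y, h2, h1⟩
    obtain ⟨m, hm⟩ := b.inter y z
    have k : K (x, m) := by
      refine hK.of_subset_pol h2 (Conf.prod_subset.2 ⟨subset_rfl, ?_⟩) ?_
      · exact hm.le.trans Set.inter_subset_left
      · rintro (e | e) he he'
        · exact absurd he he'
        · exact (h1.1 e he).resolve_left fun h => he' (show e ∈ b.evs m from hm ▸ ⟨he, h⟩)
    refine hK.of_superset_pol k (Conf.prod_subset.2 ⟨subset_rfl, ?_⟩) ?_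
    · exact hm.le.trans Set.inter_subset_right
    · rintro (e | e) he he'
      · exact absurd he he'
      · exact (h1.2 e he).resolve_left fun h => he' (show e ∈ b.evs m from hm ▸ ⟨h, he⟩)
  · exact fun h => ⟨z, h, ⟨fun e he => .inl he, fun e he => .inl he⟩⟩

theorem copy_self (x : A.V) : a.Copy (x, x) := ⟨fun _ h => .inl h, fun _ h => .inl h⟩

/-- Interaction with a copy-cat strategy has no deadlock, whether or not `K` is scheduled: it
follows `K` on the diagonal up to the meet `m` of `x` and `y`, then goes from `m` to `x` on the
left, then from `m` to `y` in the middle. -/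
theorem interacts_copy_left (hK : (a.dual.prod b).Fam K) : Interacts a.dual a b a.Copy K := by
  refine ⟨a.copy_fam, hK, ?_⟩
  rintro ⟨x, y, z⟩ ⟨h1, h2⟩
  obtain ⟨m, hm⟩ := a.inter x y
  have hmx : a.evs m ⊆ a.evs x := hm.le.trans Set.inter_subset_left
  have hmy : a.evs m ⊆ a.evs y := hm.le.trans Set.inter_subset_right
  have k : K (m, z) := by
    refine hK.of_subset_pol h2 (Conf.prod_subset.2 ⟨hmy, subset_rfl⟩) ?_
    rintro (e | e) he he'
    · have h3 := (h1.2 e he).resolve_left fun h => he' (show e ∈ a.evs m from hm ▸ ⟨h, he⟩)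
      exact congrArg Polarity.opp h3
    · exact absurd he he'
  -- Each step of `K` in `A` is doubled, in an order that depends on its polarity.
  have hdiag : ∀ v, (a.dual.prod b).Chain K (A.init, B.init) v →
      (a.dual.prod (a.prod b)).Chain (Inter a.Copy K) (A.init, A.init, B.init)
        (v.1, v.1, v.2) := by
    intro v hv
    induction hv with
    | refl => exact .refl
    | @tail v w _ k2 ih =>
      obtain ⟨x, z⟩ := v
      obtain ⟨x', z'⟩ := w
      obtain ⟨k3, k4, e, he⟩ := k2
      rcases e with e | e
      · obtain ⟨he', rfl⟩ := Conf.step_prod_inl.1 he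
        replace he' : a.Step x e x' := he'
        cases hp : a.polEv e with
        | O =>
          have k5 : a.Copy (x, x') := (copy_self (a := a) x).step_right he' (.inr hp)
          exact .tail (.tail ih ⟨⟨copy_self (a := a) x, k3⟩, ⟨k5, k4⟩, _,
            (he'.prod_left z').prod_right x⟩)
            ⟨⟨k5, k4⟩, ⟨copy_self (a := a) x', k4⟩, _, Conf.Step.prod_left (c := a.dual) he' _⟩
        | P =>
          have k5 : a.Copy (x', x) := (copy_self (a := a) x).step_left he' (.inr hp)
          exact .tail (.tail ih ⟨⟨copy_self (a := a) x, k3⟩, ⟨k5, k3⟩, _,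
            Conf.Step.prod_left (c := a.dual) he' _⟩)
            ⟨⟨k5, k3⟩, ⟨copy_self (a := a) x', k4⟩, _, (he'.prod_left z').prod_right x'⟩
      · obtain ⟨rfl, he'⟩ := Conf.step_prod_inr.1 he
        exact .tail ih ⟨⟨copy_self (a := a) x', k3⟩, ⟨copy_self (a := a) x', k4⟩, _,
          Conf.Step.prod_right (c := a.dual) x' (Conf.Step.prod_right (c := a) x' he')⟩
  refine Relation.ReflTransGen.trans (hdiag _ (hK.chain _ k)) (Relation.ReflTransGen.trans
    (b := (x, m, z)) ?_ ?_)
  · refine Conf.Chain.map (d := a.dual.prod (a.prod b)) (f := fun u => (u, m, z))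
      (fun u e u' he => ⟨_, Conf.Step.prod_left (c := a.dual) he _⟩) ?_ (a.chain_of_subset_game hmx)
    rintro u ⟨h3, h4⟩
    refine ⟨⟨fun e he => ?_, fun e he => .inl (h3 he)⟩, k⟩
    exact (h1.1 e (h4 he)).imp_left fun h => hm ▸ ⟨h4 he, h⟩
  · have hc := (hK.chain _ k).of_subset hK.res (hK.chain _ h2)
      (Conf.prod_subset.2 ⟨hmy, subset_rfl⟩)
    refine Conf.Chain.map (c := a.dual.prod b) (d := a.dual.prod (a.prod b))
      (K' := Inter a.Copy K) (f := fun u => (x, u))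
      (fun u e u' he => ⟨.inr e, Conf.Step.prod_right (c := a.dual) (d := a.prod b) x he⟩)
      (fun u hu => hu) (hc.mono (K' := fun u : A.V × B.V => a.Copy (x, u.1) ∧ K u) ?_)
    intro u hu h3 h4
    have h3 := (Conf.prod_subset.1 h3).1
    have h4 := (Conf.prod_subset.1 h4).1
    refine ⟨⟨fun e he => ?_, fun e he => h1.2 e (h4 he)⟩, hu⟩
    exact (h1.1 e he).imp_left fun h => h3 (show e ∈ a.evs m from hm ▸ ⟨he, h⟩)

theorem interacts_copy_right (hK : (a.dual.prod b).Fam K) : Interacts a.dual b b K b.Copy := by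
  refine ⟨hK, b.copy_fam, ?_⟩
  rintro ⟨x, y, z⟩ ⟨h2, h1⟩
  obtain ⟨m, hm⟩ := b.inter y z
  have hmy : b.evs m ⊆ b.evs y := hm.le.trans Set.inter_subset_left
  have hmz : b.evs m ⊆ b.evs z := hm.le.trans Set.inter_subset_right
  have k : K (x, m) := by
    refine hK.of_subset_pol h2 (Conf.prod_subset.2 ⟨subset_rfl, hmy⟩) ?_
    rintro (e | e) he he'
    · exact absurd he he'
    · exact (h1.1 e he).resolve_left fun h => he' (show e ∈ b.evs m from hm ▸ ⟨he, h⟩)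
  have hdiag : ∀ v, (a.dual.prod b).Chain K (A.init, B.init) v →
      (a.dual.prod (b.prod b)).Chain (Inter K b.Copy) (A.init, B.init, B.init)
        (v.1, v.2, v.2) := by
    intro v hv
    induction hv with
    | refl => exact .refl
    | @tail v w _ k2 ih =>
      obtain ⟨x, z⟩ := v
      obtain ⟨x', z'⟩ := w
      obtain ⟨k3, k4, e, he⟩ := k2
      rcases e with e | e
      · obtain ⟨he', rfl⟩ := Conf.step_prod_inl.1 he
        exact .tail ih ⟨⟨k3, copy_self z'⟩, ⟨k4, copy_self z'⟩, _, he'.prod_left _⟩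
      · obtain ⟨rfl, he'⟩ := Conf.step_prod_inr.1 he
        cases hp : b.polEv e with
        | O =>
          have k5 : b.Copy (z, z') := (copy_self (a := b) z).step_right he' (.inr hp)
          exact .tail (.tail ih ⟨⟨k3, copy_self z⟩, ⟨k3, k5⟩, _, (he'.prod_right z).prod_right x'⟩)
            ⟨⟨k3, k5⟩, ⟨k4, copy_self z'⟩, _, (he'.prod_left z').prod_right x'⟩
        | P =>
          have k5 : b.Copy (z', z) := (copy_self (a := b) z).step_left he' (.inr hp)
          exact .tail (.tail ih ⟨⟨k3, copy_self z⟩, ⟨k4, k5⟩, _, (he'.prod_left z).prod_right x'⟩)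
            ⟨⟨k4, k5⟩, ⟨k4, copy_self z'⟩, _, (he'.prod_right z').prod_right x'⟩
  refine Relation.ReflTransGen.trans (hdiag _ (hK.chain _ k)) (Relation.ReflTransGen.trans
    (b := (x, m, z)) ?_ ?_)
  · refine Conf.Chain.map (d := a.dual.prod (b.prod b)) (f := fun u => (x, m, u))
      (fun u e u' he => ⟨_, (he.prod_right m).prod_right x⟩) ?_ (b.chain_of_subset_game hmz)
    rintro u ⟨h3, h4⟩
    refine ⟨k, fun e he => .inl (h3 he), fun e he => ?_⟩
    exact (h1.2 e (h4 he)).imp_left fun h => hm ▸ ⟨h, h4 he⟩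
  · have hc := (hK.chain _ k).of_subset hK.res (hK.chain _ h2)
      (Conf.prod_subset.2 ⟨subset_rfl, hmy⟩)
    refine Conf.Chain.map (c := a.dual.prod b) (d := a.dual.prod (b.prod b))
      (K' := Inter K b.Copy) (f := fun u => (u.1, u.2, z)) (fun u e u' he => ?_)
      (fun u hu => hu) (hc.mono (K' := fun u => K u ∧ b.Copy (u.2, z)) ?_)
    · obtain ⟨x, y⟩ := u
      obtain ⟨x', y'⟩ := u'
      rcases e with e | e
      · obtain ⟨he', rfl⟩ := Conf.step_prod_inl.1 he
        exact ⟨_, he'.prod_left _⟩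
      · obtain ⟨rfl, he'⟩ := Conf.step_prod_inr.1 he
        exact ⟨_, (he'.prod_left z).prod_right _⟩
    intro u hu h3 h4
    have h3 := (Conf.prod_subset.1 h3).2
    have h4 := (Conf.prod_subset.1 h4).2
    refine ⟨hu, fun e he => h1.1 e (h4 he), fun e he => ?_⟩
    exact (h1.2 e he).imp_left fun h => h3 (show e ∈ b.evs m from hm ▸ ⟨h, he⟩)

end

theorem AsyncGame.Strategy.PlaysIn.ext {G : AsyncGame} {σ τ : Strategy G} {K K' : G.V → Prop}
    (hσ : σ.PlaysIn K) (hτ : τ.PlaysIn K') (h : ∀ v, K v ↔ K' v) : σ = τ := by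
  obtain rfl : K = K' := funext fun v => propext (h v)
  exact Strategy.ext (Set.ext fun s => (hσ s).trans (hτ s).symm)

theorem copycat_comp {A B : AsyncGame} (a : Conf A) (b : Conf B) {σ : Strategy (A.dual.prod B)}
    (hσ : σ.IsIngenuous) : (copycat A).comp σ = σ := by
  obtain ⟨p, f⟩ := hσ.fam (a.dual.prod b)
  exact ((interacts_copy_left f).comp_playsIn a.copycat_playsIn p).ext p (visible_copy_left f)

theorem comp_copycat {A B : AsyncGame} (a : Conf A) (b : Conf B) {σ : Strategy (A.dual.prod B)}
    (hσ : σ.IsIngenuous) : σ.comp (copycat B) = σ := by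
  obtain ⟨p, f⟩ := hσ.fam (a.dual.prod b)
  exact ((interacts_copy_right f).comp_playsIn p b.copycat_playsIn).ext p (visible_copy_right f)

end AsyncConc

/-! ### Associativity of composition -/

namespace AsyncConc
open AsyncGame

namespace AsyncGame

/-- The two paths are interleaved: transitions private to one of them are played as they come,
shared ones are synchronised. -/
theorem exists_zip {R U W : AsyncGame} {Z : Type} {pU : R.V → U.V} {pW : R.V → W.V}
    {qU : R.E → Option U.E} {qW : R.E → Option W.E} {gU : U.E → Option Z} {gW : W.E → Option Z}
    (hU : IsGraphProj pU qU) (hW : IsGraphProj pW qW)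
    (liftU : ∀ r e, U.src e = pU r → gU e = none →
      ∃ e', R.src e' = r ∧ qU e' = some e ∧ qW e' = none)
    (liftW : ∀ r f, W.src f = pW r → gW f = none →
      ∃ e', R.src e' = r ∧ qU e' = none ∧ qW e' = some f)
    (liftUW : ∀ r e f z, U.src e = pU r → W.src f = pW r → gU e = some z → gW f = some z →
      ∃ e', R.src e' = r ∧ qU e' = some e ∧ qW e' = some f)
    {u : List U.E} {w : List W.E} {r : R.V} {v : U.V} {v' : W.V} (hu : U.Path (pU r) u v)
    (hw : W.Path (pW r) w v') (huw : u.filterMap gU = w.filterMap gW) :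
    ∃ l r', R.Path r l r' ∧ l.filterMap qU = u ∧ l.filterMap qW = w := by
  induction hn : u.length + w.length using Nat.strong_induction_on generalizing u w r with
  | _ n ih =>
    subst hn
    have stepW : ∀ f w', w = f :: w' → gW f = none →
        ∃ l r', R.Path r l r' ∧ l.filterMap qU = u ∧ l.filterMap qW = w := by
      rintro f w' rfl hf
      rw [List.filterMap_cons_none hf] at huw
      obtain ⟨e', rfl, h2, h3⟩ := liftW r f hw.1 hf
      obtain ⟨l, r', h4, h5, h6⟩ := ih _ (by simp) (r := R.tgt e') (u := u) (w := w')
        (by rw [← hU.none e' h2]; exact hu) (by rw [← (hW.some e' f h3).2]; exact hw.2) huw rfl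
      exact ⟨e' :: l, r', ⟨rfl, h4⟩, by rw [List.filterMap_cons_none h2, h5],
        by rw [List.filterMap_cons_some h3, h6]⟩
    cases u with
    | nil =>
      cases w with
      | nil => exact ⟨[], r, rfl, rfl, rfl⟩
      | cons f w =>
        refine stepW f w rfl ?_
        cases hf : gW f with
        | none => rfl
        | some z => rw [List.filterMap_cons_some hf] at huw; cases huw
    | cons e u =>
      cases he : gU e with
      | none =>
        rw [List.filterMap_cons_none he] at huw
        obtain ⟨e', rfl, h2, h3⟩ := liftU r e hu.1 he
        obtain ⟨l, r', h4, h5, h6⟩ := ih _ (by simp) (r := R.tgt e') (u := u) (w := w)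
          (by rw [← (hU.some e' e h2).2]; exact hu.2) (by rw [← hW.none e' h3]; exact hw) huw rfl
        exact ⟨e' :: l, r', ⟨rfl, h4⟩, by rw [List.filterMap_cons_some h2, h5],
          by rw [List.filterMap_cons_none h3, h6]⟩
      | some z =>
        cases w with
        | nil => rw [List.filterMap_cons_some he] at huw; cases huw
        | cons f w =>
          cases hf : gW f with
          | none => exact stepW f w rfl hf
          | some z' =>
            rw [List.filterMap_cons_some he, List.filterMap_cons_some hf] at huw
            obtain ⟨rfl, huw'⟩ := List.cons.inj huw
            obtain ⟨e', rfl, h2, h3⟩ := liftUW r e f z hu.1 hw.1 he hf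
            obtain ⟨l, r', h4, h5, h6⟩ := ih _ (by simp; omega) (r := R.tgt e') (u := u) (w := w)
              (by rw [← (hU.some e' e h2).2]; exact hu.2)
              (by rw [← (hW.some e' f h3).2]; exact hw.2) huw' rfl
            exact ⟨e' :: l, r', ⟨rfl, h4⟩, by rw [List.filterMap_cons_some h2, h5],
              by rw [List.filterMap_cons_some h3, h6]⟩

variable (A B C D : AsyncGame)

/-- The part of a transition of `A ∥ (B ∥ (C ∥ D))` that is visible in `A ∥ (B ∥ C)`. -/
def projABC : (A.prod (B.prod (C.prod D))).E → Option (A.prod (B.prod C)).E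
  | .inl (m, (y, (z, _))) => some (.inl (m, (y, z)))
  | .inr (x, .inl (n, (z, _))) => some (.inr (x, .inl (n, z)))
  | .inr (x, .inr (y, .inl (p, _))) => some (.inr (x, .inr (y, p)))
  | .inr (_, .inr (_, .inr _)) => none

/-- The part of a transition of `A ∥ (B ∥ (C ∥ D))` that is visible in `A ∥ (B ∥ D)`. -/
def projABD : (A.prod (B.prod (C.prod D))).E → Option (A.prod (B.prod D)).E
  | .inl (m, (y, (_, t))) => some (.inl (m, (y, t)))
  | .inr (x, .inl (n, (_, t))) => some (.inr (x, .inl (n, t)))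
  | .inr (_, .inr (_, .inl _)) => none
  | .inr (x, .inr (y, .inr (_, q))) => some (.inr (x, .inr (y, q)))

/-- The part of a transition of `A ∥ (B ∥ (C ∥ D))` that is visible in `A ∥ (C ∥ D)`. -/
def projACD : (A.prod (B.prod (C.prod D))).E → Option (A.prod (C.prod D)).E
  | .inl (m, (_, w)) => some (.inl (m, w))
  | .inr (_, .inl _) => none
  | .inr (x, .inr (_, e)) => some (.inr (x, e))

/-- The part of a transition of `A ∥ (B ∥ (C ∥ D))` that is visible in `B ∥ (C ∥ D)`. -/
def projBCD : (A.prod (B.prod (C.prod D))).E → Option (B.prod (C.prod D)).E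
  | .inl _ => none
  | .inr (_, e) => some e

theorem isGraphProj_projABC : IsGraphProj (G := A.prod (B.prod (C.prod D)))
    (H := A.prod (B.prod C)) (fun v => (v.1, v.2.1, v.2.2.1)) (projABC A B C D) where
  none := by
    rintro (⟨m, y, z, t⟩ | ⟨x, ⟨n, z, t⟩ | ⟨y, ⟨p, t⟩ | ⟨z, q⟩⟩⟩) h <;> first | rfl | cases h
  some := by
    rintro (⟨m, y, z, t⟩ | ⟨x, ⟨n, z, t⟩ | ⟨y, ⟨p, t⟩ | ⟨z, q⟩⟩⟩) e' h <;> cases h <;>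
      exact ⟨rfl, rfl⟩

theorem isGraphProj_projABD : IsGraphProj (G := A.prod (B.prod (C.prod D)))
    (H := A.prod (B.prod D)) (fun v => (v.1, v.2.1, v.2.2.2)) (projABD A B C D) where
  none := by
    rintro (⟨m, y, z, t⟩ | ⟨x, ⟨n, z, t⟩ | ⟨y, ⟨p, t⟩ | ⟨z, q⟩⟩⟩) h <;> first | rfl | cases h
  some := by
    rintro (⟨m, y, z, t⟩ | ⟨x, ⟨n, z, t⟩ | ⟨y, ⟨p, t⟩ | ⟨z, q⟩⟩⟩) e' h <;> cases h <;>
      exact ⟨rfl, rfl⟩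

theorem isGraphProj_projACD : IsGraphProj (G := A.prod (B.prod (C.prod D)))
    (H := A.prod (C.prod D)) (fun v => (v.1, v.2.2)) (projACD A B C D) where
  none := by
    rintro (⟨m, y, z, t⟩ | ⟨x, ⟨n, z, t⟩ | ⟨y, ⟨p, t⟩ | ⟨z, q⟩⟩⟩) h <;> first | rfl | cases h
  some := by
    rintro (⟨m, y, z, t⟩ | ⟨x, ⟨n, z, t⟩ | ⟨y, ⟨p, t⟩ | ⟨z, q⟩⟩⟩) e' h <;> cases h <;>
      exact ⟨rfl, rfl⟩

theorem isGraphProj_projBCD : IsGraphProj (G := A.prod (B.prod (C.prod D)))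
    (H := B.prod (C.prod D)) (fun v => v.2) (projBCD A B C D) where
  none := by
    rintro (⟨m, y, z, t⟩ | ⟨x, ⟨n, z, t⟩ | ⟨y, ⟨p, t⟩ | ⟨z, q⟩⟩⟩) h <;> first | rfl | cases h
  some := by
    rintro (⟨m, y, z, t⟩ | ⟨x, ⟨n, z, t⟩ | ⟨y, ⟨p, t⟩ | ⟨z, q⟩⟩⟩) e' h <;> cases h <;>
      exact ⟨rfl, rfl⟩

theorem filterMap_comm {α β β' γ : Type} {f : α → Option β} {g : β → Option γ}
    {f' : α → Option β'} {g' : β' → Option γ} (h : ∀ a, (f a).bind g = (f' a).bind g')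
    (l : List α) : (l.filterMap f).filterMap g = (l.filterMap f').filterMap g' := by
  rw [List.filterMap_filterMap, List.filterMap_filterMap, funext h]

variable {A B C D}

section

variable (l : List (A.prod (B.prod (C.prod D))).E)

theorem filterMap_projAB : (l.filterMap (projABC A B C D)).filterMap (projAB A B C) =
    (l.filterMap (projABD A B C D)).filterMap (projAB A B D) :=
  filterMap_comm (by
    rintro (⟨m, y, z, t⟩ | ⟨x, ⟨n, z, t⟩ | ⟨y, ⟨p, t⟩ | ⟨z, q⟩⟩⟩) <;> rfl) l

theorem filterMap_projBC : (l.filterMap (projABC A B C D)).filterMap (projBC A B C) =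
    (l.filterMap (projBCD A B C D)).filterMap (projAB B C D) :=
  filterMap_comm (by
    rintro (⟨m, y, z, t⟩ | ⟨x, ⟨n, z, t⟩ | ⟨y, ⟨p, t⟩ | ⟨z, q⟩⟩⟩) <;> rfl) l

theorem filterMap_projAC : (l.filterMap (projABC A B C D)).filterMap (projAC A B C) =
    (l.filterMap (projACD A B C D)).filterMap (projAB A C D) :=
  filterMap_comm (by
    rintro (⟨m, y, z, t⟩ | ⟨x, ⟨n, z, t⟩ | ⟨y, ⟨p, t⟩ | ⟨z, q⟩⟩⟩) <;> rfl) l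

theorem filterMap_projCD : (l.filterMap (projACD A B C D)).filterMap (projBC A C D) =
    (l.filterMap (projBCD A B C D)).filterMap (projBC B C D) :=
  filterMap_comm (by
    rintro (⟨m, y, z, t⟩ | ⟨x, ⟨n, z, t⟩ | ⟨y, ⟨p, t⟩ | ⟨z, q⟩⟩⟩) <;> rfl) l

theorem filterMap_projAD : (l.filterMap (projACD A B C D)).filterMap (projAC A C D) =
    (l.filterMap (projABD A B C D)).filterMap (projAC A B D) :=
  filterMap_comm (by
    rintro (⟨m, y, z, t⟩ | ⟨x, ⟨n, z, t⟩ | ⟨y, ⟨p, t⟩ | ⟨z, q⟩⟩⟩) <;> rfl) l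

theorem filterMap_projBD : (l.filterMap (projABD A B C D)).filterMap (projBC A B D) =
    (l.filterMap (projBCD A B C D)).filterMap (projAC B C D) :=
  filterMap_comm (by
    rintro (⟨m, y, z, t⟩ | ⟨x, ⟨n, z, t⟩ | ⟨y, ⟨p, t⟩ | ⟨z, q⟩⟩⟩) <;> rfl) l

end

theorem exists_zip_left {u : List (A.prod (B.prod C)).E} {w : List (A.prod (C.prod D)).E}
    (hu : (A.prod (B.prod C)).IsPlay u) (hw : (A.prod (C.prod D)).IsPlay w)
    (h : u.filterMap (projAC A B C) = w.filterMap (projAB A C D)) :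
    ∃ l, (A.prod (B.prod (C.prod D))).IsPlay l ∧ l.filterMap (projABC A B C D) = u ∧
      l.filterMap (projACD A B C D) = w := by
  obtain ⟨v, hu⟩ := hu
  obtain ⟨v', hw⟩ := hw
  refine Exists.elim (exists_zip (isGraphProj_projABC A B C D)
    (isGraphProj_projACD A B C D) (r := (A.init, B.init, C.init, D.init))
    (gU := projAC A B C) (gW := projAB A C D) ?_ ?_ ?_ hu hw h)
    fun l ⟨r, h1, h2⟩ => ⟨l, ⟨r, h1⟩, h2⟩
  · rintro ⟨x, y, z, t⟩ (⟨m, y', z'⟩ | ⟨x', ⟨n, z'⟩ | ⟨y', p⟩⟩) hs hg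
    · cases hg
    · cases hs
      exact ⟨.inr (x, .inl (n, z, t)), rfl, rfl, rfl⟩
    · cases hg
  · rintro ⟨x, y, z, t⟩ (⟨m, z', t'⟩ | ⟨x', ⟨p, t'⟩ | ⟨z', q⟩⟩) hs hg
    · cases hg
    · cases hg
    · cases hs
      exact ⟨.inr (x, .inr (y, .inr (z, q))), rfl, rfl, rfl⟩
  · rintro ⟨x, y, z, t⟩ (⟨m, y', z'⟩ | ⟨x', ⟨n, z'⟩ | ⟨y', p⟩⟩)
      (⟨m', z'', t'⟩ | ⟨x'', ⟨p', t'⟩ | ⟨z'', q⟩⟩) e hs hs' hg hg' <;> cases hg <;> cases hg'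
    · cases hs; cases hs'
      exact ⟨.inl (m, y, z, t), rfl, rfl, rfl⟩
    · cases hs; cases hs'
      exact ⟨.inr (x, .inr (y, .inl (p, t))), rfl, rfl, rfl⟩

theorem exists_zip_right {w : List (A.prod (B.prod D)).E} {u : List (B.prod (C.prod D)).E}
    (hw : (A.prod (B.prod D)).IsPlay w) (hu : (B.prod (C.prod D)).IsPlay u)
    (h : w.filterMap (projBC A B D) = u.filterMap (projAC B C D)) :
    ∃ l, (A.prod (B.prod (C.prod D))).IsPlay l ∧ l.filterMap (projABD A B C D) = w ∧
      l.filterMap (projBCD A B C D) = u := by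
  obtain ⟨v, hu⟩ := hu
  obtain ⟨v', hw⟩ := hw
  refine Exists.elim (exists_zip (isGraphProj_projABD A B C D)
    (isGraphProj_projBCD A B C D) (r := (A.init, B.init, C.init, D.init))
    (gU := projBC A B D) (gW := projAC B C D) ?_ ?_ ?_ hw hu h)
    fun l ⟨r, h1, h2⟩ => ⟨l, ⟨r, h1⟩, h2⟩
  · rintro ⟨x, y, z, t⟩ (⟨m, y', t'⟩ | ⟨x', ⟨n, t'⟩ | ⟨y', q⟩⟩) hs hg
    · cases hs
      exact ⟨.inl (m, y, z, t), rfl, rfl, rfl⟩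
    · cases hg
    · cases hg
  · rintro ⟨x, y, z, t⟩ (⟨n, z', t'⟩ | ⟨y', ⟨p, t'⟩ | ⟨z', q⟩⟩) hs hg
    · cases hg
    · cases hs
      exact ⟨.inr (x, .inr (y, .inl (p, t))), rfl, rfl, rfl⟩
    · cases hg
  · rintro ⟨x, y, z, t⟩ (⟨m, y', t'⟩ | ⟨x', ⟨n, t'⟩ | ⟨y', q⟩⟩)
      (⟨n', z', t''⟩ | ⟨y'', ⟨p, t''⟩ | ⟨z', q'⟩⟩) e hs hs' hg hg' <;> cases hg <;> cases hg'
    · cases hs; cases hs'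
      exact ⟨.inr (x, .inl (n, z, t)), rfl, rfl, rfl⟩
    · cases hs; cases hs'
      exact ⟨.inr (x, .inr (y, .inr (z, q))), rfl, rfl, rfl⟩

/-- Nested interactions are zipped into one play on the four games, which is then projected
according to the other bracketing. -/
theorem Strategy.comp_assoc (σ : Strategy (A.dual.prod B)) (τ : Strategy (B.dual.prod C))
    (υ : Strategy (C.dual.prod D)) : (σ.comp τ).comp υ = σ.comp (τ.comp υ) := by
  refine Strategy.ext (Set.ext fun s => ⟨?_, ?_⟩)
  · rintro ⟨w, ⟨hw, ⟨u, ⟨hu, h1, h2⟩, h3⟩, h4⟩, rfl⟩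
    obtain ⟨l, ⟨v, hl⟩, rfl, rfl⟩ := exists_zip_left hu hw h3
    refine ⟨l.filterMap (projABD A B C D), ⟨⟨_, (isGraphProj_projABD A B C D).path hl⟩, ?_,
      l.filterMap (projBCD A B C D), ⟨⟨_, (isGraphProj_projBCD A B C D).path hl⟩, ?_, ?_⟩, ?_⟩, ?_⟩
    · exact filterMap_projAB l ▸ h1
    · exact filterMap_projBC l ▸ h2
    · exact filterMap_projCD l ▸ h4
    · exact (filterMap_projBD l).symm
    · exact (filterMap_projAD l).symm
  · rintro ⟨w, ⟨hw, h1, ⟨u, ⟨hu, h2, h3⟩, h4⟩⟩, rfl⟩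
    obtain ⟨l, ⟨v, hl⟩, rfl, rfl⟩ := exists_zip_right hw hu h4.symm
    refine ⟨l.filterMap (projACD A B C D), ⟨⟨_, (isGraphProj_projACD A B C D).path hl⟩,
      ⟨l.filterMap (projABC A B C D), ⟨⟨_, (isGraphProj_projABC A B C D).path hl⟩, ?_, ?_⟩, ?_⟩,
      ?_⟩, ?_⟩
    · exact filterMap_projAB l ▸ h1
    · exact filterMap_projBC l ▸ h2
    · exact filterMap_projAC l
    · exact filterMap_projCD l ▸ h3
    · exact filterMap_projAD l

end AsyncGame
end AsyncConc

/-! ### The functor to concurrent games -/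

namespace AsyncConc
open AsyncGame

namespace AsyncGame.Conf

variable {G : AsyncGame} {c : Conf G} {K : G.V → Prop}

/-- By determinism, a Proponent event available at `u` either belongs to `v` or is still available
there; as `v` and `w` halt, it belongs to both, hence to `u`. -/
theorem Fam.halt_inter (hK : c.Fam K) {u v w : G.V} (hv : c.Halt K v) (hw : c.Halt K w)
    (hu : c.evs u = c.evs v ∩ c.evs w) : c.Halt K u := by
  have hKu := hK.inter _ _ _ hv.1 hw.1 hu
  refine ⟨hKu, fun a t ha ht hP => ha.1 (hu ▸ ⟨?_, ?_⟩)⟩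
  all_goals
    have key : ∀ {z}, c.Halt K z → c.evs u ⊆ c.evs z → a ∈ c.evs z := fun hz hs =>
      (((hK.chain _ hKu).of_subset hK.res (hK.chain _ hz.1) hs).push
        (fun _ _ _ _ h h1 h2 h3 h4 h5 => hK.det h h1 h2 h3 h4 h5 hP) ha ht).resolve_right
          fun ⟨t', h1, h2, _⟩ => hz.2 a t' h1 h2 hP
  · exact key hv (hu.le.trans Set.inter_subset_left)
  · exact key hw (hu.le.trans Set.inter_subset_right)

/-- The halting positions above all lower bounds of `S` are closed under binary meets; the least of
them is the meet of `S`. -/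
theorem Fam.exists_halt_glb (hK : c.Fam K) {S : Set G.V} (hS : S.Nonempty)
    (h : ∀ v ∈ S, c.Halt K v) : ∃ m, c.Halt K m ∧ (∀ v ∈ S, c.evs m ⊆ c.evs v) ∧
      ∀ u, (∀ v ∈ S, c.evs u ⊆ c.evs v) → c.evs u ⊆ c.evs m := by
  obtain ⟨v, hv⟩ := hS
  obtain ⟨m, hm, hleast⟩ := c.exists_least
    (Q := fun v => c.Halt K v ∧ ∀ u, (∀ v ∈ S, c.evs u ⊆ c.evs v) → c.evs u ⊆ c.evs v)
    ⟨v, h v hv, fun u hu => hu v hv⟩ fun u v w hv hw hu =>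
      ⟨hK.halt_inter hv.1 hw.1 hu, fun z hz => hu ▸ Set.subset_inter (hv.2 z hz) (hw.2 z hz)⟩
  exact ⟨m, hm.1, fun v hv => hleast v ⟨h v hv, fun u hu => hu v hv⟩, hm.2⟩

/-- Strictly ascending sequences stop, so a directed set has a maximal element, which is its
greatest one. Directed joins of halting positions are thereby trivial. -/
theorem exists_greatest (c : Conf G) {S : Set G.V} (hS : S.Nonempty)
    (hd : ∀ v ∈ S, ∀ w ∈ S, ∃ u ∈ S, c.evs v ⊆ c.evs u ∧ c.evs w ⊆ c.evs u) :
    ∃ m ∈ S, ∀ v ∈ S, c.evs v ⊆ c.evs m := by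
  obtain ⟨m, hm, hmax⟩ := c.ssubset_wf.has_min S hS
  refine ⟨m, hm, fun v hv => ?_⟩
  obtain ⟨u, hu, h1, h2⟩ := hd m hm v hv
  rcases h1.eq_or_ssubset with h3 | h3
  · rw [h3]; exact h2
  · exact absurd h3 (hmax u hu)

end AsyncGame.Conf

theorem AsyncGame.Strategy.PlaysIn.mem_halting {G : AsyncGame} {σ : Strategy G} {c : Conf G}
    {K : G.V → Prop} (h : σ.PlaysIn K) (hK : c.Fam K) {v : G.V} :
    v ∈ σ.halting ↔ c.Halt K v := by
  refine (and_congr_left' (h.pos_iff hK v)).trans (and_congr_right fun hv =>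
    ⟨fun h' a w ha hw => ?_, fun h' e he hv => ?_⟩)
  · obtain ⟨e, rfl, rfl, rfl⟩ := ha.exists_edge
    rw [← c.pol_ev]
    exact h' e ((h.trans_iff hK e).2 ⟨hv, hw⟩) rfl
  · subst hv
    rw [c.pol_ev]
    exact h' _ _ (Conf.step_edge e) ((h.trans_iff hK e).1 he).2

/-- The element `⊤` accounts for the empty meet among the fixpoints, without changing the operator.
-/
theorem clop_insert_top {D : Type} [CompleteLattice D] (R : Set D) (w : D) :
    clop (insert ⊤ R) w = clop R w := by
  refine le_antisymm (sInf_le_sInf fun y hy => ⟨.inr hy.1, hy.2⟩) (le_sInf fun y hy => ?_)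
  rcases hy.1 with rfl | h
  · exact le_top
  · exact sInf_le ⟨h, hy.2⟩

section

variable {X : Type} {ρ : X → AsyncGame} (hρ : ∀ x, (ρ x).IsSequential) {A B C : Formula X}

theorem pair_le_iff {a : Conf (interp ρ A)} {b : Conf (interp ρ B)}
    {v w : (interp ρ A).V × (interp ρ B).V} :
    ConcGame.pair (P := dom ρ hρ A) (Q := dom ρ hρ B) v.1 v.2 ≤
        ConcGame.pair (P := dom ρ hρ A) (Q := dom ρ hρ B) w.1 w.2 ↔
      (a.dual.prod b).evs v ⊆ (a.dual.prod b).evs w := by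
  refine WithTop.coe_le_coe.trans (Iff.trans ?_ Conf.prodEvs_subset.symm)
  exact and_congr a.reach_iff b.reach_iff

theorem pair_mem_haltSet {σ : Strat ρ A B} {x : (interp ρ A).V} {y : (interp ρ B).V} :
    ConcGame.pair (P := dom ρ hρ A) (Q := dom ρ hρ B) x y ∈ insert ⊤ (haltSet hρ σ) ↔
      (x, y) ∈ σ.halting := by
  constructor
  · rintro (h | ⟨x', y', h, h'⟩)
    · exact absurd h WithTop.coe_ne_top
    · obtain ⟨rfl, rfl⟩ := ConcGame.pair_inj.1 h'
      exact h
  · exact fun h => .inr ⟨x, y, h, rfl⟩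

theorem sInf_mem_haltSet {σ : Strat ρ A B} (hσ : σ.IsIngenuous)
    (s : Set (ConcGame.Dom (dom ρ hρ A) (dom ρ hρ B))) (hs : s ⊆ insert ⊤ (haltSet hρ σ)) :
    sInf s ∈ insert ⊤ (haltSet hρ σ) := by
  obtain ⟨swA⟩ := nonempty_swConf hρ A
  obtain ⟨swB⟩ := nonempty_swConf hρ B
  obtain ⟨p, f⟩ := hσ.fam (swA.conf.dual.prod swB.conf)
  let S : Set ((interp ρ A).V × (interp ρ B).V) :=
    {v | ConcGame.pair (P := dom ρ hρ A) (Q := dom ρ hρ B) v.1 v.2 ∈ s}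
  by_cases hS : S.Nonempty
  · obtain ⟨m, h1, h2, h3⟩ := f.exists_halt_glb hS
      fun v hv => (p.mem_halting f).1 ((pair_mem_haltSet hρ).1 (hs hv))
    have h4 : IsGLB s (ConcGame.pair (P := dom ρ hρ A) (Q := dom ρ hρ B) m.1 m.2) := by
      refine ⟨fun w hw => ?_, fun w hw => ?_⟩
      · induction w using WithTop.recTopCoe with
        | top => exact le_top
        | coe v => exact (pair_le_iff hρ).2 (h2 v hw)
      · obtain ⟨v, hv⟩ := hS
        induction w using WithTop.recTopCoe with
        | top => exact absurd (top_le_iff.1 (hw hv)) WithTop.coe_ne_top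
        | coe w => exact (pair_le_iff hρ).2 (h3 w fun u hu => (pair_le_iff hρ).1 (hw hu))
    rw [h4.sInf_eq]
    exact (pair_mem_haltSet hρ).2 ((p.mem_halting f).2 h1)
  · refine .inl (top_le_iff.1 (le_sInf fun w hw => ?_))
    induction w using WithTop.recTopCoe with
    | top => exact le_rfl
    | coe v => exact absurd ⟨v, hw⟩ hS

theorem sSup_mem_haltSet {σ : Strat ρ A B}
    (s : Set (ConcGame.Dom (dom ρ hρ A) (dom ρ hρ B))) (hs : s ⊆ insert ⊤ (haltSet hρ σ))
    (hne : s.Nonempty) (hd : DirectedOn (· ≤ ·) s) : sSup s ∈ insert ⊤ (haltSet hρ σ) := by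
  obtain ⟨swA⟩ := nonempty_swConf hρ A
  obtain ⟨swB⟩ := nonempty_swConf hρ B
  by_cases htop : ⊤ ∈ s
  · exact .inl (top_le_iff.1 (le_sSup htop))
  have hcoe : ∀ w ∈ s, ∃ v : (interp ρ A).V × (interp ρ B).V,
      w = ConcGame.pair (P := dom ρ hρ A) (Q := dom ρ hρ B) v.1 v.2 := fun w hw => by
    induction w using WithTop.recTopCoe with
    | top => exact absurd hw htop
    | coe v => exact ⟨v, rfl⟩
  obtain ⟨w, hw⟩ := hne
  obtain ⟨v, rfl⟩ := hcoe w hw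
  obtain ⟨m, hm, hmax⟩ := (swA.conf.dual.prod swB.conf).exists_greatest
    (S := {v | ConcGame.pair (P := dom ρ hρ A) (Q := dom ρ hρ B) v.1 v.2 ∈ s}) ⟨v, hw⟩
    fun v hv w hw => by
      obtain ⟨u, hu, h1, h2⟩ := hd _ hv _ hw
      obtain ⟨u, rfl⟩ := hcoe u hu
      exact ⟨u, hu, (pair_le_iff hρ).1 h1, (pair_le_iff hρ).1 h2⟩
  have : IsLUB s (ConcGame.pair (P := dom ρ hρ A) (Q := dom ρ hρ B) m.1 m.2) := by
    refine ⟨fun w hw => ?_, fun w hw => hw hm⟩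
    obtain ⟨v, rfl⟩ := hcoe w hw
    exact (pair_le_iff hρ).2 (hmax v hw)
  rw [this.sSup_eq]
  exact hs hm

/-- The concurrent strategy of an ingenuous strategy. -/
noncomputable def concStrategy {σ : Strat ρ A B} (hσ : σ.IsIngenuous) :
    ConcStrategy (ConcGame.Dom (dom ρ hρ A) (dom ρ hρ B)) :=
  .ofFix (insert ⊤ (haltSet hρ σ)) (sInf_mem_haltSet hρ hσ) (sSup_mem_haltSet hρ)

theorem concStrategy_copycat (h : (copycat (interp ρ A)).IsIngenuous) :
    concStrategy hρ (A := A) (B := A) h = ConcGame.idStrategy (dom ρ hρ A) := by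
  refine ConcStrategy.ext_fix ?_
  rw [concStrategy, ConcGame.idStrategy, ConcStrategy.fix_ofFix, ConcStrategy.fix_ofFix]
  obtain ⟨sw⟩ := nonempty_swConf hρ A
  ext w
  induction w using WithTop.recTopCoe with
  | top => exact iff_of_true (.inl rfl) (.inl rfl)
  | coe v =>
    refine (pair_mem_haltSet hρ).trans (((sw.conf.copycat_playsIn).mem_halting
      sw.conf.copy_fam).trans (Conf.halt_copy.trans ⟨fun h => .inr ⟨v.1, ?_⟩, ?_⟩))
    · exact ConcGame.pair_inj.2 ⟨rfl, h.symm⟩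
    · rintro (h | ⟨x, h⟩)
      · exact absurd h WithTop.coe_ne_top
      · obtain ⟨h1, h2⟩ := ConcGame.pair_inj.1 h
        exact h1.trans h2.symm

/-- A concurrent strategy is determined by its fixpoints, and on fixpoints this is
`Interacts.halt_iff`. -/
theorem concStrategy_comp {σ : Strat ρ A B} {τ : Strat ρ B C} (hσ : σ.IsIngenuous)
    (hσ' : Scheduled σ) (hτ : τ.IsIngenuous) (hτ' : Scheduled τ) (h : (σ.comp τ).IsIngenuous) :
    concStrategy hρ (A := A) (B := C) h =
      ConcGame.compStrategy (concStrategy hρ hσ) (concStrategy hρ hτ) := by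
  refine ConcStrategy.ext_fix ?_
  rw [ConcGame.compStrategy, concStrategy, concStrategy, concStrategy, ConcStrategy.fix_ofFix,
    ConcStrategy.fix_ofFix, ConcStrategy.fix_ofFix, ConcStrategy.fix_ofFix]
  have := nonempty_switching A
  have := nonempty_switching B
  have := nonempty_switching C
  obtain ⟨swA⟩ := nonempty_swConf hρ A
  obtain ⟨swB⟩ := nonempty_swConf hρ B
  obtain ⟨swC⟩ := nonempty_swConf hρ C
  obtain ⟨pσ, fσ⟩ := hσ.fam (swA.conf.dual.prod swB.conf)
  obtain ⟨pτ, fτ⟩ := hτ.fam (swB.conf.dual.prod swC.conf)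
  obtain ⟨h1, h2, -⟩ := SchedFam.comp (jointlyWF_before ρ B) fσ fτ
    ((schedFam_iff swA swB pσ fσ).1 hσ') ((schedFam_iff swB swC pτ fτ).1 hτ')
  ext w
  induction w using WithTop.recTopCoe with
  | top => exact iff_of_true (.inl rfl) (.inl rfl)
  | coe v =>
    refine (pair_mem_haltSet hρ).trans ((((h1.comp_playsIn pσ pτ).mem_halting h2).trans
      h1.halt_iff).trans (Iff.symm (ConcGame.pair_mem_compFix.trans ?_)))
    exact exists_congr fun y => and_congr ((pair_mem_haltSet hρ).trans (pσ.mem_halting fσ))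
      ((pair_mem_haltSet hρ).trans (pτ.mem_halting fτ))

end

end AsyncConc

open AsyncConc AsyncGame CategoryTheory in
theorem theorem2 {X : Type} (ρ : X → AsyncGame) (hρ : ∀ x, (ρ x).IsSequential) :
    -- identities
    (∀ A : Formula X,
      (copycat (interp ρ A)).IsIngenuous ∧
        Scheduled (ρ := ρ) (A := A) (B := A) (copycat (interp ρ A))) ∧
    -- closure under composition
    (∀ (A B C : Formula X) (σ : Strat ρ A B) (τ : Strat ρ B C),
      σ.IsIngenuous → Scheduled σ → τ.IsIngenuous → Scheduled τ →
        (σ.comp τ).IsIngenuous ∧ Scheduled (ρ := ρ) (A := A) (B := C) (σ.comp τ)) ∧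
    -- the laws of a category
    (∀ (A B : Formula X) (σ : Strat ρ A B), σ.IsIngenuous →
      (copycat (interp ρ A)).comp σ = σ ∧ σ.comp (copycat (interp ρ B)) = σ) ∧
    (∀ (A B C D : Formula X) (σ : Strat ρ A B) (τ : Strat ρ B C) (υ : Strat ρ C D),
      σ.IsIngenuous → τ.IsIngenuous → υ.IsIngenuous →
        (σ.comp τ).comp υ = σ.comp (τ.comp υ)) ∧
    -- the functor to concurrent games
    (∃ F : ∀ A B : Formula X, {σ : Strat ρ A B // σ.IsIngenuous ∧ Scheduled σ} →
        (dom ρ hρ A ⟶ dom ρ hρ B),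
      (∀ (A B : Formula X) (σ : {σ : Strat ρ A B // σ.IsIngenuous ∧ Scheduled σ})
        (w : ConcGame.Dom (dom ρ hρ A) (dom ρ hρ B)),
        ConcStrategy.toClosureOperator (F A B σ) w = clop (haltSet hρ σ.1) w) ∧
      (∀ A h, F A A ⟨copycat (interp ρ A), h⟩ = 𝟙 (dom ρ hρ A)) ∧
      (∀ (A B C : Formula X) (σ : {σ : Strat ρ A B // σ.IsIngenuous ∧ Scheduled σ})
        (τ : {τ : Strat ρ B C // τ.IsIngenuous ∧ Scheduled τ}) h,
        F A C ⟨σ.1.comp τ.1, h⟩ = F A B σ ≫ F B C τ)) := by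
  refine ⟨copycat_isIngenuous hρ, fun A B C σ τ => comp_isIngenuous hρ, fun A B σ hσ => ?_,
    fun A B C D σ τ υ _ _ _ => Strategy.comp_assoc σ τ υ,
    fun A B σ => concStrategy hρ σ.2.1, fun A B σ w => clop_insert_top _ w,
    fun A h => concStrategy_copycat hρ h.1,
    fun A B C σ τ h => concStrategy_comp hρ σ.2.1 σ.2.2 τ.2.1 τ.2.2 h.1⟩
  obtain ⟨swA⟩ := nonempty_swConf hρ A
  obtain ⟨swB⟩ := nonempty_swConf hρ B
  exact ⟨copycat_comp swA.conf swB.conf hσ, comp_copycat swA.conf swB.conf hσ⟩
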